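/- Let $d$ be a nonnegative integer, and let $a:\mathbb R^d\to[0,\infty)$ satisfy $a\in L^1(\mathbb R^d)\cap L^2_{\rm loc}(\mathbb R^d)$, $a(-z)=a(z)$, $\int_{\mathbb R^d}a(z)\,dz>0$ and $\int_{\mathbb R^d}|z|^2a(z)\,dz<\infty$. Let $\lambda,\mu:\mathbb R^d\to\mathbb R$ be measurable, $\mathbb Z^d$-periodic, and such that $0<\alpha_1\le\lambda(x),\mu(x)\le\alpha_2<\infty$ for all $x$, with constants $\alpha_1,\alpha_2$. For $\varepsilon>0$ define on $L^2(\mathbb R^d)$ the operator $$(L^\varepsilon u)(x)=\frac1{\varepsilon^{d+2}}\int_{\mathbb R^d}a\Big(\frac{x-y}{\varepsilon}\Big)\lambda\Big(\frac x\varepsilon\Big)\mu\Big(\frac y\varepsilon\Big)\big(u(y)-u(x)\big)\,dy .$$ Then the following holds. (i) Each $L^\varepsilon$, $\varepsilon>0$, is a bounded operator defined on all of $L^2(\mathbb R^d)$. (ii) There is a $\mathbb Z^d$-periodic vector function $\varkappa=(\varkappa^1,\dots,\varkappa^d)$ (the first-order corrector), unique up to null sets, whose components are in $L^2([0,1]^d)$,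 have zero average over $[0,1]^d$, and satisfy, for $i=1,\dots,d$ and almost every $\xi\in\mathbb R^d$, $$\int_{\mathbb R^d}a(\xi-q)\mu(q)\big(\varkappa^i(q)-\varkappa^i(\xi)\big)\,dq=\int_{\mathbb R^d}a(\xi-q)(\xi-q)^i\mu(q)\,dq ,$$ where the integral on the left converges absolutely. (iii) The matrix $\Theta=\{\Theta^{ij}\}$ defined by $$\Theta^{ij}\int_{[0,1]^d}\frac{\mu(\xi)}{\lambda(\xi)}\,d\xi=\int_{[0,1]^d}\int_{\mathbb R^d}\tfrac12(\xi-q)^i(\xi-q)^ja(\xi-q)\mu(q)\mu(\xi)\,dq\,d\xi-\int_{[0,1]^d}\int_{\mathbb R^d}a(\xi-q)\mu(q)\mu(\xi)(\xi-q)^i\varkappa^j(q)\,dq\,d\xi$$ (with absolutely convergent integrals) is symmetric and positive definite. (iv) Let $L^0u=\sum_{i,j}\Theta^{ij}\frac{\partial^2u}{\partial x^i\partial x^j}$ with domain $H^2(\mathbb R^d)$. For every $m>0$ the bounded resolvents $(L^\varepsilon-m)^{-1}$, $\varepsilon>0$, and $(L^0-m)^{-1}$ exist on $L^2(\mathbb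 R^d)$, and for every $f\in L^2(\mathbb R^d)$ $$\big\|(L^\varepsilon-m)^{-1}f-(L^0-m)^{-1}f\big\|_{L^2(\mathbb R^d)}\to0\qquad\text{as }\varepsilon\to0^+ .$$ -/

import Mathlib

open MeasureTheory Filter Topology
open scoped ContDiff

noncomputable section

namespace NonlocalHomog

/-- Euclidean space `ℝ^d`. -/
abbrev E (d : ℕ) : Type := EuclideanSpace ℝ (Fin d)

/-- The real Hilbert space `L²(ℝ^d)`. -/
abbrev L2 (d : ℕ) : Type := Lp ℝ 2 (volume : Measure (E d))

/-- The `i`-th vector of the canonical basis of `ℝ^d`. -/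
abbrev e {d : ℕ} (i : Fin d) : E d := EuclideanSpace.single i (1 : ℝ)

/-- Periodicity with respect to the lattice `ℤ^d`. -/
def IsPeriodic {d : ℕ} (g : E d → ℝ) : Prop :=
  ∀ i : Fin d, Function.Periodic g (e i)

/-- The periodicity cell `[0,1)^d`, a fundamental domain of the torus. -/
def unitCell (d : ℕ) : Set (E d) := {x | ∀ i, x i ∈ Set.Ico (0 : ℝ) 1}

/-! ### The rescaled convolution type operators -/

/-- The integrand, as a function of `y`, of the rescaled operator applied to `u` at `x`. -/
def rescaledIntegrand {d : ℕ} (a lam mu : E d → ℝ) (ε : ℝ) (u : E d → ℝ) (x y : E d) : ℝ :=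
  a (ε⁻¹ • (x - y)) * lam (ε⁻¹ • x) * mu (ε⁻¹ • y) * (u y - u x)

/-- The function `x ↦ ε^{-d-2} ∫ a((x-y)/ε) λ(x/ε) μ(y/ε) (u(y) - u(x)) dy`. -/
def rescaledFun {d : ℕ} (a lam mu : E d → ℝ) (ε : ℝ) (u : E d → ℝ) (x : E d) : ℝ :=
  (ε ^ (d + 2))⁻¹ * ∫ y, rescaledIntegrand a lam mu ε u x y

/-- `u` lies in the maximal `L²`-domain of the rescaled operator: the defining integral converges
absolutely for almost every `x` and defines a function in `L²(ℝ^d)`. -/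
def InRescaledDomain {d : ℕ} (a lam mu : E d → ℝ) (ε : ℝ) (u : L2 d) : Prop :=
  (∀ᵐ x : E d, Integrable (rescaledIntegrand a lam mu ε u x)) ∧
    MemLp (rescaledFun a lam mu ε u) 2 volume

section RescaledLemmas

variable {d : ℕ} {a lam mu : E d → ℝ} {ε : ℝ}

theorem integrand_add {u v : L2 d} :
    ∀ᵐ x : E d, rescaledIntegrand a lam mu ε (u + v : L2 d) x =ᵐ[volume]
      rescaledIntegrand a lam mu ε u x + rescaledIntegrand a lam mu ε v x := by
  have h := Lp.coeFn_add u v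
  filter_upwards [h] with x hx
  filter_upwards [h] with y hy
  simp only [rescaledIntegrand, Pi.add_apply, hx, hy]
  ring

theorem integrand_smul {c : ℝ} {u : L2 d} :
    ∀ᵐ x : E d, rescaledIntegrand a lam mu ε (c • u : L2 d) x =ᵐ[volume]
      c • rescaledIntegrand a lam mu ε u x := by
  have h := Lp.coeFn_smul c u
  filter_upwards [h] with x hx
  filter_upwards [h] with y hy
  simp only [rescaledIntegrand, Pi.smul_apply, smul_eq_mul, hx, hy]
  ring

theorem rescaledFun_add {u v : L2 d} (hu : InRescaledDomain a lam mu ε u)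
    (hv : InRescaledDomain a lam mu ε v) :
    rescaledFun a lam mu ε (u + v : L2 d) =ᵐ[volume]
      rescaledFun a lam mu ε u + rescaledFun a lam mu ε v := by
  filter_upwards [integrand_add (u := u) (v := v), hu.1, hv.1] with x hx hux hvx
  simp only [rescaledFun, Pi.add_apply]
  rw [integral_congr_ae hx, integral_add' hux hvx, mul_add]

theorem rescaledFun_smul {c : ℝ} {u : L2 d} :
    rescaledFun a lam mu ε (c • u : L2 d) =ᵐ[volume] c • rescaledFun a lam mu ε u := by
  filter_upwards [integrand_smul (c := c) (u := u)] with x hx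
  simp only [rescaledFun, Pi.smul_apply, smul_eq_mul]
  rw [integral_congr_ae hx]
  simp only [Pi.smul_apply, smul_eq_mul, integral_const_mul]
  ring

theorem InRescaledDomain.add {u v : L2 d} (hu : InRescaledDomain a lam mu ε u)
    (hv : InRescaledDomain a lam mu ε v) : InRescaledDomain a lam mu ε (u + v) := by
  refine ⟨?_, (hu.2.add hv.2).ae_eq (rescaledFun_add hu hv).symm⟩
  filter_upwards [integrand_add (u := u) (v := v), hu.1, hv.1] with x hx hux hvx
  exact (hux.add hvx).congr hx.symm

theorem InRescaledDomain.smul {u : L2 d} (c : ℝ) (hu : InRescaledDomain a lam mu ε u) :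
    InRescaledDomain a lam mu ε (c • u) := by
  refine ⟨?_, (hu.2.const_smul c).ae_eq rescaledFun_smul.symm⟩
  filter_upwards [integrand_smul (c := c) (u := u), hu.1] with x hx hux
  exact (hux.smul c).congr hx.symm

theorem inRescaledDomain_zero : InRescaledDomain a lam mu ε (0 : L2 d) := by
  have h : ∀ᵐ x : E d, rescaledIntegrand a lam mu ε (0 : L2 d) x =ᵐ[volume] fun _ => 0 := by
    filter_upwards [integrand_smul (a := a) (lam := lam) (mu := mu) (ε := ε) (c := 0)
      (u := (0 : L2 d))] with x hx
    rw [zero_smul, zero_smul] at hx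
    exact hx
  refine ⟨?_, MemLp.ae_eq (f := fun _ => 0) ?_ MemLp.zero'⟩
  · filter_upwards [h] with x hx
    exact (integrable_zero _ _ _).congr hx.symm
  · filter_upwards [h] with x hx
    rw [rescaledFun, integral_congr_ae hx, integral_zero, mul_zero]

end RescaledLemmas

/-- The rescaled operator `L^ε` in `L²(ℝ^d)`,
`(L^ε u)(x) = ε^{-d-2} ∫ a((x-y)/ε) λ(x/ε) μ(y/ε) (u(y) - u(x)) dy`, on its maximal domain. -/
def rescaledOp {d : ℕ} (a lam mu : E d → ℝ) (ε : ℝ) : L2 d →ₗ.[ℝ] L2 d where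
  domain :=
    { carrier := {u | InRescaledDomain a lam mu ε u}
      add_mem' := fun hu hv => hu.add hv
      zero_mem' := inRescaledDomain_zero
      smul_mem' := fun c _ hu => hu.smul c }
  toFun :=
    { toFun := fun u => (show InRescaledDomain a lam mu ε u.1 from u.2).2.toLp _
      map_add' := by
        intro u v
        rw [← MemLp.toLp_add, MemLp.toLp_eq_toLp_iff]
        exact rescaledFun_add u.2 v.2
      map_smul' := by
        intro c u
        rw [RingHom.id_apply, ← MemLp.toLp_const_smul, MemLp.toLp_eq_toLp_iff]
        exact rescaledFun_smul }

/-! ### The Sobolev space `H²` and the limit operator -/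

/-- `g ∈ L²` is the weak partial derivative `∂u/∂x^i` of `u ∈ L²`. -/
def HasWeakPartial {d : ℕ} (i : Fin d) (u g : L2 d) : Prop :=
  ∀ φ : E d → ℝ, ContDiff ℝ ∞ φ → HasCompactSupport φ →
    ∫ x, u x * fderiv ℝ φ x (e i) = -∫ x, g x * φ x

/-- `u ∈ L²` has weak first derivatives in `L²` and weak second derivatives
`H i j = ∂²u/∂x^i∂x^j` in `L²`. -/
def HasWeakHessian {d : ℕ} (u : L2 d) (H : Fin d → Fin d → L2 d) : Prop :=
  ∃ g : Fin d → L2 d, (∀ j, HasWeakPartial j u (g j)) ∧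
    ∀ i j, HasWeakPartial i (g j) (H i j)

section WeakLemmas

variable {d : ℕ}

theorem integrable_lp_mul (u : L2 d) {φ : E d → ℝ} (hφ : Continuous φ)
    (hs : HasCompactSupport φ) : Integrable (fun x => u x * φ x) := by
  have h2 : MemLp φ 2 (volume : Measure (E d)) := hφ.memLp_of_hasCompactSupport hs
  exact (Lp.memLp u).integrable_mul h2

theorem continuous_partial {φ : E d → ℝ} (hφ : ContDiff ℝ ∞ φ) (i : Fin d) :
    Continuous fun x => fderiv ℝ φ x (e i) :=
  (hφ.continuous_fderiv (by simp)).clm_apply continuous_const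

theorem hasCompactSupport_partial {φ : E d → ℝ} (hs : HasCompactSupport φ) (i : Fin d) :
    HasCompactSupport fun x => fderiv ℝ φ x (e i) :=
  hs.fderiv_apply (𝕜 := ℝ) (e i)

theorem integral_add_lp (u v : L2 d) {φ : E d → ℝ} (hφ : Continuous φ)
    (hs : HasCompactSupport φ) :
    ∫ x, (u + v : L2 d) x * φ x = (∫ x, u x * φ x) + ∫ x, v x * φ x := by
  rw [← integral_add (integrable_lp_mul u hφ hs) (integrable_lp_mul v hφ hs)]
  refine integral_congr_ae ?_
  filter_upwards [Lp.coeFn_add u v] with x hx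
  simp only [hx, Pi.add_apply]
  ring

theorem integral_smul_lp (c : ℝ) (u : L2 d) (φ : E d → ℝ) :
    ∫ x, (c • u : L2 d) x * φ x = c * ∫ x, u x * φ x := by
  rw [← integral_const_mul]
  refine integral_congr_ae ?_
  filter_upwards [Lp.coeFn_smul c u] with x hx
  simp only [hx, Pi.smul_apply, smul_eq_mul]
  ring

theorem HasWeakPartial.add {i : Fin d} {u v g h : L2 d} (hu : HasWeakPartial i u g)
    (hv : HasWeakPartial i v h) : HasWeakPartial i (u + v) (g + h) := by
  intro φ hφ hs
  rw [integral_add_lp u v (continuous_partial hφ i) (hasCompactSupport_partial hs i),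
    integral_add_lp g h hφ.continuous hs, hu φ hφ hs, hv φ hφ hs]
  ring

theorem HasWeakPartial.smul {i : Fin d} {u g : L2 d} (c : ℝ) (hu : HasWeakPartial i u g) :
    HasWeakPartial i (c • u) (c • g) := by
  intro φ hφ hs
  rw [integral_smul_lp, integral_smul_lp, hu φ hφ hs]
  ring

theorem HasWeakPartial.unique {i : Fin d} {u g h : L2 d} (hg : HasWeakPartial i u g)
    (hh : HasWeakPartial i u h) : g = h := by
  refine Lp.ext ?_
  refine ae_eq_of_integral_contDiff_smul_eq ((Lp.memLp g).locallyIntegrable (by norm_num))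
    ((Lp.memLp h).locallyIntegrable (by norm_num)) ?_
  intro φ hφ hs
  have h1 := (hg φ hφ hs).symm.trans (hh φ hφ hs)
  simp only [smul_eq_mul, mul_comm (φ _)]
  linarith

theorem HasWeakHessian.add {u v : L2 d} {H K : Fin d → Fin d → L2 d}
    (hu : HasWeakHessian u H) (hv : HasWeakHessian v K) :
    HasWeakHessian (u + v) (fun i j => H i j + K i j) := by
  obtain ⟨g, hg, hH⟩ := hu
  obtain ⟨k, hk, hK⟩ := hv
  exact ⟨fun j => g j + k j, fun j => (hg j).add (hk j), fun i j => (hH i j).add (hK i j)⟩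

theorem HasWeakHessian.smul {u : L2 d} {H : Fin d → Fin d → L2 d} (c : ℝ)
    (hu : HasWeakHessian u H) : HasWeakHessian (c • u) (fun i j => c • H i j) := by
  obtain ⟨g, hg, hH⟩ := hu
  exact ⟨fun j => c • g j, fun j => (hg j).smul c, fun i j => (hH i j).smul c⟩

theorem HasWeakHessian.unique {u : L2 d} {H K : Fin d → Fin d → L2 d}
    (hH : HasWeakHessian u H) (hK : HasWeakHessian u K) : H = K := by
  obtain ⟨g, hg, hH⟩ := hH
  obtain ⟨k, hk, hK⟩ := hK
  obtain rfl : g = k := funext fun j => (hg j).unique (hk j)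
  exact funext fun i => funext fun j => (hH i j).unique (hK i j)

end WeakLemmas

/-- The Sobolev space `H²(ℝ^d)`, as a subspace of `L²(ℝ^d)`. -/
def sobolevH2 (d : ℕ) : Submodule ℝ (L2 d) where
  carrier := {u | ∃ H, HasWeakHessian u H}
  add_mem' := fun ⟨_, hu⟩ ⟨_, hv⟩ => ⟨_, hu.add hv⟩
  zero_mem' := by
    have h0 : ∀ i : Fin d, HasWeakPartial i (0 : L2 d) 0 := by
      intro i φ hφ hs
      have h := integral_smul_lp (d := d) 0 0
      simp only [zero_smul, zero_mul] at h
      rw [h, h, neg_zero]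
    exact ⟨fun _ _ => 0, fun _ => 0, h0, fun i _ => h0 i⟩
  smul_mem' := fun c _ ⟨_, hu⟩ => ⟨_, hu.smul c⟩

/-- The weak Hessian of an element of `H²(ℝ^d)`. -/
def weakHessian {d : ℕ} (u : sobolevH2 d) : Fin d → Fin d → L2 d := Classical.choose u.2

theorem weakHessian_spec {d : ℕ} (u : sobolevH2 d) : HasWeakHessian u.1 (weakHessian u) :=
  Classical.choose_spec u.2

/-- The operator `L⁰ u = Θ^{ij} ∂²u/∂x^i∂x^j` in `L²(ℝ^d)` with domain `H²(ℝ^d)`. -/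
def limitOp {d : ℕ} (Θ : Matrix (Fin d) (Fin d) ℝ) : L2 d →ₗ.[ℝ] L2 d where
  domain := sobolevH2 d
  toFun :=
    { toFun := fun u => ∑ i, ∑ j, Θ i j • weakHessian u i j
      map_add' := by
        intro u v
        rw [(weakHessian_spec (u + v)).unique ((weakHessian_spec u).add (weakHessian_spec v))]
        simp only [smul_add, Finset.sum_add_distrib]
      map_smul' := by
        intro c u
        rw [(weakHessian_spec (c • u)).unique ((weakHessian_spec u).smul c)]
        simp only [Finset.smul_sum, RingHom.id_apply, smul_comm c] }

/-- `R` is the resolvent `(T - m)⁻¹`: a bounded everywhere defined two-sided inverse of `T - m`,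
where `T` is an (unbounded) operator in `L²(ℝ^d)`. -/
def IsResolvent {d : ℕ} (T : L2 d →ₗ.[ℝ] L2 d) (m : ℝ) (R : L2 d →L[ℝ] L2 d) : Prop :=
  (∀ f : L2 d, ∃ h : R f ∈ T.domain, T ⟨R f, h⟩ - m • R f = f) ∧
    ∀ u : T.domain, R (T u - m • (u : L2 d)) = u

/-! ### The cell problem and the effective matrix -/

/-- `κ = (κ^1, …, κ^d)` is the first-order periodic corrector: its components are periodic, square
integrable over the cell, of zero average, and for almost every `ξ`
`∫ a(ξ-q) μ(q) (κ^i(q) - κ^i(ξ)) dq = ∫ a(ξ-q) (ξ-q)^i μ(q) dq`. -/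
structure IsCorrector {d : ℕ} (a mu : E d → ℝ) (κ : Fin d → E d → ℝ) : Prop where
  periodic : ∀ i, IsPeriodic (κ i)
  memLp : ∀ i, MemLp (κ i) 2 (volume.restrict (unitCell d))
  average_eq_zero : ∀ i, ∫ ξ in unitCell d, κ i ξ = 0
  integrable : ∀ i, ∀ᵐ ξ : E d, Integrable fun q => a (ξ - q) * mu q * (κ i q - κ i ξ)
  cell_eq : ∀ i, ∀ᵐ ξ : E d, ∫ q, a (ξ - q) * mu q * (κ i q - κ i ξ) =
    ∫ q, a (ξ - q) * (ξ - q) i * mu q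

/-- The first integrand, as a function of `(ξ, q)`, in the cell formula. -/
def cellIntegrand₁ {d : ℕ} (a mu : E d → ℝ) (i j : Fin d) (ξ q : E d) : ℝ :=
  1 / 2 * (ξ - q) i * (ξ - q) j * a (ξ - q) * mu q * mu ξ

/-- The second integrand, as a function of `(ξ, q)`, in the cell formula. -/
def cellIntegrand₂ {d : ℕ} (a mu : E d → ℝ) (κ : Fin d → E d → ℝ) (i j : Fin d) (ξ q : E d) : ℝ :=
  a (ξ - q) * mu q * mu ξ * (ξ - q) i * κ j q

/-- The effective matrix `Θ`, given by
`Θ^{ij} ∫_{𝕋^d} μ/λ dξ = ∫_{𝕋^d} ∫ ½ (ξ-q)^i (ξ-q)^j a(ξ-q) μ(q) μ(ξ) dq dξ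
  - ∫_{𝕋^d} ∫ a(ξ-q) μ(q) μ(ξ) (ξ-q)^i κ^j(q) dq dξ`. -/
def effectiveMatrix {d : ℕ} (a lam mu : E d → ℝ) (κ : Fin d → E d → ℝ) :
    Matrix (Fin d) (Fin d) ℝ := Matrix.of fun i j =>
  (∫ ξ in unitCell d, mu ξ / lam ξ)⁻¹ *
    ((∫ ξ in unitCell d, ∫ q, cellIntegrand₁ a mu i j ξ q) -
      ∫ ξ in unitCell d, ∫ q, cellIntegrand₂ a mu κ i j ξ q)

end NonlocalHomog

end

open NonlocalHomog

set_option linter.unusedSectionVars false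

noncomputable section

namespace NonlocalHomog

open scoped ENNReal

/-! ### Weighted Cauchy–Schwarz -/

/-! Substituting y = x − εz gives (L^ε u)(x) = ε⁻² λ(x/ε) ∫ μ(x/ε − z)(u(x − εz) − u(x)) a(z) dz.
With the projection onto the torus in place of the dilation, the same integral is the operator of
the cell problem. Both are cases of `genFun`, for a finite even measure ρ on Z and a homomorphism π
: Z → G. Multiplied by m(x), this operator becomes symmetric, with minus a nonlocal Dirichlet form
as its form (`integral_genFun_mul`). Writing A ≤ 0 for the symmetric operator, L^ε − k = −(λ/μ)(k
μ/λ − ε⁻²A), and the bracket is coercive with a constant that does not see ε. Hence the resolvents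
exist and are bounded uniformly in ε (`exists_resolvent`).

On the torus A is coercive modulo constants. Squared increments satisfy P(w) ≤ 2P(z) + 2P(w+z), and
a overlaps its small translates, so their a-average controls P on every bounded set
(`exists_poincare`). Averaging over the cell turns this into a variance bound. Adding the projection
onto constants to −A then makes the cell problem solvable for every compatible right-hand side
(`exists_cell_solution`).

Evenness of a makes the first cell problem compatible. The definition of Θ is exactly the
compatibility condition of a second cell problem, with solution χ. Testing the first problem with
the correctors turns Θ into the energy of the functions z_i − (κ^i(t − z) − κ^i(t)). This shows
symmetry, and the Poincaré argument, which tolerates an additive linear term, shows definiteness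
(`IsTorusCorrector.posDef`).

For a test function φ put w_ε = φ + εκ(x/ε)·∇φ + ε²χ(x/ε):∇²φ. The two cell equations remove the
orders ε⁻¹ and 1 in L^ε w_ε − L⁰φ. What is left is a Taylor remainder, which tends to 0 in L² by
dominated convergence using only the second moment of a (`genFun_ansatz`, `tendsto_intRem`). The
uniform resolvent bound then gives convergence for f = (L⁰ − k)φ.

Such f are dense. If w is orthogonal to all of them, its convolutions with test functions are
bounded solutions of ΘD²F = kF, hence zero by a maximum principle (`denseRange_shiftedOp`). The L²
elliptic estimates on test functions extend φ and its derivatives continuously from this dense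
range, which constructs the limit resolvent (`exists_limit_resolvent`). The uniform bound carries
the convergence to every f. -/

theorem sq_lintegral_mul_le {α : Type*} [MeasurableSpace α] {ρ : Measure α} {w f : α → ℝ≥0∞}
    (hw : AEMeasurable w ρ) (hf : AEMeasurable f ρ) :
    (∫⁻ z, w z * f z ∂ρ) ^ 2 ≤ (∫⁻ z, w z ∂ρ) * ∫⁻ z, w z * f z ^ 2 ∂ρ := by
  have h1 : ∀ z, w z * f z = w z ^ (1 / 2 : ℝ) * (w z ^ (1 / 2 : ℝ) * f z) := by
    intro z
    rw [← mul_assoc, ← ENNReal.rpow_add_of_nonneg _ _ (by norm_num) (by norm_num)]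
    norm_num
  have hs : ∀ x : ℝ≥0∞, (x ^ (1 / 2 : ℝ)) ^ 2 = x := by
    intro x
    rw [← ENNReal.rpow_natCast, ← ENNReal.rpow_mul]
    norm_num
  have h := ENNReal.lintegral_mul_le_Lp_mul_Lq ρ (p := 2) (q := 2)
    (f := fun z => w z ^ (1 / 2 : ℝ)) (g := fun z => w z ^ (1 / 2 : ℝ) * f z)
    Real.HolderConjugate.two_two (hw.pow_const _) ((hw.pow_const _).mul hf)
  simp only [Pi.mul_apply, ← h1, ENNReal.rpow_two, mul_pow, hs] at h
  calc _ ≤ _ := pow_le_pow_left' h 2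
    _ = _ := by rw [mul_pow, hs, hs]

/-! ### Nonlocal operators on a group: change of variables, L² bounds, Dirichlet form -/

section Convolution

variable {G Z : Type*} [AddCommGroup G] [MeasurableSpace G] [MeasurableAdd₂ G] [MeasurableNeg G]
  [AddCommGroup Z] [MeasurableSpace Z] [MeasurableNeg Z]

/-- The reflection `(x, z) ↦ (x - π z, -z)`. -/
def flip (π : Z →+ G) (p : G × Z) : G × Z := (p.1 - π p.2, -p.2)

theorem flip_flip (π : Z →+ G) (p : G × Z) : flip π (flip π p) = p := by
  simp [flip]

/-- The reflection `(x, z) ↦ (x - π z, -z)` as a measurable equivalence. -/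
def flipEquiv (π : Z →+ G) (hπ : Measurable π) : G × Z ≃ᵐ G × Z where
  toFun := flip π
  invFun := flip π
  left_inv := flip_flip π
  right_inv := flip_flip π
  measurable_toFun := (measurable_fst.sub (hπ.comp measurable_snd)).prodMk measurable_snd.neg
  measurable_invFun := (measurable_fst.sub (hπ.comp measurable_snd)).prodMk measurable_snd.neg

variable {ν : Measure G} {ρ : Measure Z} [SigmaFinite ν] [IsFiniteMeasure ρ]
  [ν.IsAddLeftInvariant] {π : Z →+ G}

theorem measurePreserving_shear {ρ : Measure Z} [SFinite ρ] (hπ : Measurable π) :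
    MeasurePreserving (fun p : G × Z => (p.1 - π p.2, p.2)) (ν.prod ρ) (ν.prod ρ) := by
  have h : MeasurePreserving (fun p : Z × G => (p.1, p.2 - π p.1)) (ρ.prod ν) (ρ.prod ν) := by
    refine (MeasurePreserving.id ρ).skew_product (g := fun z x => x - π z)
      (measurable_snd.sub (hπ.comp measurable_fst)) (Eventually.of_forall fun z => ?_)
    simpa only [sub_eq_add_neg] using map_add_right_eq_self ν (-π z)
  exact (Measure.measurePreserving_swap (μ := ρ) (ν := ν)).comp
    (h.comp (Measure.measurePreserving_swap (μ := ν) (ν := ρ)))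

/-- Exchanging the endpoints x and x − πz of a jump replaces z by −z. Translation invariance of ν
and evenness of ρ therefore make the jump measure reversible; every symmetry used later rests on
this. -/
theorem measurePreserving_flip [ρ.IsNegInvariant] (hπ : Measurable π) :
    MeasurePreserving (flipEquiv (G := G) π hπ) (ν.prod ρ) (ν.prod ρ) := by
  have h : MeasurePreserving (Prod.map id Neg.neg : G × Z → G × Z) (ν.prod ρ) (ν.prod ρ) :=
    (MeasurePreserving.id ν).prod (Measure.measurePreserving_neg ρ)
  exact h.comp (measurePreserving_shear hπ)

theorem integral_flip [ρ.IsNegInvariant] (hπ : Measurable π) (F : G × Z → ℝ) :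
    ∫ p, F (flip π p) ∂(ν.prod ρ) = ∫ p, F p ∂(ν.prod ρ) :=
  (measurePreserving_flip hπ).integral_comp' F

theorem integrable_flip [ρ.IsNegInvariant] (hπ : Measurable π) {F : G × Z → ℝ}
    (hF : Integrable F (ν.prod ρ)) : Integrable (fun p => F (flip π p)) (ν.prod ρ) :=
  (measurePreserving_flip hπ).integrable_comp_of_integrable hF

theorem quasiMeasurePreserving_sub {ρ : Measure Z} [SFinite ρ] (hπ : Measurable π) :
    Measure.QuasiMeasurePreserving (fun p : G × Z => p.1 - π p.2) (ν.prod ρ) ν :=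
  Measure.quasiMeasurePreserving_fst.comp (measurePreserving_shear hπ).quasiMeasurePreserving

theorem integral_shear (hπ : Measurable π) {p : G → ℝ≥0∞} (hp : AEMeasurable p ν)
    {w : Z → ℝ≥0∞} (hw : AEMeasurable w ρ) :
    ∫⁻ y, w y.2 * p (y.1 - π y.2) ∂(ν.prod ρ) = (∫⁻ z, w z ∂ρ) * ∫⁻ x, p x ∂ν := by
  have hS := measurePreserving_shear (ν := ν) (ρ := ρ) hπ
  have hf : AEMeasurable (fun y : G × Z => p y.1 * w y.2) (ν.prod ρ) := hp.comp_fst.mul hw.comp_snd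
  rw [mul_comm, ← lintegral_prod_mul hp hw]
  conv_rhs => rw [← hS.map_eq]
  rw [lintegral_map' (by rwa [hS.map_eq]) hS.measurable.aemeasurable]
  simp only [mul_comm]

/-- A Schur-type bound: Cauchy–Schwarz in z with weight w at each fixed x, then integration in x.
Finiteness of the resulting double integral also gives absolute convergence for almost every x. -/
theorem memLp_integral_of_le {F : G × Z → ℝ} (hF : AEStronglyMeasurable F (ν.prod ρ))
    {w : Z → ℝ≥0∞} (hw : AEMeasurable w ρ) (hwi : ∫⁻ z, w z ∂ρ ≠ ⊤)
    {h : G × Z → ℝ≥0∞} (hh : AEMeasurable h (ν.prod ρ)) (hle : ∀ p, ‖F p‖ₑ ≤ w p.2 * h p)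
    (hfin : ∫⁻ p, w p.2 * h p ^ 2 ∂(ν.prod ρ) ≠ ⊤) :
    (∀ᵐ x ∂ν, Integrable (fun z => F (x, z)) ρ) ∧
      MemLp (fun x => ∫ z, F (x, z) ∂ρ) 2 ν ∧
      ∫⁻ x, ‖∫ z, F (x, z) ∂ρ‖ₑ ^ 2 ∂ν ≤ (∫⁻ z, w z ∂ρ) * ∫⁻ p, w p.2 * h p ^ 2 ∂(ν.prod ρ) := by
  have hwh : AEMeasurable (fun p : G × Z => w p.2 * h p ^ 2) (ν.prod ρ) :=
    hw.comp_snd.mul (hh.pow_const 2)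
  have hsec : ∀ᵐ x ∂ν, AEMeasurable (fun z => h (x, z)) ρ := by
    have h1 := Measure.ae_ae_of_ae_prod hh.ae_eq_mk
    filter_upwards [h1] with x hx
    exact ⟨_, hh.measurable_mk.comp measurable_prodMk_left, hx⟩
  have hbd : ∀ᵐ x ∂ν, (∫⁻ z, ‖F (x, z)‖ₑ ∂ρ) ^ 2 ≤
      (∫⁻ z, w z ∂ρ) * ∫⁻ z, w z * h (x, z) ^ 2 ∂ρ := by
    filter_upwards [hsec] with x hx
    exact (pow_le_pow_left' (lintegral_mono fun z => hle (x, z)) 2).trans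
      (sq_lintegral_mul_le hw hx)
  have htot : ∫⁻ x, (∫⁻ z, ‖F (x, z)‖ₑ ∂ρ) ^ 2 ∂ν ≤
      (∫⁻ z, w z ∂ρ) * ∫⁻ p, w p.2 * h p ^ 2 ∂(ν.prod ρ) := by
    refine (lintegral_mono_ae hbd).trans ?_
    rw [lintegral_const_mul' _ _ hwi, lintegral_prod _ hwh]
  have hlt : ∫⁻ x, (∫⁻ z, ‖F (x, z)‖ₑ ∂ρ) ^ 2 ∂ν < ⊤ :=
    htot.trans_lt (ENNReal.mul_lt_top hwi.lt_top hfin.lt_top)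
  have hmeas : AEMeasurable (fun x => (∫⁻ z, ‖F (x, z)‖ₑ ∂ρ) ^ 2) ν :=
    (hF.enorm.lintegral_prod_right').pow_const 2
  have hle2 : ∫⁻ x, ‖∫ z, F (x, z) ∂ρ‖ₑ ^ 2 ∂ν ≤ ∫⁻ x, (∫⁻ z, ‖F (x, z)‖ₑ ∂ρ) ^ 2 ∂ν :=
    lintegral_mono fun x => pow_le_pow_left' (enorm_integral_le_lintegral_enorm _) 2
  refine ⟨?_, ?_, hle2.trans htot⟩
  · filter_upwards [ae_lt_top' hmeas hlt.ne, hF.prodMk_left] with x hx hm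
    refine ⟨hm, ?_⟩
    by_contra hcon
    simp only [HasFiniteIntegral, not_lt, top_le_iff] at hcon
    simp [hcon] at hx
  · refine ⟨hF.integral_prod_right', ?_⟩
    rw [eLpNorm_lt_top_iff_lintegral_rpow_enorm_lt_top (by norm_num) (by norm_num)]
    simpa using hle2.trans_lt hlt

theorem lintegral_sq_lt_top {p : G → ℝ} (hp : MemLp p 2 ν) : ∫⁻ x, ‖p x‖ₑ ^ 2 ∂ν < ⊤ := by
  have := (eLpNorm_lt_top_iff_lintegral_rpow_enorm_lt_top (p := 2) (by norm_num) (by norm_num)).1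
    hp.2
  simpa using this

/-- The nonlocal operator `u ↦ ∫ m(x - πz) (u(x - πz) - u(x)) dρ(z)`. -/
def genFun (ρ : Measure Z) (π : Z →+ G) (m u : G → ℝ) (x : G) : ℝ :=
  ∫ z, m (x - π z) * (u (x - π z) - u x) ∂ρ

/-- The shear (x, z) ↦ (x − πz, z) preserves the product measure, so the double integral of the
weight against |p(x − πz)|² factorises. -/
theorem memLp_weighted (hπ : Measurable π) {F : G × Z → ℝ}
    (hF : AEStronglyMeasurable F (ν.prod ρ)) {w : Z → ℝ} (hw : Integrable w ρ)
    {p : G → ℝ} (hp : MemLp p 2 ν) (hle : ∀ y, |F y| ≤ w y.2 * |p (y.1 - π y.2)|) :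
    (∀ᵐ x ∂ν, Integrable (fun z => F (x, z)) ρ) ∧ MemLp (fun x => ∫ z, F (x, z) ∂ρ) 2 ν ∧
    ∫⁻ x, ‖∫ z, F (x, z) ∂ρ‖ₑ ^ 2 ∂ν ≤ (∫⁻ z, ‖w z‖ₑ ∂ρ) ^ 2 * ∫⁻ x, ‖p x‖ₑ ^ 2 ∂ν := by
  have hm : AEMeasurable (fun y : G × Z => ‖p (y.1 - π y.2)‖ₑ) (ν.prod ρ) :=
    (hp.1.comp_quasiMeasurePreserving (quasiMeasurePreserving_sub hπ)).enorm
  have hI := integral_shear (ν := ν) (ρ := ρ) hπ (hp.1.enorm.pow_const 2) hw.1.enorm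
  have h := memLp_integral_of_le hF (w := fun z => ‖w z‖ₑ) hw.1.enorm hw.2.ne
    (h := fun y => ‖p (y.1 - π y.2)‖ₑ) hm (fun y => by
      rw [← enorm_mul, enorm_le_iff_norm_le, Real.norm_eq_abs, norm_mul, Real.norm_eq_abs,
        Real.norm_eq_abs]
      exact (hle y).trans (mul_le_mul_of_nonneg_right (le_abs_self _) (abs_nonneg _)))
    (by rw [hI]; exact (ENNReal.mul_lt_top hw.2 (lintegral_sq_lt_top hp)).ne)
  refine ⟨h.1, h.2.1, h.2.2.trans_eq ?_⟩
  rw [hI, sq, mul_assoc]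

theorem aesm_fst {ρ : Measure Z} [SFinite ρ] {p : G → ℝ} (hp : AEStronglyMeasurable p ν) :
    AEStronglyMeasurable (fun y : G × Z => p y.1) (ν.prod ρ) :=
  hp.comp_quasiMeasurePreserving Measure.quasiMeasurePreserving_fst

theorem aesm_sub {ρ : Measure Z} [SFinite ρ] (hπ : Measurable π) {p : G → ℝ} (hp : AEStronglyMeasurable p ν) :
    AEStronglyMeasurable (fun y : G × Z => p (y.1 - π y.2)) (ν.prod ρ) :=
  hp.comp_quasiMeasurePreserving (quasiMeasurePreserving_sub hπ)

/-- Products of `L²` functions of `x` and `x - πz` with an integrable weight are integrable. -/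
theorem integrable_pair (hπ : Measurable π) {w : Z → ℝ} (hw : Integrable w ρ)
    {p q : G → ℝ} (hp : MemLp p 2 ν) (hq : MemLp q 2 ν) {F : G × Z → ℝ}
    (hF : AEStronglyMeasurable F (ν.prod ρ))
    (hle : ∀ y, |F y| ≤ w y.2 * (|p y.1| + |p (y.1 - π y.2)|) * (|q y.1| + |q (y.1 - π y.2)|)) :
    Integrable F (ν.prod ρ) := by
  have h1 : ∀ p : G → ℝ, MemLp p 2 ν → Integrable (fun y : G × Z => p y.1 ^ 2 * |w y.2|) (ν.prod ρ)
      := fun p hp => (hp.integrable_sq).mul_prod hw.abs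
  have h2 : ∀ p : G → ℝ, MemLp p 2 ν →
      Integrable (fun y : G × Z => p (y.1 - π y.2) ^ 2 * |w y.2|) (ν.prod ρ) :=
    fun p hp => (measurePreserving_shear hπ).integrable_comp_of_integrable (h1 p hp)
  refine Integrable.mono' (((h1 p hp).add (h2 p hp)).add ((h1 q hq).add (h2 q hq))) hF
    (Eventually.of_forall fun y => (hle y).trans ?_)
  simp only [Pi.add_apply]
  have hA : (|p y.1| + |p (y.1 - π y.2)|) * (|q y.1| + |q (y.1 - π y.2)|) ≤
      p y.1 ^ 2 + p (y.1 - π y.2) ^ 2 + (q y.1 ^ 2 + q (y.1 - π y.2) ^ 2) := by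
    rw [← sq_abs (p y.1), ← sq_abs (p (y.1 - π y.2)), ← sq_abs (q y.1), ← sq_abs (q (y.1 - π y.2))]
    nlinarith [sq_nonneg (|p y.1| - |q y.1|), sq_nonneg (|p y.1| - |q (y.1 - π y.2)|),
      sq_nonneg (|p (y.1 - π y.2)| - |q y.1|), sq_nonneg (|p (y.1 - π y.2)| - |q (y.1 - π y.2)|)]
  rw [mul_assoc]
  calc _ ≤ |w y.2| * ((|p y.1| + |p (y.1 - π y.2)|) * (|q y.1| + |q (y.1 - π y.2)|)) :=
        mul_le_mul_of_nonneg_right (le_abs_self _) (by positivity)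
    _ ≤ _ := mul_le_mul_of_nonneg_left hA (abs_nonneg _)
    _ = _ := by ring

variable {m : G → ℝ} {β : ℝ}

/-- The difference is split into a convolution term, covered by `memLp_weighted` with constant
weight β, and u(x) times a bounded function of x; both need only that m is bounded and ρ finite. -/
theorem genFun_aux (hπ : Measurable π) (hm : AEStronglyMeasurable m ν) (hβ : ∀ x, |m x| ≤ β)
    {u : G → ℝ} (hu : MemLp u 2 ν) :
    (∀ᵐ x ∂ν, Integrable (fun z => m (x - π z) * (u (x - π z) - u x)) ρ) ∧
      MemLp (genFun ρ π m u) 2 ν := by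
  obtain ⟨i1, l1, -⟩ := memLp_weighted (ν := ν) (ρ := ρ) hπ
    (F := fun y => m (y.1 - π y.2) * u (y.1 - π y.2)) ((aesm_sub hπ hm).mul (aesm_sub hπ hu.1))
    (integrable_const β) hu (fun y => by
      rw [abs_mul]; exact mul_le_mul_of_nonneg_right (hβ _) (abs_nonneg _))
  have hmsec : ∀ᵐ x ∂ν, Integrable (fun z => m (x - π z)) ρ := by
    filter_upwards [(aesm_sub (ρ := ρ) hπ hm).prodMk_left] with x hx
    exact Integrable.of_bound hx β (Eventually.of_forall fun z => hβ _)
  have hsum : (fun x => ∫ z, m (x - π z) * u (x - π z) ∂ρ) - (fun x => (∫ z, m (x - π z) ∂ρ) * u x)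
      =ᵐ[ν] genFun ρ π m u := by
    filter_upwards [i1, hmsec] with x h1 h2
    simp only [Pi.sub_apply, genFun, mul_sub]
    rw [integral_sub h1 (h2.mul_const _), integral_mul_const]
  refine ⟨?_, ?_⟩
  · filter_upwards [i1, hmsec] with x h1 h2
    simp only [mul_sub]
    exact h1.sub (h2.mul_const _)
  · refine (l1.sub ?_).ae_eq hsum
    have hb : ∀ x, ‖∫ z, m (x - π z) ∂ρ‖ ≤ β * ρ.real Set.univ :=
      fun x => norm_integral_le_of_norm_le_const (Eventually.of_forall fun z => hβ _)
    refine MemLp.of_le_mul (c := β * ρ.real Set.univ) hu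
      ((aesm_sub (ρ := ρ) hπ hm).integral_prod_right'.mul hu.1) (Eventually.of_forall fun x => ?_)
    rw [norm_mul]
    exact mul_le_mul_of_nonneg_right (hb x) (norm_nonneg _)

/-- Nonlocal integration by parts. The factor m(x) makes the coefficient m(x)m(x − πz) invariant
under exchange of endpoints, and averaging the integrand with its reflection replaces v(x) by minus
half the increment of v. -/
theorem integral_genFun_mul [ρ.IsNegInvariant] (hπ : Measurable π) (hm : AEStronglyMeasurable m ν)
    (hβ : ∀ x, |m x| ≤ β) {u v : G → ℝ} (hu : MemLp u 2 ν) (hv : MemLp v 2 ν) :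
    ∫ x, m x * genFun ρ π m u x * v x ∂ν = -(1 / 2 * ∫ y : G × Z, m y.1 * m (y.1 - π y.2) *
      (u (y.1 - π y.2) - u y.1) * (v (y.1 - π y.2) - v y.1) ∂(ν.prod ρ)) := by
  have hβ0 : 0 ≤ β := (abs_nonneg _).trans (hβ 0)
  have hmm : ∀ x y, |m x * m y| ≤ β * β := fun x y => by
    rw [abs_mul]; exact mul_le_mul (hβ _) (hβ _) (abs_nonneg _) hβ0
  set F : G × Z → ℝ := fun y => m y.1 * m (y.1 - π y.2) * (u (y.1 - π y.2) - u y.1) * v y.1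
  have hF : Integrable F (ν.prod ρ) := by
    refine integrable_pair hπ (integrable_const (β * β)) hu hv ((((aesm_fst hm).mul
      (aesm_sub hπ hm)).mul ((aesm_sub hπ hu.1).sub (aesm_fst hu.1))).mul (aesm_fst hv.1))
      fun y => ?_
    simp only [F]
    rw [abs_mul, abs_mul]
    refine mul_le_mul (mul_le_mul (hmm _ _) ?_ (abs_nonneg _) (by positivity)) ?_ (abs_nonneg _)
      (by positivity)
    · rw [add_comm]; exact abs_sub _ _
    · linarith [abs_nonneg (v (y.1 - π y.2))]
  have h1 : ∫ x, m x * genFun ρ π m u x * v x ∂ν = ∫ y, F y ∂(ν.prod ρ) := by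
    rw [integral_prod _ hF]
    congr 1; ext x
    rw [genFun, ← integral_const_mul, ← integral_mul_const]
    congr 1; ext z
    simp only [F]; ring
  have h2 := integral_flip (ν := ν) (ρ := ρ) hπ F
  have h3 : ∫ y, F y ∂(ν.prod ρ) = 1 / 2 * ∫ y, (F y + F (flip π y)) ∂(ν.prod ρ) := by
    rw [integral_add hF (integrable_flip hπ hF), h2]; ring
  rw [h1, h3, ← mul_neg, ← integral_neg]
  congr 2; ext y
  simp only [F, flip, map_neg, sub_neg_eq_add, sub_add_cancel]
  ring

end Convolution

/-! ### Coercive operators -/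

/-- The Lax–Milgram argument. The bound on the inverse involves only the coercivity constant; this
is the source of estimates uniform in ε. -/
theorem exists_inverse_of_coercive {V : Type*} [NormedAddCommGroup V] [InnerProductSpace ℝ V]
    [CompleteSpace V] (T : V →L[ℝ] V) {c : ℝ} (hc : 0 < c)
    (h : ∀ v, c * ‖v‖ ^ 2 ≤ inner ℝ (T v) v) :
    ∃ S : V →L[ℝ] V, (∀ v, T (S v) = v) ∧ (∀ v, S (T v) = v) ∧ ‖S‖ ≤ c⁻¹ := by
  have hu : IsUnit T := ContinuousLinearMap.isUnit_of_forall_le_norm_inner_map T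
    (c := ⟨c, hc.le⟩) hc fun x => by
      rw [mul_comm]; exact (h x).trans (Real.le_norm_self _)
  obtain ⟨u, rfl⟩ := hu
  have h1 : ∀ v, (u : V →L[ℝ] V) (((u⁻¹ : (V →L[ℝ] V)ˣ) : V →L[ℝ] V) v) = v := fun v =>
    DFunLike.congr_fun u.mul_inv v
  refine ⟨(u⁻¹ : (V →L[ℝ] V)ˣ), h1, fun v => DFunLike.congr_fun u.inv_mul v, ?_⟩
  refine ContinuousLinearMap.opNorm_le_bound _ (by positivity) fun v => ?_
  set y := ((u⁻¹ : (V →L[ℝ] V)ˣ) : V →L[ℝ] V) v with hy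
  have h2 : c * ‖y‖ ^ 2 ≤ ‖v‖ * ‖y‖ := by
    have := (h y).trans (real_inner_le_norm _ _)
    rwa [h1] at this
  rcases (norm_nonneg y).eq_or_lt with h0 | h0
  · rw [← h0]; positivity
  · rw [← div_eq_inv_mul, le_div_iff₀ hc]
    rw [sq, ← mul_assoc] at h2
    linarith [le_of_mul_le_mul_right h2 h0]

/-! ### A Poincaré type inequality for subadditive functionals -/

section Poincare

variable {d : ℕ} {a : E d → ℝ}

/-- The finite measure `a(z) dz`. -/
def kernelMeasure (a : E d → ℝ) : Measure (E d) := volume.withDensity fun z => ENNReal.ofReal (a z)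

/-- Translations act continuously on L¹; the statement is this continuity at w = 0, rewritten as an
integral. -/
theorem tendsto_integral_abs_sub_translate (ha : Integrable a) :
    Tendsto (fun w : E d => ∫ z, |a (w + z) - a z|) (𝓝 0) (𝓝 0) := by
  have hmem : MemLp a 1 volume := memLp_one_iff_integrable.2 ha
  set f : Lp ℝ 1 (volume : Measure (E d)) := hmem.toLp a
  have : Fact ((1 : ℝ≥0∞) ≠ ⊤) := ⟨by simp⟩
  have hc : Continuous fun w : E d => (DomAddAct.mk w) +ᵥ f :=
    (continuous_id.vadd continuous_const).comp DomAddAct.continuous_mk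
  have h1 : Tendsto (fun w : E d => ‖(DomAddAct.mk w +ᵥ f) - f‖) (𝓝 0) (𝓝 0) := by
    have := (hc.sub (continuous_const (y := f))).norm.tendsto 0
    convert! this using 2
    have h0 : (DomAddAct.mk (0 : E d)) +ᵥ f = f := zero_vadd _ f
    rw [Pi.sub_apply, h0, sub_self, norm_zero]
  refine h1.congr fun w => ?_
  rw [L1.norm_eq_integral_norm]
  refine integral_congr_ae ?_
  have h2 : (DomAddAct.mk w +ᵥ f) =
    (hmem.comp_measurePreserving <| measurePreserving_vadd w volume).toLp (a ∘ fun x => w +ᵥ x) :=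
    DomAddAct.mk_vadd_toLp w hmem
  filter_upwards [Lp.coeFn_sub (DomAddAct.mk w +ᵥ f) f, hmem.coeFn_toLp,
    (hmem.comp_measurePreserving <| measurePreserving_vadd w volume).coeFn_toLp] with z h3 h4 h5
  rw [h3, Pi.sub_apply, h2, h5, h4]
  rfl

/-- Since min(s, t) = (s + t − |s − t|)/2, the overlap of a with its translate is ∫a minus half
their L¹ distance. Once that distance is below ∫a, the overlap is at least ½∫a. This is the
nondegeneracy of a that replaces a pointwise lower bound. -/
theorem exists_le_lintegral_min (ha : Integrable a) (hnn : ∀ z, 0 ≤ a z) (hpos : 0 < ∫ z, a z) :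
    ∃ r > 0, ∃ c : ℝ≥0∞, c ≠ 0 ∧ c ≠ ⊤ ∧ ∀ w : E d, ‖w‖ < r →
      c ≤ ∫⁻ z, ENNReal.ofReal (min (a z) (a (w + z))) := by
  have h := (tendsto_integral_abs_sub_translate ha).eventually (gt_mem_nhds hpos)
  obtain ⟨r, hr, hb⟩ := Metric.eventually_nhds_iff.1 h
  refine ⟨r, hr, ENNReal.ofReal (1 / 2 * ∫ z, a z), by simpa using hpos, ENNReal.ofReal_ne_top,
    fun w hw => ?_⟩
  have hw' := hb (y := w) (by simpa using hw)
  have ht : Integrable fun z => a (w + z) := ha.comp_add_left w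
  have hmin : Integrable fun z => min (a z) (a (w + z)) := ha.inf ht
  rw [← ofReal_integral_eq_lintegral_ofReal hmin
    (Eventually.of_forall fun z => le_min (hnn _) (hnn _))]
  refine ENNReal.ofReal_le_ofReal ?_
  have h2 : ∀ z, min (a z) (a (w + z)) = 1 / 2 * (a z + a (w + z) - |a (w + z) - a z|) := by
    intro z
    rcases le_total (a z) (a (w + z)) with h | h
    · rw [min_eq_left h, abs_of_nonneg (by linarith)]; ring
    · rw [min_eq_right h, abs_of_nonpos (by linarith)]; ring
  have hadd : Integrable fun z => a z + a (w + z) := ha.add ht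
  have hsub : Integrable fun z => |a (w + z) - a z| := (ht.sub ha).abs
  have h3 : ∫ z, min (a z) (a (w + z)) =
      1 / 2 * ((∫ z, a z) + (∫ z, a z) - ∫ z, |a (w + z) - a z|) := by
    simp only [h2]
    rw [integral_const_mul, integral_sub hadd hsub, integral_add ha ht,
      integral_add_left_eq_self a w]
  rw [h3]
  linarith

/-- Integrating P(w) ≤ 2P(z) + 2P(w + z) in z against min(a(z), a(w + z)) bounds both terms on the
right by the a-average of P, while the left side keeps a factor c for small w. Doubling then reaches
any radius R. -/
theorem exists_poincare (ha : Integrable a) (hnn : ∀ z, 0 ≤ a z) (hpos : 0 < ∫ z, a z) (R : ℝ) :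
    ∃ C : ℝ≥0∞, C ≠ ⊤ ∧ ∀ P : E d → ℝ≥0∞, AEMeasurable P →
      (∀ z w, P w ≤ 2 * P z + 2 * P (w + z)) → (∀ w, P (-w) = P w) →
      ∀ w, ‖w‖ ≤ R → P w ≤ C * ∫⁻ z, P z ∂(kernelMeasure a) := by
  obtain ⟨r, hr, c, hc0, hct, hb⟩ := exists_le_lintegral_min ha hnn hpos
  obtain ⟨n, hn⟩ : ∃ n : ℕ, R < 2 ^ n * r := by
    obtain ⟨n, hn⟩ := pow_unbounded_of_one_lt (R / r) (by norm_num : (1 : ℝ) < 2)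
    exact ⟨n, by rwa [div_lt_iff₀ hr] at hn⟩
  -- The factor 4/c comes from vectors of norm below r; each of the n doublings needed to pass from
  -- r to R costs a factor 4.
  refine ⟨4 ^ n * (4 / c), ENNReal.mul_ne_top (by simp) (ENNReal.div_ne_top (by simp) hc0), ?_⟩
  intro P hP hsub heven w hw
  have hAm : AEMeasurable (fun z => ENNReal.ofReal (a z)) := ha.1.aemeasurable.ennreal_ofReal
  have hI : ∫⁻ z, P z ∂(kernelMeasure a) = ∫⁻ z, ENNReal.ofReal (a z) * P z := by
    rw [kernelMeasure, lintegral_withDensity_eq_lintegral_mul₀ hAm hP]; rfl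
  have hsmall : ∀ w : E d, ‖w‖ < r → P w ≤ 4 / c * ∫⁻ z, P z ∂(kernelMeasure a) := by
    intro w hw
    have h1 : P w * c ≤ 4 * ∫⁻ z, P z ∂(kernelMeasure a) := by
      have hAP : AEMeasurable (fun z => ENNReal.ofReal (a z) * P z) := hAm.mul hP
      have hAPw : ∫⁻ z, ENNReal.ofReal (a (w + z)) * P (w + z) =
          ∫⁻ z, ENNReal.ofReal (a z) * P z :=
        lintegral_add_left_eq_self (fun z => ENNReal.ofReal (a z) * P z) w
      calc P w * c ≤ P w * ∫⁻ z, ENNReal.ofReal (min (a z) (a (w + z))) := by gcongr; exact hb w hw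
        _ ≤ ∫⁻ z, P w * ENNReal.ofReal (min (a z) (a (w + z))) := lintegral_const_mul_le _ _
        _ ≤ ∫⁻ z, (2 * (ENNReal.ofReal (a z) * P z) +
              2 * (ENNReal.ofReal (a (w + z)) * P (w + z))) := by
            refine lintegral_mono fun z => ?_
            calc P w * ENNReal.ofReal (min (a z) (a (w + z)))
                ≤ (2 * P z + 2 * P (w + z)) * ENNReal.ofReal (min (a z) (a (w + z))) := by
                  gcongr; exact hsub z w
              _ = 2 * (ENNReal.ofReal (min (a z) (a (w + z))) * P z) +
                  2 * (ENNReal.ofReal (min (a z) (a (w + z))) * P (w + z)) := by ring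
              _ ≤ _ := by
                  gcongr
                  · exact min_le_left _ _
                  · exact min_le_right _ _
        _ = 4 * ∫⁻ z, P z ∂(kernelMeasure a) := by
            rw [lintegral_add_left' (hAP.const_mul 2), lintegral_const_mul' _ _ (by simp),
              lintegral_const_mul' _ _ (by simp), hAPw, hI, ← add_mul]
            norm_num
    rw [← ENNReal.le_div_iff_mul_le (Or.inl hc0) (Or.inl hct)] at h1
    refine h1.trans_eq ?_
    rw [ENNReal.mul_div_right_comm]
  have hdouble : ∀ (k : ℕ) (w : E d), P ((2 : ℝ) ^ k • w) ≤ 4 ^ k * P w := by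
    intro k
    induction k with
    | zero => intro w; simp
    | succ k ih =>
      intro w
      have h1 : P ((2 : ℝ) • w) ≤ 4 * P w := by
        -- Taking z = −w gives P(2w) ≤ 2P(−w) + 2P(w), which is 4P(w) by evenness.
        have := hsub (-w) ((2 : ℝ) • w)
        rw [heven, two_smul, add_neg_cancel_right, ← add_mul] at this
        rw [two_smul]
        refine this.trans_eq ?_
        norm_num
      calc P ((2 : ℝ) ^ (k + 1) • w) = P ((2 : ℝ) ^ k • (2 : ℝ) • w) := by rw [pow_succ, mul_smul]
        _ ≤ 4 ^ k * (4 * P w) := (ih _).trans (by gcongr)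
        _ = _ := by rw [pow_succ, mul_assoc]
  have h2n : (0 : ℝ) < 2 ^ n := by positivity
  have h := hdouble n (((2 : ℝ) ^ n)⁻¹ • w)
  rw [smul_smul, mul_inv_cancel₀ h2n.ne', one_smul] at h
  refine h.trans ?_
  rw [mul_assoc]
  gcongr
  refine hsmall _ ?_
  rw [norm_smul, norm_inv, Real.norm_of_nonneg h2n.le, inv_mul_lt_iff₀ h2n]
  exact hw.trans_lt hn

end Poincare

/-! ### Multiplication operators in L² -/

section MulOp

variable {G : Type*} [MeasurableSpace G] {ν : Measure G}

theorem memLp_mul_of_bound {b : G → ℝ} (hb : AEStronglyMeasurable b ν) {β : ℝ}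
    (hβ : ∀ x, |b x| ≤ β) {u : G → ℝ} (hu : MemLp u 2 ν) : MemLp (fun x => b x * u x) 2 ν :=
  MemLp.of_le_mul (c := β) hu (hb.mul hu.1) (Eventually.of_forall fun x => by
    rw [norm_mul]; exact mul_le_mul_of_nonneg_right (hβ x) (norm_nonneg _))

/-- Multiplication by a bounded measurable function, as a bounded operator in `L²`. -/
def mulOp (b : G → ℝ) (hb : AEStronglyMeasurable b ν) (β : ℝ) (hβ : ∀ x, |b x| ≤ β) :
    Lp ℝ 2 ν →L[ℝ] Lp ℝ 2 ν :=
  LinearMap.mkContinuous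
    { toFun := fun u => (memLp_mul_of_bound hb hβ (Lp.memLp u)).toLp _
      map_add' := by
        intro u v
        rw [← MemLp.toLp_add, MemLp.toLp_eq_toLp_iff]
        filter_upwards [Lp.coeFn_add u v] with x hx
        simp only [hx, Pi.add_apply, mul_add]
      map_smul' := by
        intro c u
        rw [RingHom.id_apply, ← MemLp.toLp_const_smul, MemLp.toLp_eq_toLp_iff]
        filter_upwards [Lp.coeFn_smul c u] with x hx
        simp only [hx, Pi.smul_apply, smul_eq_mul]
        ring } β (by
    intro u
    refine Lp.norm_le_mul_norm_of_ae_le_mul ?_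
    filter_upwards [(memLp_mul_of_bound hb hβ (Lp.memLp u)).coeFn_toLp] with x hx
    change ‖(memLp_mul_of_bound hb hβ (Lp.memLp u)).toLp _ x‖ ≤ _
    rw [hx, norm_mul]
    exact mul_le_mul_of_nonneg_right (hβ x) (norm_nonneg _))

variable {b : G → ℝ} {hb : AEStronglyMeasurable b ν} {β : ℝ} {hβ : ∀ x, |b x| ≤ β}

theorem coeFn_mulOp (u : Lp ℝ 2 ν) : mulOp b hb β hβ u =ᵐ[ν] fun x => b x * u x :=
  (memLp_mul_of_bound hb hβ (Lp.memLp u)).coeFn_toLp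

theorem norm_mulOp_le (h0 : 0 ≤ β) : ‖mulOp b hb β hβ‖ ≤ β :=
  LinearMap.mkContinuous_norm_le _ h0 _

theorem inner_eq_integral_mul (u v : Lp ℝ 2 ν) : inner ℝ u v = ∫ x, u x * v x ∂ν := by
  rw [L2.inner_def]
  simp [mul_comm]

end MulOp

/-! ### The nonlocal operator on L² classes and its resolvent -/

section Convolution

variable {G Z : Type*} [AddCommGroup G] [MeasurableSpace G] [MeasurableAdd₂ G] [MeasurableNeg G]
  [AddCommGroup Z] [MeasurableSpace Z] [MeasurableNeg Z]
variable {ν : Measure G} {ρ : Measure Z} [SigmaFinite ν] [IsFiniteMeasure ρ]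
  [ν.IsAddLeftInvariant] {π : Z →+ G} {m : G → ℝ} {β : ℝ}

theorem ae_ae_sub (hπ : Measurable π) {q : G → Prop} (h : ∀ᵐ x ∂ν, q x) :
    ∀ᵐ x ∂ν, ∀ᵐ z ∂ρ, q (x - π z) :=
  Measure.ae_ae_of_ae_prod ((quasiMeasurePreserving_sub (ν := ν) (ρ := ρ) hπ).ae h)

theorem genFun_congr (hπ : Measurable π) {u v : G → ℝ} (h : u =ᵐ[ν] v) :
    genFun ρ π m u =ᵐ[ν] genFun ρ π m v := by
  filter_upwards [h, ae_ae_sub (ρ := ρ) hπ h] with x hx hz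
  refine integral_congr_ae ?_
  filter_upwards [hz] with z hz
  rw [hx, hz]

theorem genFun_add (hπ : Measurable π) (hm : AEStronglyMeasurable m ν) (hβ : ∀ x, |m x| ≤ β)
    {u v : G → ℝ} (hu : MemLp u 2 ν) (hv : MemLp v 2 ν) :
    genFun ρ π m (u + v) =ᵐ[ν] genFun ρ π m u + genFun ρ π m v := by
  filter_upwards [(genFun_aux (ρ := ρ) hπ hm hβ hu).1, (genFun_aux (ρ := ρ) hπ hm hβ hv).1]
    with x h1 h2
  rw [Pi.add_apply, genFun, genFun, genFun, ← integral_add h1 h2]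
  congr 1; ext z; simp only [Pi.add_apply]; ring

theorem genFun_smul (c : ℝ) (u : G → ℝ) : genFun ρ π m (c • u) = c • genFun ρ π m u := by
  ext x
  simp only [genFun, Pi.smul_apply, smul_eq_mul, ← integral_const_mul]
  congr 1; ext z; ring

variable [ρ.IsNegInvariant]

/-- The linear map underlying `symOp`. -/
def symLin (hπ : Measurable π) (hm : AEStronglyMeasurable m ν) (hβ : ∀ x, |m x| ≤ β) :
    Lp ℝ 2 ν →ₗ[ℝ] Lp ℝ 2 ν where
  toFun u := (memLp_mul_of_bound hm hβ (genFun_aux (ρ := ρ) hπ hm hβ (Lp.memLp u)).2).toLp _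
  map_add' u v := by
    rw [← MemLp.toLp_add, MemLp.toLp_eq_toLp_iff]
    filter_upwards [genFun_congr (ρ := ρ) (m := m) hπ (Lp.coeFn_add u v),
      genFun_add (ρ := ρ) hπ hm hβ (Lp.memLp u) (Lp.memLp v)] with x h1 h2
    rw [h1, h2]
    simp only [Pi.add_apply, mul_add]
  map_smul' c u := by
    rw [RingHom.id_apply, ← MemLp.toLp_const_smul, MemLp.toLp_eq_toLp_iff]
    filter_upwards [genFun_congr (ρ := ρ) (m := m) hπ (Lp.coeFn_smul c u)] with x h1
    rw [h1, genFun_smul]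
    simp only [Pi.smul_apply, smul_eq_mul]
    ring

theorem coeFn_symLin (hπ : Measurable π) (hm : AEStronglyMeasurable m ν) (hβ : ∀ x, |m x| ≤ β)
    (u : Lp ℝ 2 ν) : symLin (ρ := ρ) hπ hm hβ u =ᵐ[ν] fun x => m x * genFun ρ π m u x :=
  (memLp_mul_of_bound hm hβ (genFun_aux (ρ := ρ) hπ hm hβ (Lp.memLp u)).2).coeFn_toLp

theorem inner_symLin (hπ : Measurable π) (hm : AEStronglyMeasurable m ν) (hβ : ∀ x, |m x| ≤ β)
    (u v : Lp ℝ 2 ν) : inner ℝ (symLin (ρ := ρ) hπ hm hβ u) v =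
      -(1 / 2 * ∫ y : G × Z, m y.1 * m (y.1 - π y.2) *
      (u (y.1 - π y.2) - u y.1) * (v (y.1 - π y.2) - v y.1) ∂(ν.prod ρ)) := by
  rw [← integral_genFun_mul hπ hm hβ (Lp.memLp u) (Lp.memLp v), inner_eq_integral_mul]
  refine integral_congr_ae ?_
  filter_upwards [coeFn_symLin (ρ := ρ) hπ hm hβ u] with x hx
  rw [hx]

theorem isSymmetric_symLin (hπ : Measurable π) (hm : AEStronglyMeasurable m ν)
    (hβ : ∀ x, |m x| ≤ β) : (symLin (ρ := ρ) hπ hm hβ).IsSymmetric := by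
  intro u v
  rw [real_inner_comm _ u, inner_symLin, inner_symLin]
  congr 3; ext y; ring

/-- The bounded symmetric operator `u ↦ m(x) ∫ m(x - πz) (u(x - πz) - u(x)) dρ(z)` in `L²`. -/
def symOp (hπ : Measurable π) (hm : AEStronglyMeasurable m ν) (hβ : ∀ x, |m x| ≤ β) :
    Lp ℝ 2 ν →L[ℝ] Lp ℝ 2 ν :=
  -- Hellinger–Toeplitz: a symmetric operator defined on the whole Hilbert space is bounded, so no
  -- norm estimate is needed.
  ⟨symLin (ρ := ρ) hπ hm hβ, (isSymmetric_symLin (ρ := ρ) hπ hm hβ).continuous⟩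

theorem coeFn_symOp (hπ : Measurable π) (hm : AEStronglyMeasurable m ν) (hβ : ∀ x, |m x| ≤ β)
    (u : Lp ℝ 2 ν) : symOp (ρ := ρ) hπ hm hβ u =ᵐ[ν] fun x => m x * genFun ρ π m u x :=
  coeFn_symLin hπ hm hβ u

theorem inner_symOp (hπ : Measurable π) (hm : AEStronglyMeasurable m ν) (hβ : ∀ x, |m x| ≤ β)
    (u v : Lp ℝ 2 ν) : inner ℝ (symOp (ρ := ρ) hπ hm hβ u) v =
      -(1 / 2 * ∫ y : G × Z, m y.1 * m (y.1 - π y.2) *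
      (u (y.1 - π y.2) - u y.1) * (v (y.1 - π y.2) - v y.1) ∂(ν.prod ρ)) :=
  inner_symLin hπ hm hβ u v

theorem inner_symOp_self_nonpos (hπ : Measurable π) (hm : AEStronglyMeasurable m ν)
    (hβ : ∀ x, |m x| ≤ β) (h0 : ∀ x, 0 ≤ m x) (u : Lp ℝ 2 ν) :
    inner ℝ (symOp (ρ := ρ) hπ hm hβ u) u ≤ 0 := by
  rw [inner_symOp]
  have : 0 ≤ ∫ y : G × Z, m y.1 * m (y.1 - π y.2) *
      (u (y.1 - π y.2) - u y.1) * (u (y.1 - π y.2) - u y.1) ∂(ν.prod ρ) := by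
    refine integral_nonneg fun y => ?_
    rw [mul_assoc]
    exact mul_nonneg (mul_nonneg (h0 _) (h0 _)) (mul_self_nonneg _)
  linarith

/-- Let M and N be multiplication by m/l and l/m, and A the symmetric operator. Then L = sNA and L −
k = −N(kM − sA). Since A ≤ 0, the coercivity constant kα₁/α₂ of the bracket comes from M alone, so
the bound on R = −(kM − sA)⁻¹M does not involve s, later taken to be ε⁻². -/
theorem exists_resolvent (hπ : Measurable π) {l : G → ℝ} (hm : AEStronglyMeasurable m ν)
    (hl : AEStronglyMeasurable l ν) {α₁ α₂ : ℝ} (hα : 0 < α₁) (hmb : ∀ x, α₁ ≤ m x ∧ m x ≤ α₂)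
    (hlb : ∀ x, α₁ ≤ l x ∧ l x ≤ α₂) {s k : ℝ} (hs : 0 < s) (hk : 0 < k) :
    ∃ L R : Lp ℝ 2 ν →L[ℝ] Lp ℝ 2 ν,
      (∀ u : Lp ℝ 2 ν, L u =ᵐ[ν] fun x => s * (l x * genFun ρ π m u x)) ∧
      (∀ f, L (R f) - k • R f = f) ∧ (∀ u, R (L u - k • u) = u) ∧
      ‖R‖ ≤ (k * (α₁ / α₂))⁻¹ * (α₂ / α₁) := by
  have hα₂ : 0 < α₂ := hα.trans_le ((hmb 0).1.trans (hmb 0).2)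
  have hm0 : ∀ x, 0 < m x := fun x => hα.trans_le (hmb x).1
  have hl0 : ∀ x, 0 < l x := fun x => hα.trans_le (hlb x).1
  have hβ : ∀ x, |m x| ≤ α₂ := fun x => by rw [abs_of_pos (hm0 x)]; exact (hmb x).2
  have hq : ∀ p q : G → ℝ, (∀ x, α₁ ≤ p x ∧ p x ≤ α₂) → (∀ x, α₁ ≤ q x ∧ q x ≤ α₂) →
      ∀ x, |p x / q x| ≤ α₂ / α₁ := by
    intro p q hp hq x
    have h1 := hα.trans_le (hp x).1
    have h2 := hα.trans_le (hq x).1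
    rw [abs_of_pos (by positivity)]
    exact div_le_div₀ hα₂.le (hp x).2 hα (hq x).1
  have hml : AEStronglyMeasurable (fun x => m x / l x) ν :=
    (hm.aemeasurable.div hl.aemeasurable).aestronglyMeasurable
  have hlm : AEStronglyMeasurable (fun x => l x / m x) ν :=
    (hl.aemeasurable.div hm.aemeasurable).aestronglyMeasurable
  set M := mulOp (fun x => m x / l x) hml _ (hq m l hmb hlb) with hM
  set N := mulOp (fun x => l x / m x) hlm _ (hq l m hlb hmb) with hN
  set A := symOp (ρ := ρ) hπ hm hβ with hA
  have hMN : ∀ u, N (M u) = u := by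
    intro u
    refine Lp.ext ?_
    filter_upwards [coeFn_mulOp (hb := hlm) (hβ := hq l m hlb hmb) (M u),
      coeFn_mulOp (hb := hml) (hβ := hq m l hmb hlb) u] with x h1 h2
    rw [h1, h2]
    have := hm0 x
    have := hl0 x
    field_simp
  have hNM : ∀ u, M (N u) = u := by
    intro u
    refine Lp.ext ?_
    filter_upwards [coeFn_mulOp (hb := hml) (hβ := hq m l hmb hlb) (N u),
      coeFn_mulOp (hb := hlm) (hβ := hq l m hlb hmb) u] with x h1 h2
    rw [h1, h2]
    have := hm0 x
    have := hl0 x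
    field_simp
  have hcoer : ∀ u, k * (α₁ / α₂) * ‖u‖ ^ 2 ≤ inner ℝ ((k • M - s • A) u) u := by
    intro u
    have h1 : α₁ / α₂ * ‖u‖ ^ 2 ≤ inner ℝ (M u) u := by
      rw [← real_inner_self_eq_norm_sq, inner_eq_integral_mul, inner_eq_integral_mul,
        ← integral_const_mul]
      have i1 : Integrable (fun x => u x * u x) ν := (Lp.memLp u).integrable_mul (Lp.memLp u)
      have i2 : Integrable (fun x => M u x * u x) ν := (Lp.memLp (M u)).integrable_mul (Lp.memLp u)
      refine integral_mono_ae (i1.const_mul _) i2 ?_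
      filter_upwards [coeFn_mulOp (hb := hml) (hβ := hq m l hmb hlb) u] with x hx
      rw [hx, mul_assoc]
      exact mul_le_mul_of_nonneg_right (div_le_div₀ (hm0 x).le (hmb x).1 (hl0 x) (hlb x).2)
        (mul_self_nonneg _)
    have h2 := inner_symOp_self_nonpos (ρ := ρ) hπ hm hβ (fun x => (hm0 x).le) u
    simp only [_root_.sub_apply, _root_.smul_apply, inner_sub_left,
      real_inner_smul_left]
    nlinarith
  obtain ⟨S, hS1, hS2, hS3⟩ := exists_inverse_of_coercive (k • M - s • A)
    (c := k * (α₁ / α₂)) (by positivity) hcoer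
  have hLO : ∀ u, N (s • A u) - k • u = -N ((k • M - s • A) u) := by
    intro u
    simp only [_root_.sub_apply, _root_.smul_apply, map_sub, map_smul,
      hMN]
    abel
  refine ⟨N.comp (s • A), -(S.comp M), fun u => ?_, fun f => ?_, fun u => ?_, ?_⟩
  · have h1 := coeFn_mulOp (hb := hlm) (hβ := hq l m hlb hmb) (s • A u)
    filter_upwards [h1, Lp.coeFn_smul s (A u), coeFn_symOp (ρ := ρ) hπ hm hβ u] with x h1 h2 h3
    refine h1.trans ?_
    rw [h2, Pi.smul_apply, h3, smul_eq_mul]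
    have := hm0 x
    field_simp
  · have := hLO (-(S (M f)))
    simp only [ContinuousLinearMap.comp_apply, _root_.neg_apply,
      _root_.smul_apply]
    rw [this, map_neg, hS1, map_neg, neg_neg, hMN]
  · simp only [ContinuousLinearMap.comp_apply, _root_.neg_apply,
      _root_.smul_apply]
    rw [hLO, map_neg, map_neg, neg_neg, hNM, hS2]
  · rw [norm_neg]
    exact (ContinuousLinearMap.opNorm_comp_le _ _).trans
      (mul_le_mul hS3 (norm_mulOp_le (by positivity)) (norm_nonneg _) (by positivity))

end Convolution

/-! ### The torus -/

/-- The torus `ℝ^d / ℤ^d`. -/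
abbrev Torus (d : ℕ) : Type := Fin d → UnitAddCircle

variable {d : ℕ}

instance : IsProbabilityMeasure (volume : Measure UnitAddCircle) :=
  ⟨by simp [AddCircle.measure_univ]⟩

instance : (volume : Measure (Torus d)).IsNegInvariant :=
  Measure.IsAddHaarMeasure.isNegInvariant_of_regular _

/-- The projection of `ℝ^d` onto the torus. -/
def proj (d : ℕ) : E d →+ Torus d where
  toFun x i := (x i : UnitAddCircle)
  map_zero' := by ext i; simp
  map_add' x y := by ext i; simp

theorem measurable_proj : Measurable (proj d) := by
  refine Continuous.measurable (continuous_pi fun i => ?_)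
  exact (AddCircle.continuous_mk' 1).comp (EuclideanSpace.proj (𝕜 := ℝ) i).continuous

/-- The section of `proj` with values in the unit cell. -/
def sec (t : Torus d) : E d := WithLp.toLp 2 fun i => ((AddCircle.equivIco 1 0 (t i) : ℝ))

theorem proj_sec (t : Torus d) : proj d (sec t) = t := by
  ext i
  exact (AddCircle.equivIco 1 0).symm_apply_apply (t i)

theorem sec_proj {x : E d} (hx : x ∈ unitCell d) : sec (proj d x) = x := by
  ext i
  have := AddCircle.equivIco_coe_eq (p := (1 : ℝ)) (a := 0) (x := x i) (by simpa using hx i)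
  simp only [sec, proj, AddMonoidHom.coe_mk, ZeroHom.coe_mk]
  rw [this]

theorem measurable_sec : Measurable (sec (d := d)) := by
  refine (PiLp.continuous_toLp 2 _).measurable.comp (measurable_pi_lambda _ fun i => ?_)
  exact measurable_subtype_coe.comp
    ((AddCircle.measurableEquivIco 1 0).measurable.comp (measurable_pi_apply i))

theorem unitCell_eq : unitCell d = (fun x : E d => x.ofLp) ⁻¹'
    (Set.univ.pi fun _ => Set.Ico (0 : ℝ) 1) := by
  ext x; simp [unitCell]

theorem measurableSet_unitCell : MeasurableSet (unitCell d) := by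
  rw [unitCell_eq]
  exact (PiLp.continuous_ofLp 2 _).measurable
    (MeasurableSet.univ_pi fun _ => measurableSet_Ico)

theorem measurePreserving_proj :
    MeasurePreserving (proj d) (volume.restrict (unitCell d)) volume := by
  have h1 : MeasurePreserving (fun x : E d => x.ofLp) (volume.restrict (unitCell d))
      (volume.restrict (Set.univ.pi fun _ => Set.Ico (0 : ℝ) 1)) := by
    rw [unitCell_eq]
    exact (PiLp.volume_preserving_ofLp (Fin d)).restrict_preimage
      (MeasurableSet.univ_pi fun _ => measurableSet_Ico)
  have h2 : (volume.restrict (Set.univ.pi fun _ : Fin d => Set.Ico (0 : ℝ) 1)) =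
      Measure.pi fun _ : Fin d => (volume : Measure ℝ).restrict (Set.Ioc (0 : ℝ) (0 + 1)) := by
    rw [volume_pi, Measure.restrict_pi_pi]
    congr 1; ext1 i
    rw [zero_add]
    exact Measure.restrict_congr_set Ico_ae_eq_Ioc
  rw [h2] at h1
  have h3 := measurePreserving_pi (fun _ : Fin d =>
    (volume : Measure ℝ).restrict (Set.Ioc (0 : ℝ) (0 + 1))) (fun _ : Fin d =>
    (volume : Measure UnitAddCircle)) (fun _ => UnitAddCircle.measurePreserving_mk 0)
  exact h3.comp h1

theorem measurePreserving_sec :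
    MeasurePreserving (sec (d := d)) volume (volume.restrict (unitCell d)) := by
  refine ⟨measurable_sec, ?_⟩
  rw [← measurePreserving_proj.map_eq, Measure.map_map measurable_sec measurable_proj]
  have : (sec ∘ proj d) =ᵐ[volume.restrict (unitCell d)] id := by
    filter_upwards [ae_restrict_mem measurableSet_unitCell] with x hx using sec_proj hx
  rw [Measure.map_congr this, Measure.map_id]

theorem volume_unitCell : volume (unitCell d) = 1 := by
  have := (measurePreserving_proj (d := d)).measure_preimage MeasurableSet.univ.nullMeasurableSet
  simpa using this

instance : IsProbabilityMeasure ((volume : Measure (E d)).restrict (unitCell d)) :=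
  ⟨by rw [Measure.restrict_apply_univ, volume_unitCell]⟩

theorem norm_le_of_mem_unitCell {x : E d} (hx : x ∈ unitCell d) : ‖x‖ ≤ d := by
  rw [EuclideanSpace.norm_eq]
  refine Real.sqrt_le_iff.2 ⟨by positivity, ?_⟩
  calc ∑ i, ‖x i‖ ^ 2 ≤ ∑ _i : Fin d, (1 : ℝ) := by
        refine Finset.sum_le_sum fun i _ => ?_
        rw [Real.norm_of_nonneg (hx i).1]
        exact pow_le_one₀ (hx i).1 (hx i).2.le
    _ = d := by simp
    _ ≤ (d : ℝ) ^ 2 := by exact_mod_cast Nat.le_self_pow (by norm_num) d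

theorem IsPeriodic.eq_of_proj_eq {g : E d → ℝ} (hg : IsPeriodic g) {x y : E d}
    (h : proj d x = proj d y) : g x = g y := by
  have hn : ∀ i, ∃ n : ℤ, x i = y i + n := by
    intro i
    have h1 : ((x i : ℝ) : UnitAddCircle) = (y i : UnitAddCircle) := congrFun h i
    obtain ⟨n, hn⟩ := (AddCircle.coe_eq_zero_iff (1 : ℝ) (x := x i - y i)).1 (by
      rw [AddCircle.coe_sub, h1, sub_self])
    exact ⟨n, by simp at hn; linarith⟩
  choose n hn using hn
  have hs : ∀ (s : Finset (Fin d)) (y : E d), g (y + ∑ i ∈ s, n i • e i) = g y := by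
    intro s
    induction s using Finset.induction_on with
    | empty => simp
    | insert i s hi ih =>
      intro y
      rw [Finset.sum_insert hi, ← add_assoc, ih]
      exact (hg i).zsmul (n i) y
  have hx : x = y + ∑ i, n i • e i := by
    ext j
    rw [PiLp.add_apply, hn j]
    simp [Finset.sum_apply, Pi.single_apply]
  rw [hx, hs]

theorem IsPeriodic.comp_sec_proj {g : E d → ℝ} (hg : IsPeriodic g) (x : E d) :
    g (sec (proj d x)) = g x := hg.eq_of_proj_eq (proj_sec _)

theorem isPeriodic_comp_proj (p : Torus d → ℝ) : IsPeriodic fun x => p (proj d x) := by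
  intro i x
  have h : proj d (e i) = 0 := by
    ext j
    by_cases hij : j = i
    · subst hij; simp [proj]
    · simp [proj, hij]
  simp [map_add, h]

/-- The cell has volume 1, so one may average over s in it; moving the shift εs from h' onto the
oscillating factor and exchanging integrals, the average of p over the cell becomes ∫p. The bound is
uniform in ε and t although p is only measurable, which allows correctors that are merely L². -/
theorem lintegral_proj_mul_le {p : Torus d → ℝ≥0∞} (hp : Measurable p) {h h' : E d → ℝ≥0∞}
    (hh' : Measurable h') {ε : ℝ} (hε : ε ≠ 0) (t : Torus d)
    (hle : ∀ x, ∀ s ∈ unitCell d, h x ≤ h' (x + ε • s)) :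
    ∫⁻ x, p (proj d (ε⁻¹ • x) - t) * h x ≤ (∫⁻ τ, p τ) * ∫⁻ x, h' x := by
  have hm : Measurable fun x : E d => p (proj d (ε⁻¹ • x) - t) :=
    hp.comp ((measurable_proj.comp (measurable_const_smul ε⁻¹)).sub_const t)
  calc ∫⁻ x, p (proj d (ε⁻¹ • x) - t) * h x
      = ∫⁻ s in unitCell d, ∫⁻ x, p (proj d (ε⁻¹ • x) - t) * h x := by simp
    _ ≤ ∫⁻ s in unitCell d, ∫⁻ x, p (proj d (ε⁻¹ • x) - t) * h' (x + ε • s) := by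
        refine setLIntegral_mono' measurableSet_unitCell fun s hs => lintegral_mono fun x => ?_
        gcongr
        exact hle x s hs
    _ = ∫⁻ s in unitCell d, ∫⁻ x, p (proj d (ε⁻¹ • x) - t - proj d s) * h' x := by
        refine lintegral_congr fun s => ?_
        rw [← lintegral_add_right_eq_self
          (fun x => p (proj d (ε⁻¹ • x) - t - proj d s) * h' x) (ε • s)]
        refine lintegral_congr fun x => ?_
        rw [smul_add, smul_smul, inv_mul_cancel₀ hε, one_smul, map_add]
        congr 2; abel
    _ = ∫⁻ x, ∫⁻ s in unitCell d, p (proj d (ε⁻¹ • x) - t - proj d s) * h' x := by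
        refine lintegral_lintegral_swap (Measurable.aemeasurable ?_)
        refine (hp.comp ?_).mul (hh'.comp measurable_snd)
        exact ((measurable_proj.comp ((measurable_const_smul ε⁻¹).comp measurable_snd)).sub_const
          t).sub (measurable_proj.comp measurable_fst)
    _ = ∫⁻ x, (∫⁻ τ, p τ) * h' x := by
        refine lintegral_congr fun x => ?_
        have hpm : Measurable fun τ => p (proj d (ε⁻¹ • x) - t - τ) :=
          hp.comp (measurable_const.sub measurable_id)
        have hpm' : Measurable fun s => p (proj d (ε⁻¹ • x) - t - proj d s) :=
          hpm.comp measurable_proj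
        rw [lintegral_mul_const _ hpm']
        congr 1
        rw [measurePreserving_proj.lintegral_comp hpm, lintegral_sub_left_eq_self]
    _ = _ := lintegral_const_mul _ hh'

/-- The averaging bound applied to the indicator of a null set. It transfers almost everywhere
statements about the torus to almost every x at scale ε. -/
theorem quasiMeasurePreserving_proj_smul {ε : ℝ} (hε : ε ≠ 0) :
    Measure.QuasiMeasurePreserving (fun x : E d => proj d (ε⁻¹ • x)) volume volume := by
  have hm : Measurable fun x : E d => proj d (ε⁻¹ • x) :=
    measurable_proj.comp (measurable_const_smul ε⁻¹)
  refine ⟨hm, Measure.AbsolutelyContinuous.mk fun N hN h0 => ?_⟩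
  have h := lintegral_proj_mul_le (p := N.indicator 1) (measurable_one.indicator hN)
    (h := 1) (h' := 1) measurable_one hε 0 (fun _ _ _ => le_rfl)
  rw [lintegral_indicator_one hN, h0, zero_mul] at h
  rw [Measure.map_apply hm hN, ← lintegral_indicator_one (hm hN)]
  refine le_antisymm (le_trans (le_of_eq ?_) h) zero_le
  refine lintegral_congr fun x => ?_
  simp only [sub_zero, Pi.one_apply, mul_one]
  rfl

theorem quasiMeasurePreserving_proj :
    Measure.QuasiMeasurePreserving (proj d) volume volume := by
  simpa using quasiMeasurePreserving_proj_smul (d := d) one_ne_zero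

/-! ### The kernel measure -/

section Kernel

variable {a : E d → ℝ}

theorem isFiniteMeasure_kernelMeasure (ha : Integrable a) : IsFiniteMeasure (kernelMeasure a) :=
  isFiniteMeasure_withDensity_ofReal ha.2

theorem isNegInvariant_kernelMeasure (ha : Integrable a) (heven : ∀ z, a (-z) = a z) :
    (kernelMeasure a).IsNegInvariant := by
  have hA : AEMeasurable fun z => ENNReal.ofReal (a z) := ha.1.aemeasurable.ennreal_ofReal
  refine ⟨Measure.ext fun s hs => ?_⟩
  have hs' : MeasurableSet (-s) := hs.neg
  rw [Measure.neg_apply, kernelMeasure, withDensity_apply _ hs, withDensity_apply _ hs',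
    ← lintegral_indicator hs, ← lintegral_indicator hs',
    ← lintegral_neg_eq_self (s.indicator fun z => ENNReal.ofReal (a z))]
  refine lintegral_congr fun z => ?_
  simp only [Set.indicator, heven]
  rfl

theorem integrable_kernelMeasure_iff (ha : Integrable a) (hnn : ∀ z, 0 ≤ a z) {f : E d → ℝ} :
    Integrable f (kernelMeasure a) ↔ Integrable fun z => a z * f z := by
  rw [kernelMeasure, integrable_withDensity_iff_integrable_smul₀' ha.1.aemeasurable.ennreal_ofReal
    (Eventually.of_forall fun z => ENNReal.ofReal_lt_top)]
  simp only [ENNReal.toReal_ofReal (hnn _), smul_eq_mul]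

theorem integral_kernelMeasure (ha : Integrable a) (hnn : ∀ z, 0 ≤ a z) (f : E d → ℝ) :
    ∫ z, f z ∂(kernelMeasure a) = ∫ z, a z * f z := by
  rw [kernelMeasure, integral_withDensity_eq_integral_toReal_smul₀
    ha.1.aemeasurable.ennreal_ofReal (Eventually.of_forall fun z => ENNReal.ofReal_lt_top)]
  simp only [ENNReal.toReal_ofReal (hnn _), smul_eq_mul]

end Kernel

/-! ### The Poincaré inequality on the torus -/

section TorusPoincare

variable {d : ℕ} {a : E d → ℝ}

/-- The squared `L²`-norm of the increment by `-z` of the function `x ↦ u(x) + ⟪v, x⟫`. -/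
def incrSq (v : E d) (u : Torus d → ℝ) (z : E d) : ℝ≥0∞ :=
  ∫⁻ t, ‖u (t - proj d z) - u t - inner ℝ v z‖ₑ ^ 2

theorem aesm_incr {ρ : Measure (E d)} [SFinite ρ] (v : E d) {u : Torus d → ℝ}
    (hu : AEStronglyMeasurable u) :
    AEStronglyMeasurable (fun y : Torus d × E d => u (y.1 - proj d y.2) - u y.1 - inner ℝ v y.2)
      ((volume : Measure (Torus d)).prod ρ) :=
  ((aesm_sub measurable_proj hu).sub (aesm_fst hu)).sub
    (continuous_const.inner continuous_snd).aestronglyMeasurable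

theorem aemeasurable_incrSq {ρ : Measure (E d)} [SFinite ρ] (v : E d) {u : Torus d → ℝ}
    (hu : AEStronglyMeasurable u) : AEMeasurable (incrSq v u) ρ :=
  ((aesm_incr (ρ := ρ) v hu).enorm.pow_const 2).lintegral_prod_left'

/-- The increment by w + z is the increment by w plus a translate of the increment by z, and the
linear term is additive, so the identity survives for every v. Conclude with (A − B)² ≤ 2A² + 2B²
and translation invariance. -/
theorem incrSq_le (v : E d) {u : Torus d → ℝ} (hu : AEStronglyMeasurable u) (z w : E d) :
    incrSq v u w ≤ 2 * incrSq v u z + 2 * incrSq v u (w + z) := by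
  have hmp : ∀ s : Torus d, MeasurePreserving (fun t : Torus d => t - s) volume volume :=
    fun s => measurePreserving_sub_right volume s
  have hsec : ∀ z, AEMeasurable (fun t => ‖u (t - proj d z) - u t - inner ℝ v z‖ₑ ^ 2) :=
    fun z => (((hu.comp_measurePreserving (hmp _)).sub hu).sub
      aestronglyMeasurable_const).enorm.pow_const 2
  have h1 : incrSq v u z =
      ∫⁻ t, ‖u (t - proj d w - proj d z) - u (t - proj d w) - inner ℝ v z‖ₑ ^ 2 :=
    (lintegral_sub_right_eq_self (μ := (volume : Measure (Torus d)))
      (fun t => ‖u (t - proj d z) - u t - inner ℝ v z‖ₑ ^ 2) (proj d w)).symm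
  rw [h1, incrSq, incrSq, ← lintegral_const_mul' _ _ (by simp), ← lintegral_const_mul' _ _ (by simp),
    ← lintegral_add_right' _ ((hsec (w + z)).const_mul 2)]
  refine lintegral_mono fun t => ?_
  have h2 : u (t - proj d w) - u t - inner ℝ v w =
      (u (t - proj d (w + z)) - u t - inner ℝ v (w + z)) -
      (u (t - proj d w - proj d z) - u (t - proj d w) - inner ℝ v z) := by
    have h4 : t - proj d (w + z) = t - proj d w - proj d z := by rw [map_add]; abel
    rw [h4, inner_add_right]; ring
  have h3 : ∀ x : ℝ, ‖x‖ₑ ^ 2 = ENNReal.ofReal (x ^ 2) := fun x => by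
    rw [Real.enorm_eq_ofReal_abs, ← ENNReal.ofReal_pow (abs_nonneg _), sq_abs]
  rw [h2]
  generalize u (t - proj d (w + z)) - u t - inner ℝ v (w + z) = A
  generalize u (t - proj d w - proj d z) - u (t - proj d w) - inner ℝ v z = B
  rw [h3, h3, h3, show (2 : ℝ≥0∞) = ENNReal.ofReal 2 by simp, ← ENNReal.ofReal_mul (by norm_num),
    ← ENNReal.ofReal_mul (by norm_num), ← ENNReal.ofReal_add (by positivity) (by positivity)]
  exact ENNReal.ofReal_le_ofReal (by nlinarith [sq_nonneg (A + B)])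

theorem incrSq_neg (v : E d) (u : Torus d → ℝ) (w : E d) : incrSq v u (-w) = incrSq v u w := by
  rw [incrSq, ← lintegral_sub_right_eq_self _ (proj d w)]
  refine lintegral_congr fun t => ?_
  rw [map_neg, sub_neg_eq_add, sub_add_cancel, inner_neg_right, ← enorm_neg]
  congr 2; ring

theorem exists_incrSq_le (ha : Integrable a) (hnn : ∀ z, 0 ≤ a z) (hpos : 0 < ∫ z, a z) (R : ℝ) :
    ∃ C : ℝ≥0∞, C ≠ ⊤ ∧ ∀ (v : E d) (u : Torus d → ℝ), AEStronglyMeasurable u →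
      ∀ w, ‖w‖ ≤ R → incrSq v u w ≤ C * ∫⁻ z, incrSq v u z ∂(kernelMeasure a) := by
  obtain ⟨C, hC, h⟩ := exists_poincare ha hnn hpos R
  exact ⟨C, hC, fun v u hu w hw => h _ (aemeasurable_incrSq v hu) (incrSq_le v hu)
    (incrSq_neg v u) w hw⟩

theorem enorm_sq_eq_ofReal (x : ℝ) : ‖x‖ₑ ^ 2 = ENNReal.ofReal (x ^ 2) := by
  rw [Real.enorm_eq_ofReal_abs, ← ENNReal.ofReal_pow (abs_nonneg _), sq_abs]

/-- As w runs over the cell, t − w runs over the whole torus, so this averages (u(s) − u(t))² over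
all pairs and yields twice the variance. -/
theorem setLIntegral_incrSq {u : Torus d → ℝ} (hu : MemLp u 2) :
    ∫⁻ w in unitCell d, incrSq 0 u w =
      ENNReal.ofReal (2 * (∫ t, u t ^ 2) - 2 * (∫ t, u t) ^ 2) := by
  have hi : Integrable u := hu.integrable (by norm_num)
  have hi2 : Integrable fun t => u t ^ 2 := hu.integrable_sq
  have hsw : ∫⁻ w in unitCell d, incrSq 0 u w =
      ∫⁻ t, ∫⁻ w in unitCell d, ‖u (t - proj d w) - u t - inner ℝ (0 : E d) w‖ₑ ^ 2 :=
    (lintegral_lintegral_swap ((aesm_incr 0 hu.1).enorm.pow_const 2)).symm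
  have hsq : ∀ t, ∫ s, (u s - u t) ^ 2 = (∫ s, u s ^ 2) - 2 * u t * (∫ s, u s) + u t ^ 2 := by
    intro t
    have h1 : ∀ s, (u s - u t) ^ 2 = u s ^ 2 - 2 * u t * u s + u t ^ 2 := fun s => by ring
    have h2 : Integrable fun s => u s ^ 2 - 2 * u t * u s := hi2.sub (hi.const_mul _)
    simp only [h1]
    rw [integral_add h2 (integrable_const _), integral_sub hi2 (hi.const_mul _),
      integral_const_mul]
    simp
  have hin : ∀ t, ∫⁻ w in unitCell d, ‖u (t - proj d w) - u t - inner ℝ (0 : E d) w‖ₑ ^ 2 =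
      ENNReal.ofReal ((∫ s, u s ^ 2) - 2 * u t * (∫ s, u s) + u t ^ 2) := by
    intro t
    have hms : AEMeasurable (fun s => ‖u (t - s) - u t‖ₑ ^ 2) (volume : Measure (Torus d)) :=
      ((hu.1.comp_measurePreserving (Measure.measurePreserving_sub_left volume t)).sub
        aestronglyMeasurable_const).enorm.pow_const 2
    calc _ = ∫⁻ w in unitCell d, ‖u (t - proj d w) - u t‖ₑ ^ 2 := by simp
      _ = ∫⁻ s, ‖u (t - s) - u t‖ₑ ^ 2 := by
          rw [← measurePreserving_proj.map_eq] at hms ⊢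
          rw [lintegral_map' hms measurable_proj.aemeasurable]
      _ = ∫⁻ s, ‖u s - u t‖ₑ ^ 2 := lintegral_sub_left_eq_self (fun s => ‖u s - u t‖ₑ ^ 2) t
      _ = ∫⁻ s, ENNReal.ofReal ((u s - u t) ^ 2) := by simp only [enorm_sq_eq_ofReal]
      _ = ENNReal.ofReal (∫ s, (u s - u t) ^ 2) := by
          have : Integrable fun s => (u s - u t) ^ 2 := (hu.sub (memLp_const (u t))).integrable_sq
          rw [ofReal_integral_eq_lintegral_ofReal this (Eventually.of_forall fun s => sq_nonneg _)]
      _ = _ := by rw [hsq]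
  have hg1 : Integrable fun t => (∫ s, u s ^ 2) - 2 * u t * (∫ s, u s) :=
    (integrable_const _).sub ((hi.const_mul 2).mul_const _)
  have hg : Integrable fun t => (∫ s, u s ^ 2) - 2 * u t * (∫ s, u s) + u t ^ 2 := hg1.add hi2
  have hg0 : ∀ t, 0 ≤ (∫ s, u s ^ 2) - 2 * u t * (∫ s, u s) + u t ^ 2 := by
    intro t
    rw [← hsq]
    exact integral_nonneg fun s => sq_nonneg _
  rw [hsw]
  simp only [hin]
  rw [← ofReal_integral_eq_lintegral_ofReal hg (Eventually.of_forall hg0)]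
  congr 1
  rw [integral_add hg1 hi2,
    integral_sub (integrable_const _) ((hi.const_mul 2).mul_const _), integral_mul_const,
    integral_const_mul]
  simp
  ring

variable {m : Torus d → ℝ} {α₁ α₂ : ℝ}

/-- The Poincaré inequality is applied on the ball of radius d, which contains the cell, and
integrated over the cell: the variance of u is controlled by its increments under a(z) dz, and m ≥
α₁ compares these with the Dirichlet form. -/
theorem exists_coercive (ha : Integrable a) (hnn : ∀ z, 0 ≤ a z) (heven : ∀ z, a (-z) = a z)
    (hpos : 0 < ∫ z, a z) (hm : AEStronglyMeasurable m) (hα : 0 < α₁)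
    (hmb : ∀ t, α₁ ≤ m t ∧ m t ≤ α₂) :
    ∃ C : ℝ, 0 < C ∧ ∀ u : Torus d → ℝ, MemLp u 2 → ∫ t, u t ^ 2 ≤
      C * -(∫ t, m t * genFun (kernelMeasure a) (proj d) m u t * u t) + (∫ t, u t) ^ 2 := by
  have := isFiniteMeasure_kernelMeasure ha
  have := isNegInvariant_kernelMeasure ha heven
  obtain ⟨C, hC, hP⟩ := exists_incrSq_le ha hnn hpos (d : ℝ)
  have hβ : ∀ x, |m x| ≤ α₂ := fun x => by
    rw [abs_of_pos (hα.trans_le (hmb x).1)]; exact (hmb x).2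
  -- The 2 in front of the variance cancels the ½ of the Dirichlet form; the + 1 only makes the
  -- constant positive.
  refine ⟨(C.toReal + 1) * (α₁ ^ 2)⁻¹, by positivity, fun u hu => ?_⟩
  set D := ∫ y : Torus d × E d, (u (y.1 - proj d y.2) - u y.1) ^ 2
    ∂(volume.prod (kernelMeasure a)) with hD
  have hDi : Integrable (fun y : Torus d × E d => (u (y.1 - proj d y.2) - u y.1) ^ 2)
      (volume.prod (kernelMeasure a)) := by
    refine integrable_pair measurable_proj (integrable_const (1 : ℝ)) hu hu
      (((aesm_sub measurable_proj hu.1).sub (aesm_fst hu.1)).pow 2) fun y => ?_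
    rw [abs_pow, sq, one_mul]
    have : |u (y.1 - proj d y.2) - u y.1| ≤ |u y.1| + |u (y.1 - proj d y.2)| := by
      rw [add_comm]; exact abs_sub _ _
    exact mul_self_le_mul_self (abs_nonneg _) this
  have hPD : ∫⁻ z, incrSq 0 u z ∂(kernelMeasure a) = ENNReal.ofReal D := by
    rw [hD, ofReal_integral_eq_lintegral_ofReal hDi (Eventually.of_forall fun y => sq_nonneg _),
      lintegral_prod_symm]
    · refine lintegral_congr fun z => lintegral_congr fun t => ?_
      rw [inner_zero_left, sub_zero, enorm_sq_eq_ofReal]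
    · exact hDi.1.aemeasurable.ennreal_ofReal
  have h1 : ∫⁻ w in unitCell d, incrSq 0 u w ≤ C * ENNReal.ofReal D := by
    calc _ ≤ ∫⁻ w in unitCell d, C * ENNReal.ofReal D := by
          refine setLIntegral_mono' measurableSet_unitCell fun w hw => ?_
          rw [← hPD]
          exact hP 0 u hu.1 w (norm_le_of_mem_unitCell hw)
      _ = _ := by simp
  have hD0 : 0 ≤ D := integral_nonneg fun y => sq_nonneg _
  rw [setLIntegral_incrSq hu, ← ENNReal.ofReal_toReal hC,
    ← ENNReal.ofReal_mul ENNReal.toReal_nonneg,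
    ENNReal.ofReal_le_ofReal_iff (mul_nonneg ENNReal.toReal_nonneg hD0)] at h1
  rw [integral_genFun_mul measurable_proj hm hβ hu hu, neg_neg]
  have h2 : α₁ ^ 2 * D ≤ ∫ y : Torus d × E d, m y.1 * m (y.1 - proj d y.2) *
      (u (y.1 - proj d y.2) - u y.1) * (u (y.1 - proj d y.2) - u y.1)
      ∂(volume.prod (kernelMeasure a)) := by
    rw [hD, ← integral_const_mul]
    refine integral_mono (hDi.const_mul _) ?_ fun y => ?_
    · refine Integrable.mono' (hDi.const_mul (α₂ ^ 2)) ((((aesm_fst hm).mul (aesm_sub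
        measurable_proj hm)).mul ((aesm_sub measurable_proj hu.1).sub (aesm_fst hu.1))).mul
        ((aesm_sub measurable_proj hu.1).sub (aesm_fst hu.1))) (Eventually.of_forall fun y => ?_)
      rw [mul_assoc, ← sq, norm_mul, norm_mul, Real.norm_of_nonneg (sq_nonneg _), sq α₂]
      exact mul_le_mul_of_nonneg_right (mul_le_mul (hβ _) (hβ _) (abs_nonneg _)
        ((abs_nonneg _).trans (hβ 0))) (sq_nonneg _)
    · simp only
      rw [mul_assoc (m y.1 * _), ← sq, sq α₁]
      exact mul_le_mul_of_nonneg_right (mul_le_mul (hmb _).1 (hmb _).1 hα.le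
        (hα.le.trans (hmb _).1)) (sq_nonneg _)
  set Q := ∫ y : Torus d × E d, m y.1 * m (y.1 - proj d y.2) *
      (u (y.1 - proj d y.2) - u y.1) * (u (y.1 - proj d y.2) - u y.1)
      ∂(volume.prod (kernelMeasure a))
  have h3 : D ≤ (α₁ ^ 2)⁻¹ * Q := by
    rw [← div_eq_inv_mul, le_div_iff₀ (by positivity)]; linarith
  have h4 : C.toReal * D ≤ (C.toReal + 1) * ((α₁ ^ 2)⁻¹ * Q) :=
    mul_le_mul (by linarith) h3 hD0 (by positivity)
  linarith

theorem eq_zero_of_genFun_eq_zero (ha : Integrable a) (hnn : ∀ z, 0 ≤ a z)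
    (heven : ∀ z, a (-z) = a z) (hpos : 0 < ∫ z, a z) (hm : AEStronglyMeasurable m) (hα : 0 < α₁)
    (hmb : ∀ t, α₁ ≤ m t ∧ m t ≤ α₂) {u : Torus d → ℝ} (hu : MemLp u 2) (h0 : ∫ t, u t = 0)
    (hA : genFun (kernelMeasure a) (proj d) m u =ᵐ[volume] 0) : u =ᵐ[volume] 0 := by
  obtain ⟨C, -, hC⟩ := exists_coercive ha hnn heven hpos hm hα hmb
  have h1 := hC u hu
  have h2 : ∫ t, m t * genFun (kernelMeasure a) (proj d) m u t * u t = 0 := by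
    rw [integral_eq_zero_of_ae]
    filter_upwards [hA] with t ht
    simp [ht]
  rw [h2, h0] at h1
  have h3 : ∫ t, u t ^ 2 = 0 :=
    le_antisymm (by simpa using h1) (integral_nonneg fun t => sq_nonneg _)
  rw [integral_eq_zero_iff_of_nonneg (fun t => sq_nonneg _) hu.integrable_sq] at h3
  filter_upwards [h3] with t ht
  simpa using ht

/-- With J the rank-one projection onto constants, J − A is coercive on all of L², so (J − A)κ = −mh
is solvable without restriction. Compatibility of h forces Jκ = 0, and division by m recovers the
equation. -/
theorem exists_cell_solution (ha : Integrable a) (hnn : ∀ z, 0 ≤ a z) (heven : ∀ z, a (-z) = a z)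
    (hpos : 0 < ∫ z, a z) (hm : AEStronglyMeasurable m) (hα : 0 < α₁)
    (hmb : ∀ t, α₁ ≤ m t ∧ m t ≤ α₂) {h : Torus d → ℝ} (hh : MemLp h 2)
    (h0 : ∫ t, m t * h t = 0) :
    ∃ u : Torus d → ℝ, Measurable u ∧ MemLp u 2 ∧ ∫ t, u t = 0 ∧
      genFun (kernelMeasure a) (proj d) m u =ᵐ[volume] h := by
  have := isFiniteMeasure_kernelMeasure ha
  have := isNegInvariant_kernelMeasure ha heven
  obtain ⟨C, hC0, hC⟩ := exists_coercive ha hnn heven hpos hm hα hmb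
  have hm0 : ∀ x, 0 < m x := fun x => hα.trans_le (hmb x).1
  have hβ : ∀ x, |m x| ≤ α₂ := fun x => by
    rw [abs_of_pos (hm0 x)]; exact (hmb x).2
  set one : Lp ℝ 2 (volume : Measure (Torus d)) := (memLp_const (1 : ℝ)).toLp _ with hone
  have hinner : ∀ u : Lp ℝ 2 (volume : Measure (Torus d)), inner ℝ one u = ∫ t, u t := by
    intro u
    rw [inner_eq_integral_mul]
    refine integral_congr_ae ?_
    filter_upwards [(memLp_const (1 : ℝ)).coeFn_toLp] with t ht
    rw [hone, ht, one_mul]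
  have hone1 : inner ℝ one one = (1 : ℝ) := by
    rw [hinner, integral_congr_ae (memLp_const (1 : ℝ)).coeFn_toLp]
    simp
  set A := symOp (ρ := kernelMeasure a) measurable_proj hm hβ
  set J : Lp ℝ 2 (volume : Measure (Torus d)) →L[ℝ] Lp ℝ 2 (volume : Measure (Torus d)) :=
    (innerSL ℝ one).smulRight one with hJ
  have hAin : ∀ u v : Lp ℝ 2 (volume : Measure (Torus d)), inner ℝ (A u) v =
      ∫ t, m t * genFun (kernelMeasure a) (proj d) m u t * v t := by
    intro u v
    rw [inner_eq_integral_mul]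
    refine integral_congr_ae ?_
    filter_upwards [coeFn_symOp (ρ := kernelMeasure a) measurable_proj hm hβ u] with t ht
    rw [ht]
  have hJapp : ∀ u, J u = inner ℝ one u • one := fun u => rfl
  have hcoer : ∀ u, (C + 1)⁻¹ * ‖u‖ ^ 2 ≤ inner ℝ ((J - A) u) u := by
    intro u
    have h1 := hC u (Lp.memLp u)
    rw [← hAin] at h1
    have h2 : ‖u‖ ^ 2 = ∫ t, u t ^ 2 := by
      rw [← real_inner_self_eq_norm_sq, inner_eq_integral_mul]
      simp only [sq]
    have h3 := inner_symOp_self_nonpos (ρ := kernelMeasure a) measurable_proj hm hβ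
      (fun x => (hm0 x).le) u
    rw [_root_.sub_apply, inner_sub_left, hJapp, real_inner_smul_left, hinner, h2,
      ← div_eq_inv_mul, div_le_iff₀ (by positivity)]
    change inner ℝ (A u) u ≤ 0 at h3
    nlinarith [sq_nonneg (∫ t, u t)]
  obtain ⟨S, hS, -, -⟩ := exists_inverse_of_coercive (J - A) (c := (C + 1)⁻¹) (by positivity) hcoer
  have hmh := memLp_mul_of_bound hm hβ hh
  set κ := S (-hmh.toLp _) with hκ
  have heq : J κ - A κ = -hmh.toLp _ := hS _
  have hA1 : inner ℝ (A κ) one = 0 := by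
    have := integral_genFun_mul (ρ := kernelMeasure a) measurable_proj hm hβ (Lp.memLp κ)
      (memLp_const (1 : ℝ))
    rw [hAin, ← integral_congr_ae (f := fun t => m t * genFun (kernelMeasure a) (proj d) m κ t * 1),
      this]
    · simp
    · filter_upwards [(memLp_const (1 : ℝ)).coeFn_toLp] with t ht
      rw [hone, ht]
  -- Pairing the equation with 1: A annihilates constants by symmetry and ∫mh = 0, so only the mean
  -- of κ remains.
  have hmean : ∫ t, κ t = 0 := by
    have h1 : inner ℝ one (J κ - A κ) = inner ℝ one (-hmh.toLp _) := by rw [heq]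
    rw [inner_sub_right, inner_neg_right, hinner (hmh.toLp _), hJapp, real_inner_smul_right, hone1,
      real_inner_comm (A κ) one, hA1, integral_congr_ae hmh.coeFn_toLp, h0, hinner] at h1
    linarith
  -- A Borel representative is kept because the averaging bound `lintegral_proj_mul_le` is stated
  -- for measurable functions.
  refine ⟨κ, (Lp.stronglyMeasurable κ).measurable, Lp.memLp κ, hmean, ?_⟩
  rw [hJapp, hinner, hmean, zero_smul, zero_sub, neg_inj] at heq
  have h2 := coeFn_symOp (ρ := kernelMeasure a) measurable_proj hm hβ κ
  change A κ =ᵐ[volume] _ at h2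
  rw [heq] at h2
  filter_upwards [h2, hmh.coeFn_toLp] with t h3 h4
  rw [h4] at h3
  exact (mul_left_cancel₀ (hm0 t).ne' h3).symm

end TorusPoincare

/-! ### Correctors and the effective matrix on the torus -/

/-- The hypotheses on the convolution kernel. -/
structure IsKernel {d : ℕ} (a : E d → ℝ) : Prop where
  int : Integrable a
  nonneg : ∀ z, 0 ≤ a z
  even : ∀ z, a (-z) = a z
  pos : 0 < ∫ z, a z
  moment : Integrable fun z => ‖z‖ ^ 2 * a z

/-- A measurable coefficient on the torus with values in `[α₁, α₂]`. -/
structure IsCoeff {d : ℕ} (m : Torus d → ℝ) (α₁ α₂ : ℝ) : Prop where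
  meas : AEStronglyMeasurable m
  pos : 0 < α₁
  bound : ∀ t, α₁ ≤ m t ∧ m t ≤ α₂

section

variable {d : ℕ} {a : E d → ℝ} {m l : Torus d → ℝ} {α₁ α₂ : ℝ}

theorem IsKernel.finite (ha : IsKernel a) : IsFiniteMeasure (kernelMeasure a) :=
  isFiniteMeasure_kernelMeasure ha.int

theorem IsKernel.negInvariant (ha : IsKernel a) : (kernelMeasure a).IsNegInvariant :=
  isNegInvariant_kernelMeasure ha.int ha.even

/-- The weight `1 + |z|²`. -/
def weight (z : E d) : ℝ := 1 + ‖z‖ ^ 2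

theorem weight_pos (z : E d) : 0 < weight z := by unfold weight; positivity

theorem one_le_weight (z : E d) : 1 ≤ weight z := by
  unfold weight; linarith [sq_nonneg ‖z‖]

theorem norm_le_weight (z : E d) : ‖z‖ ≤ weight z := by
  unfold weight; nlinarith [sq_nonneg (‖z‖ - 1)]

theorem abs_coord_le_norm (z : E d) (i : Fin d) : |z i| ≤ ‖z‖ := by
  simpa using PiLp.norm_apply_le z i

theorem abs_coord_le_weight (z : E d) (i : Fin d) : |z i| ≤ weight z :=
  (abs_coord_le_norm z i).trans (norm_le_weight z)

theorem abs_coord_mul_le_weight (z : E d) (i j : Fin d) : |z i * z j| ≤ weight z := by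
  rw [abs_mul]
  have := mul_le_mul (abs_coord_le_norm z i) (abs_coord_le_norm z j) (abs_nonneg _) (norm_nonneg _)
  unfold weight; nlinarith

theorem continuous_coord (i : Fin d) : Continuous fun z : E d => z i :=
  (EuclideanSpace.proj (𝕜 := ℝ) i).continuous

theorem continuous_weight : Continuous (weight (d := d)) := by unfold weight; fun_prop

theorem IsKernel.integrable_weight (ha : IsKernel a) : Integrable weight (kernelMeasure a) := by
  rw [integrable_kernelMeasure_iff ha.int ha.nonneg]
  refine (ha.int.add ha.moment).congr (Eventually.of_forall fun z => ?_)
  simp only [Pi.add_apply, weight]; ring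

theorem IsCoeff.pos' (hm : IsCoeff m α₁ α₂) (t : Torus d) : 0 < m t :=
  hm.pos.trans_le (hm.bound t).1

theorem IsCoeff.abs_le (hm : IsCoeff m α₁ α₂) (t : Torus d) : |m t| ≤ α₂ := by
  rw [abs_of_pos (hm.pos' t)]; exact (hm.bound t).2

theorem IsCoeff.pos₂ (hm : IsCoeff m α₁ α₂) : 0 < α₂ :=
  (hm.pos' 0).trans_le (hm.bound 0).2

theorem IsCoeff.memLp (hm : IsCoeff m α₁ α₂) : MemLp m 2 :=
  MemLp.of_bound hm.meas α₂ (Eventually.of_forall hm.abs_le)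

theorem IsCoeff.abs_mul_le (hm : IsCoeff m α₁ α₂) (s t : Torus d) : |m s * m t| ≤ α₂ * α₂ := by
  rw [abs_mul]; exact mul_le_mul (hm.abs_le s) (hm.abs_le t) (abs_nonneg _) hm.pos₂.le

theorem aesm_coord (i : Fin d) : AEStronglyMeasurable (fun y : Torus d × E d => y.2 i)
    (volume.prod (kernelMeasure a)) :=
  ((continuous_coord i).comp continuous_snd).aestronglyMeasurable

theorem IsCoeff.aesm_mul (hm : IsCoeff m α₁ α₂) [SFinite (kernelMeasure a)] :
    AEStronglyMeasurable (fun y : Torus d × E d => m y.1 * m (y.1 - proj d y.2))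
    (volume.prod (kernelMeasure a)) :=
  (aesm_fst hm.meas).mul (aesm_sub measurable_proj hm.meas)

/-- The right-hand side of the cell problem. -/
def corrRhs (a : E d → ℝ) (m : Torus d → ℝ) (i : Fin d) (t : Torus d) : ℝ :=
  ∫ z, z i * m (t - proj d z) ∂(kernelMeasure a)

theorem memLp_corrRhs (ha : IsKernel a) (hm : IsCoeff m α₁ α₂) (i : Fin d) :
    MemLp (corrRhs a m i) 2 := by
  have := ha.finite
  exact (memLp_weighted (ρ := kernelMeasure a) measurable_proj
    (F := fun y => y.2 i * m (y.1 - proj d y.2)) ((aesm_coord i).mul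
    (aesm_sub measurable_proj hm.meas)) ha.integrable_weight hm.memLp fun y => by
      rw [abs_mul]
      exact mul_le_mul_of_nonneg_right (abs_coord_le_weight _ _) (abs_nonneg _)).2.1

/-- Integrability on `𝕋^d × ℝ^d` of the weighted products entering the energy. -/
theorem integrable_energy (ha : IsKernel a) (hm : IsCoeff m α₁ α₂) {p q : Torus d → ℝ}
    (hp : MemLp p 2) (hq : MemLp q 2) {F : Torus d × E d → ℝ}
    (hF : AEStronglyMeasurable F (volume.prod (kernelMeasure a)))
    (hle : ∀ y, |F y| ≤ weight y.2 * (|p y.1| + |p (y.1 - proj d y.2)|) *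
      (|q y.1| + |q (y.1 - proj d y.2)|)) :
    Integrable (fun y => m y.1 * m (y.1 - proj d y.2) * F y) (volume.prod (kernelMeasure a)) := by
  have := ha.finite
  refine integrable_pair measurable_proj (ha.integrable_weight.const_mul (α₂ * α₂)) hp hq
    (hm.aesm_mul.mul hF) fun y => ?_
  rw [abs_mul, mul_assoc (α₂ * α₂), mul_assoc (α₂ * α₂)]
  exact mul_le_mul (hm.abs_mul_le _ _) (hle y) (abs_nonneg _) (mul_self_nonneg _)

theorem integrable_coord_mul (ha : IsKernel a) (hm : IsCoeff m α₁ α₂) (i j : Fin d) :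
    Integrable (fun y : Torus d × E d => m y.1 * m (y.1 - proj d y.2) * (y.2 i * y.2 j))
      (volume.prod (kernelMeasure a)) := by
  refine integrable_energy ha hm (memLp_const (1 : ℝ)) (memLp_const (1 : ℝ))
    ((aesm_coord i).mul (aesm_coord j)) fun y => (abs_coord_mul_le_weight _ _ _).trans ?_
  simp only [abs_one]
  nlinarith [weight_pos y.2]

theorem integrable_coord_fst (ha : IsKernel a) (hm : IsCoeff m α₁ α₂) (i : Fin d)
    {p : Torus d → ℝ} (hp : MemLp p 2) :
    Integrable (fun y : Torus d × E d => m y.1 * m (y.1 - proj d y.2) * (y.2 i * p y.1))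
      (volume.prod (kernelMeasure a)) := by
  have := ha.finite
  refine integrable_energy ha hm hp (memLp_const (1 : ℝ))
    ((aesm_coord i).mul (aesm_fst hp.1)) fun y => ?_
  rw [abs_mul, abs_one]
  have h1 := abs_coord_le_weight y.2 i
  have h2 := abs_nonneg (p (y.1 - proj d y.2))
  calc _ ≤ weight y.2 * (|p y.1| + |p (y.1 - proj d y.2)|) :=
        mul_le_mul h1 (by linarith) (abs_nonneg _) (weight_pos _).le
    _ ≤ _ := by
        have : 0 ≤ weight y.2 * (|p y.1| + |p (y.1 - proj d y.2)|) :=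
          mul_nonneg (weight_pos _).le (by positivity)
        linarith

theorem integrable_coord_sub (ha : IsKernel a) (hm : IsCoeff m α₁ α₂) (i : Fin d)
    {p : Torus d → ℝ} (hp : MemLp p 2) :
    Integrable (fun y : Torus d × E d => m y.1 * m (y.1 - proj d y.2) *
      (y.2 i * p (y.1 - proj d y.2))) (volume.prod (kernelMeasure a)) := by
  have := ha.finite
  have := ha.negInvariant
  refine (integrable_flip measurable_proj (integrable_coord_fst ha hm i hp)).neg.congr
    (Eventually.of_forall fun y => ?_)
  simp only [Pi.neg_apply, flip, map_neg, sub_neg_eq_add, sub_add_cancel, PiLp.neg_apply]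
  ring

theorem integrable_incr_mul (ha : IsKernel a) (hm : IsCoeff m α₁ α₂)
    {p q : Torus d → ℝ} (hp : MemLp p 2) (hq : MemLp q 2) :
    Integrable (fun y : Torus d × E d => m y.1 * m (y.1 - proj d y.2) *
      ((p (y.1 - proj d y.2) - p y.1) * (q (y.1 - proj d y.2) - q y.1)))
      (volume.prod (kernelMeasure a)) := by
  have := ha.finite
  refine integrable_energy ha hm hp hq (((aesm_sub measurable_proj hp.1).sub (aesm_fst hp.1)).mul
    ((aesm_sub measurable_proj hq.1).sub (aesm_fst hq.1))) fun y => ?_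
  rw [abs_mul, mul_assoc]
  have h : ∀ A B : ℝ, |A - B| ≤ |B| + |A| := fun A B => by rw [add_comm]; exact abs_sub _ _
  exact (mul_le_mul (h _ _) (h _ _) (abs_nonneg _) (by positivity)).trans
    (le_mul_of_one_le_left (by positivity) (one_le_weight _))

theorem integral_mul_corrRhs (ha : IsKernel a) (hm : IsCoeff m α₁ α₂) (i : Fin d)
    {p : Torus d → ℝ} (hp : MemLp p 2) :
    ∫ t, m t * corrRhs a m i t * p t = ∫ y : Torus d × E d, m y.1 * m (y.1 - proj d y.2) *
      (y.2 i * p y.1) ∂(volume.prod (kernelMeasure a)) := by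
  have := ha.finite
  rw [integral_prod _ (integrable_coord_fst ha hm i hp)]
  refine integral_congr_ae (Eventually.of_forall fun t => ?_)
  simp only [corrRhs]
  rw [← integral_const_mul, ← integral_mul_const]
  congr 1; ext z; ring

/-- Exchange of endpoints moves p from x − πz to x and changes the sign of z_i. -/
theorem integral_coord_sub (ha : IsKernel a) (i : Fin d) (p : Torus d → ℝ) :
    ∫ y : Torus d × E d, m y.1 * m (y.1 - proj d y.2) * (y.2 i * p (y.1 - proj d y.2))
      ∂(volume.prod (kernelMeasure a)) = -∫ y : Torus d × E d, m y.1 * m (y.1 - proj d y.2) *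
      (y.2 i * p y.1) ∂(volume.prod (kernelMeasure a)) := by
  have := ha.finite
  have := ha.negInvariant
  rw [← integral_flip measurable_proj, ← integral_neg]
  congr 1; ext y
  simp only [flip, map_neg, sub_neg_eq_add, sub_add_cancel, PiLp.neg_apply]
  ring

/-- The case p = 1 of the previous reflection: the integral equals its own negative. This is the
compatibility condition of the first cell problem. -/
theorem integral_mul_corrRhs_eq_zero (ha : IsKernel a) (hm : IsCoeff m α₁ α₂) (i : Fin d) :
    ∫ t, m t * corrRhs a m i t = 0 := by
  have h1 := integral_mul_corrRhs ha hm i (memLp_const (1 : ℝ))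
  have h2 := integral_coord_sub (m := m) ha i fun _ => 1
  simp only [mul_one] at h1 h2
  rw [h1]; linarith

/-- The first-order correctors, as functions on the torus. -/
structure IsTorusCorrector (a : E d → ℝ) (m : Torus d → ℝ) (κ : Fin d → Torus d → ℝ) : Prop where
  memLp : ∀ i, MemLp (κ i) 2
  mean : ∀ i, ∫ t, κ i t = 0
  eq : ∀ i, genFun (kernelMeasure a) (proj d) m (κ i) =ᵐ[volume] corrRhs a m i

theorem exists_torusCorrector (ha : IsKernel a) (hm : IsCoeff m α₁ α₂) :
    ∃ κ, (∀ i, Measurable (κ i)) ∧ IsTorusCorrector a m κ := by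
  choose κ h0 h1 h2 h3 using fun i => exists_cell_solution ha.int ha.nonneg ha.even ha.pos hm.meas
    hm.pos hm.bound (memLp_corrRhs ha hm i) (integral_mul_corrRhs_eq_zero ha hm i)
  exact ⟨κ, h0, h1, h2, h3⟩

theorem IsTorusCorrector.unique (ha : IsKernel a) (hm : IsCoeff m α₁ α₂)
    {κ κ' : Fin d → Torus d → ℝ} (h : IsTorusCorrector a m κ) (h' : IsTorusCorrector a m κ')
    (i : Fin d) : κ' i =ᵐ[volume] κ i := by
  have := ha.finite
  have h0 : (κ' i + (-1 : ℝ) • κ i) =ᵐ[volume] 0 := by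
    refine eq_zero_of_genFun_eq_zero ha.int ha.nonneg ha.even ha.pos hm.meas hm.pos hm.bound
      ((h'.memLp i).add ((h.memLp i).const_smul _)) ?_ ?_
    · simp only [Pi.add_apply, Pi.smul_apply, smul_eq_mul]
      rw [integral_add ((h'.memLp i).integrable (by norm_num))
        (((h.memLp i).integrable (by norm_num)).const_mul _), integral_const_mul, h.mean, h'.mean]
      simp
    · filter_upwards [genFun_add (ρ := kernelMeasure a) measurable_proj hm.meas hm.abs_le
        (h'.memLp i) ((h.memLp i).const_smul (-1 : ℝ)), h.eq i, h'.eq i] with t h1 h2 h3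
      rw [h1, genFun_smul, Pi.add_apply, Pi.smul_apply, h2, h3]
      simp
  filter_upwards [h0] with t ht
  simp only [Pi.add_apply, Pi.smul_apply, smul_eq_mul, Pi.zero_apply] at ht
  linarith

/-- The effective matrix, in terms of integrals over `𝕋^d × ℝ^d`. -/
def torusMatrix (a : E d → ℝ) (l m : Torus d → ℝ) (κ : Fin d → Torus d → ℝ) :
    Matrix (Fin d) (Fin d) ℝ := Matrix.of fun i j => (∫ t, m t / l t)⁻¹ *
  ((1 / 2 * ∫ y : Torus d × E d, m y.1 * m (y.1 - proj d y.2) * (y.2 i * y.2 j)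
      ∂(volume.prod (kernelMeasure a))) -
    ∫ y : Torus d × E d, m y.1 * m (y.1 - proj d y.2) * (y.2 i * κ j (y.1 - proj d y.2))
      ∂(volume.prod (kernelMeasure a)))

/-- The increment `z_i - (κ^i(t - z) - κ^i(t))`. -/
def corrIncr (κ : Fin d → Torus d → ℝ) (i : Fin d) (y : Torus d × E d) : ℝ :=
  y.2 i - (κ i (y.1 - proj d y.2) - κ i y.1)

theorem IsCoeff.memLp_div (hm : IsCoeff m α₁ α₂) (hl : IsCoeff l α₁ α₂) :
    MemLp (fun t => m t / l t) 2 := by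
  refine MemLp.of_bound (hm.meas.aemeasurable.div hl.meas.aemeasurable).aestronglyMeasurable
    (α₂ / α₁) (Eventually.of_forall fun t => ?_)
  rw [Real.norm_of_nonneg (div_nonneg (hm.pos' t).le (hl.pos' t).le)]
  exact div_le_div₀ hm.pos₂.le (hm.bound t).2 hm.pos (hl.bound t).1

theorem IsCoeff.integral_div_pos (hm : IsCoeff m α₁ α₂) (hl : IsCoeff l α₁ α₂) :
    0 < ∫ t, m t / l t := by
  refine (integral_pos_iff_support_of_nonneg (fun t => (div_pos (hm.pos' t) (hl.pos' t)).le)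
    ((hm.memLp_div hl).integrable (by norm_num))).2 ?_
  have : Function.support (fun t => m t / l t) = Set.univ := by
    ext t; simp [(hm.pos' t).ne', (hl.pos' t).ne']
  rw [this]; simp

variable {κ : Fin d → Torus d → ℝ}

/-- The i-th cell equation tested with κ^j. The left side is symmetric in i and j, hence so is the
mixed term defining Θ. -/
theorem IsTorusCorrector.integral_incr_mul (ha : IsKernel a) (hm : IsCoeff m α₁ α₂)
    (hκ : IsTorusCorrector a m κ) (i j : Fin d) :
    1 / 2 * ∫ y : Torus d × E d, m y.1 * m (y.1 - proj d y.2) *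
      ((κ i (y.1 - proj d y.2) - κ i y.1) * (κ j (y.1 - proj d y.2) - κ j y.1))
      ∂(volume.prod (kernelMeasure a)) =
    ∫ y : Torus d × E d, m y.1 * m (y.1 - proj d y.2) * (y.2 i * κ j (y.1 - proj d y.2))
      ∂(volume.prod (kernelMeasure a)) := by
  have := ha.finite
  have := ha.negInvariant
  rw [integral_coord_sub ha, ← integral_mul_corrRhs ha hm i (hκ.memLp j)]
  have h := integral_genFun_mul (ρ := kernelMeasure a) measurable_proj hm.meas hm.abs_le
    (hκ.memLp i) (hκ.memLp j)
  rw [integral_congr_ae (g := fun t => m t * corrRhs a m i t * κ j t)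
    (by filter_upwards [hκ.eq i] with t ht; rw [ht])] at h
  rw [h, neg_neg]
  congr 2; ext y; ring

theorem IsTorusCorrector.integrable_corrIncr (ha : IsKernel a) (hm : IsCoeff m α₁ α₂)
    (hκ : IsTorusCorrector a m κ) (i j : Fin d) :
    Integrable (fun y : Torus d × E d => m y.1 * m (y.1 - proj d y.2) *
      (corrIncr κ i y * corrIncr κ j y)) (volume.prod (kernelMeasure a)) := by
  refine ((((integrable_coord_mul ha hm i j).sub (integrable_coord_sub ha hm i (hκ.memLp j))).add
    (integrable_coord_fst ha hm i (hκ.memLp j))).sub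
    ((integrable_coord_sub ha hm j (hκ.memLp i)).sub
    (integrable_coord_fst ha hm j (hκ.memLp i)))).add
    (integrable_incr_mul ha hm (hκ.memLp i) (hκ.memLp j)) |>.congr
    (Eventually.of_forall fun y => ?_)
  simp only [Pi.add_apply, Pi.sub_apply, corrIncr]
  ring

/-- Let X_ij be the mixed term with z_i κ^j(t − z). Expanding the product, the reflection turns the
cross terms into −X_ij − X_ji, and the cell equation evaluates the quadratic term in κ as X_ij =
X_ji. What survives is the defining formula, now manifestly symmetric. -/
theorem IsTorusCorrector.torusMatrix_apply (ha : IsKernel a) (hm : IsCoeff m α₁ α₂)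
    (hκ : IsTorusCorrector a m κ) (i j : Fin d) :
    torusMatrix a l m κ i j = (∫ t, m t / l t)⁻¹ * (1 / 2 * ∫ y : Torus d × E d,
      m y.1 * m (y.1 - proj d y.2) * (corrIncr κ i y * corrIncr κ j y)
      ∂(volume.prod (kernelMeasure a))) := by
  have h0 := integrable_coord_mul ha hm i j
  have h1 := integrable_coord_sub ha hm i (hκ.memLp j)
  have h2 := integrable_coord_fst ha hm i (hκ.memLp j)
  have h3 := integrable_coord_sub ha hm j (hκ.memLp i)
  have h4 := integrable_coord_fst ha hm j (hκ.memLp i)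
  have h5 := integrable_incr_mul ha hm (hκ.memLp i) (hκ.memLp j)
  have hsum : ∫ y : Torus d × E d,
      m y.1 * m (y.1 - proj d y.2) * (corrIncr κ i y * corrIncr κ j y)
      ∂(volume.prod (kernelMeasure a)) = _ :=
    (integral_congr_ae (Eventually.of_forall fun y => by
      simp only [Pi.add_apply, Pi.sub_apply, corrIncr]; ring)).trans
    (integral_add (((h0.sub h1).add h2).sub (h3.sub h4)) h5)
  rw [integral_sub' ((h0.sub h1).add h2) (h3.sub h4), integral_sub' h3 h4,
    integral_add' (h0.sub h1) h2, integral_sub' h0 h1] at hsum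
  have e1 := integral_coord_sub (m := m) ha i (κ j)
  have e2 := integral_coord_sub (m := m) ha j (κ i)
  have e3 := hκ.integral_incr_mul ha hm i j
  have e4 := hκ.integral_incr_mul ha hm j i
  have e5 : ∫ y : Torus d × E d, m y.1 * m (y.1 - proj d y.2) *
      ((κ i (y.1 - proj d y.2) - κ i y.1) * (κ j (y.1 - proj d y.2) - κ j y.1))
      ∂(volume.prod (kernelMeasure a)) = ∫ y : Torus d × E d, m y.1 * m (y.1 - proj d y.2) *
      ((κ j (y.1 - proj d y.2) - κ j y.1) * (κ i (y.1 - proj d y.2) - κ i y.1))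
      ∂(volume.prod (kernelMeasure a)) := by
    congr 1; ext y; ring
  rw [torusMatrix, Matrix.of_apply, hsum]
  congr 1
  linarith

/-- The quadratic form at v is, up to a positive factor, the energy of the increments of u − v·x
with u = Σ v_i κ^i. If it vanishes, so do these increments for a-almost every z, and by the Poincaré
inequality for every z in a bounded set, in particular for lattice vectors. -/
theorem IsTorusCorrector.posDef (ha : IsKernel a) (hm : IsCoeff m α₁ α₂) (hl : IsCoeff l α₁ α₂)
    (hκ : IsTorusCorrector a m κ) : (torusMatrix a l m κ).PosDef := by
  have := ha.finite
  have hc := hm.integral_div_pos hl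
  refine Matrix.posDef_iff_dotProduct_mulVec.2 ⟨?_, fun v hv => ?_⟩
  · ext i j
    rw [Matrix.conjTranspose_apply, star_trivial, hκ.torusMatrix_apply ha hm,
      hκ.torusMatrix_apply ha hm]
    congr 3; ext y; ring
  set V : E d := WithLp.toLp 2 v with hV
  set u : Torus d → ℝ := fun t => ∑ i, v i * κ i t with hu
  have hum : MemLp u 2 := memLp_finsetSum _ fun i _ => (hκ.memLp i).const_mul (v i)
  have hg : ∀ y : Torus d × E d, ∑ i, v i * corrIncr κ i y =
      -(u (y.1 - proj d y.2) - u y.1 - inner ℝ V y.2) := by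
    intro y
    have : inner ℝ V y.2 = ∑ i, v i * y.2 i := by
      simp [PiLp.inner_apply, hV, mul_comm]
    rw [this, hu]
    simp only [corrIncr, mul_sub, Finset.sum_sub_distrib]
    ring
  have hquad : star v ⬝ᵥ (torusMatrix a l m κ).mulVec v = (∫ t, m t / l t)⁻¹ * (1 / 2 *
      ∫ y : Torus d × E d, m y.1 * m (y.1 - proj d y.2) *
      (u (y.1 - proj d y.2) - u y.1 - inner ℝ V y.2) ^ 2 ∂(volume.prod (kernelMeasure a))) := by
    have h1 : ∀ y : Torus d × E d, m y.1 * m (y.1 - proj d y.2) *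
        (u (y.1 - proj d y.2) - u y.1 - inner ℝ V y.2) ^ 2 = ∑ i, ∑ j, v i * v j *
        (m y.1 * m (y.1 - proj d y.2) * (corrIncr κ i y * corrIncr κ j y)) := by
      intro y
      rw [← neg_sq, ← hg, sq, Finset.sum_mul_sum, Finset.mul_sum]
      refine Finset.sum_congr rfl fun i _ => ?_
      rw [Finset.mul_sum]
      exact Finset.sum_congr rfl fun j _ => by ring
    simp only [h1]
    have hI : ∀ i j, Integrable (fun y : Torus d × E d => v i * v j *
        (m y.1 * m (y.1 - proj d y.2) * (corrIncr κ i y * corrIncr κ j y)))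
        (volume.prod (kernelMeasure a)) :=
      fun i j => (hκ.integrable_corrIncr ha hm i j).const_mul _
    rw [integral_finsetSum _ fun i _ => integrable_finsetSum _ fun j _ => hI i j]
    simp only [dotProduct, Matrix.mulVec, star_trivial, Finset.mul_sum]
    refine Finset.sum_congr rfl fun i _ => ?_
    rw [integral_finsetSum _ fun j _ => hI i j, Finset.mul_sum, Finset.mul_sum]
    refine Finset.sum_congr rfl fun j _ => ?_
    rw [hκ.torusMatrix_apply ha hm, integral_const_mul]
    ring
  have hquadI : Integrable (fun y : Torus d × E d => m y.1 * m (y.1 - proj d y.2) *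
      (u (y.1 - proj d y.2) - u y.1 - inner ℝ V y.2) ^ 2) (volume.prod (kernelMeasure a)) := by
    refine (integrable_finsetSum Finset.univ fun i _ => integrable_finsetSum Finset.univ
      fun j _ => (hκ.integrable_corrIncr ha hm i j).const_mul (v i * v j)).congr
      (Eventually.of_forall fun y => ?_)
    simp only
    rw [← neg_sq (u (y.1 - proj d y.2) - u y.1 - inner ℝ V y.2), ← hg, sq, Finset.sum_mul_sum,
      Finset.mul_sum]
    refine Finset.sum_congr rfl fun i _ => ?_
    rw [Finset.mul_sum]
    exact Finset.sum_congr rfl fun j _ => by ring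
  rw [hquad]
  refine mul_pos (inv_pos.2 hc) (mul_pos (by norm_num) ?_)
  have hnn : ∀ y : Torus d × E d, 0 ≤ m y.1 * m (y.1 - proj d y.2) *
      (u (y.1 - proj d y.2) - u y.1 - inner ℝ V y.2) ^ 2 := fun y =>
    mul_nonneg (mul_nonneg (hm.pos' _).le (hm.pos' _).le) (sq_nonneg _)
  refine (integral_nonneg hnn).lt_of_ne' fun h0 => hv ?_
  rw [integral_eq_zero_iff_of_nonneg hnn hquadI] at h0
  have h1 : ∫⁻ z, incrSq V u z ∂(kernelMeasure a) = 0 := by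
    have h2 : ∫⁻ y : Torus d × E d, ‖u (y.1 - proj d y.2) - u y.1 - inner ℝ V y.2‖ₑ ^ 2
        ∂(volume.prod (kernelMeasure a)) = 0 := by
      rw [lintegral_eq_zero_iff' ((aesm_incr V hum.1).enorm.pow_const 2)]
      filter_upwards [h0] with y hy
      have : 0 < m y.1 * m (y.1 - proj d y.2) := mul_pos (hm.pos' _) (hm.pos' _)
      simpa [this.ne', (hm.pos' y.1).ne', (hm.pos' (y.1 - proj d y.2)).ne'] using hy
    rw [← h2, lintegral_prod_symm _ ((aesm_incr V hum.1).enorm.pow_const 2)]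
    rfl
  obtain ⟨C, -, hC⟩ := exists_incrSq_le ha.int ha.nonneg ha.pos (1 : ℝ)
  ext i
  -- The increment of u by e_i is zero by periodicity, so the vanishing increment is −v_i.
  have h3 := hC V u hum.1 (e i) (by simp)
  have hpe : proj d (e i) = 0 := by
    ext j
    by_cases hij : j = i
    · subst hij; simp [proj]
    · simp [proj, hij]
  rw [h1, mul_zero, incrSq] at h3
  simp only [hpe, sub_zero, sub_self, zero_sub, enorm_neg, lintegral_const, measure_univ,
    mul_one, nonpos_iff_eq_zero] at h3
  simpa [hV, e, EuclideanSpace.inner_single_right] using h3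

/-- The right-hand side of the problem for the second-order corrector. -/
def corrRhs₂ (a : E d → ℝ) (l m : Torus d → ℝ) (κ : Fin d → Torus d → ℝ) (i j : Fin d)
    (t : Torus d) : ℝ :=
  torusMatrix a l m κ i j / l t - ∫ z, m (t - proj d z) *
    (1 / 2 * (z i * z j) - z i * κ j (t - proj d z)) ∂(kernelMeasure a)

theorem IsTorusCorrector.corrRhs₂_aux (ha : IsKernel a) (hm : IsCoeff m α₁ α₂)
    (hκ : IsTorusCorrector a m κ) (i j : Fin d) :
    (∀ᵐ t, Integrable (fun z => m (t - proj d z) *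
      (1 / 2 * (z i * z j) - z i * κ j (t - proj d z))) (kernelMeasure a)) ∧
    MemLp (fun t => ∫ z, m (t - proj d z) *
      (1 / 2 * (z i * z j) - z i * κ j (t - proj d z)) ∂(kernelMeasure a)) 2 := by
  have := ha.finite
  have h := memLp_weighted (ρ := kernelMeasure a) measurable_proj
    (F := fun y : Torus d × E d => m (y.1 - proj d y.2) *
      (1 / 2 * (y.2 i * y.2 j) - y.2 i * κ j (y.1 - proj d y.2)))
    ((aesm_sub measurable_proj hm.meas).mul ((((aesm_coord i).mul (aesm_coord j)).const_mul
      _).sub ((aesm_coord i).mul (aesm_sub measurable_proj (hκ.memLp j).1))))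
    (ha.integrable_weight.const_mul α₂) (p := fun t => 1 + |κ j t|)
    ((memLp_const (1 : ℝ)).add (hκ.memLp j).abs) fun y => by
      rw [abs_mul, mul_assoc]
      refine mul_le_mul (hm.abs_le _) ?_ (abs_nonneg _) hm.pos₂.le
      rw [abs_of_pos (show 0 < 1 + |κ j (y.1 - proj d y.2)| by positivity)]
      have h1 := abs_coord_mul_le_weight y.2 i j
      have h2 := mul_le_mul_of_nonneg_right (abs_coord_le_weight y.2 i)
        (abs_nonneg (κ j (y.1 - proj d y.2)))
      rw [← abs_mul] at h2
      have h3 : |1 / 2 * (y.2 i * y.2 j)| ≤ weight y.2 := by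
        rw [abs_mul, abs_of_pos (by norm_num : (0 : ℝ) < 1 / 2)]
        linarith [abs_nonneg (y.2 i * y.2 j)]
      refine (abs_sub _ _).trans ?_
      simp only
      linarith
  exact ⟨h.1, h.2.1⟩

/-- The compatibility condition says Θ^{ij} ∫m/l equals the difference of the two cell integrals,
which is how Θ is defined. -/
theorem IsTorusCorrector.exists_second (ha : IsKernel a) (hm : IsCoeff m α₁ α₂)
    (hl : IsCoeff l α₁ α₂) (hκ : IsTorusCorrector a m κ) (i j : Fin d) :
    ∃ u : Torus d → ℝ, Measurable u ∧ MemLp u 2 ∧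
      genFun (kernelMeasure a) (proj d) m u =ᵐ[volume] corrRhs₂ a l m κ i j := by
  have := ha.finite
  have hc := hm.integral_div_pos hl
  obtain ⟨hi, hM⟩ := hκ.corrRhs₂_aux ha hm i j
  have hdiv : MemLp (fun t => torusMatrix a l m κ i j / l t) 2 := by
    refine MemLp.of_bound (hl.meas.aemeasurable.const_div _).aestronglyMeasurable
      (|torusMatrix a l m κ i j| / α₁) (Eventually.of_forall fun t => ?_)
    rw [norm_div, Real.norm_of_nonneg (hl.pos' t).le]
    exact div_le_div_of_nonneg_left (abs_nonneg _) hl.pos (hl.bound t).1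
  have hrhs : MemLp (corrRhs₂ a l m κ i j) 2 := hdiv.sub hM
  obtain ⟨u, h0, h1, -, h2⟩ := exists_cell_solution ha.int ha.nonneg ha.even ha.pos hm.meas
    hm.pos hm.bound hrhs (by
      have e0 : ∀ t, m t * corrRhs₂ a l m κ i j t = torusMatrix a l m κ i j * (m t / l t) -
          m t * ∫ z, m (t - proj d z) *
          (1 / 2 * (z i * z j) - z i * κ j (t - proj d z)) ∂(kernelMeasure a) := fun t => by
        rw [corrRhs₂]; ring
      simp only [e0]
      have hmM := (memLp_mul_of_bound hm.meas hm.abs_le hM).integrable (by norm_num)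
      rw [integral_sub (((hm.memLp_div hl).integrable (by norm_num)).const_mul _) hmM,
        integral_const_mul]
      have f1 := (integrable_coord_mul ha hm i j).const_mul (1 / 2)
      have f2 := integrable_coord_sub ha hm i (hκ.memLp j)
      have e1 : ∫ t, m t * ∫ z, m (t - proj d z) *
          (1 / 2 * (z i * z j) - z i * κ j (t - proj d z)) ∂(kernelMeasure a) =
          (1 / 2 * ∫ y : Torus d × E d, m y.1 * m (y.1 - proj d y.2) * (y.2 i * y.2 j)
            ∂(volume.prod (kernelMeasure a))) - ∫ y : Torus d × E d, m y.1 *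
            m (y.1 - proj d y.2) * (y.2 i * κ j (y.1 - proj d y.2))
            ∂(volume.prod (kernelMeasure a)) := by
        rw [← integral_const_mul, ← integral_sub f1 f2]
        refine Eq.trans ?_ (integral_prod _ (f1.sub f2)).symm
        refine integral_congr_ae (Eventually.of_forall fun t => ?_)
        simp only
        rw [← integral_const_mul]
        congr 1; ext z
        simp only [Pi.sub_apply]; ring
      rw [e1, torusMatrix, Matrix.of_apply]
      field_simp
      ring)
  exact ⟨u, h0, h1, h2⟩

end

/-! ### Periodic functions and functions on the torus -/

section

variable {d : ℕ} {a mu lam : E d → ℝ} {α₁ α₂ : ℝ}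

theorem isCoeff_comp_sec (hmu : AEMeasurable mu) (hα : 0 < α₁)
    (hb : ∀ x, α₁ ≤ mu x ∧ mu x ≤ α₂) : IsCoeff (fun t => mu (sec t)) α₁ α₂ where
  meas := (hmu.aestronglyMeasurable.restrict (s := unitCell d)).comp_measurePreserving
    measurePreserving_sec
  pos := hα
  bound _ := hb _

theorem IsPeriodic.comp_sec_sub {g : E d → ℝ} (hg : IsPeriodic g) (ξ z : E d) :
    g (sec (proj d ξ - proj d z)) = g (ξ - z) := by
  rw [← map_sub, hg.comp_sec_proj]

theorem integral_unitCell_comp_proj {f : Torus d → ℝ} (hf : AEStronglyMeasurable f) :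
    ∫ ξ in unitCell d, f (proj d ξ) = ∫ t, f t := by
  rw [← measurePreserving_proj.map_eq] at hf ⊢
  rw [integral_map measurable_proj.aemeasurable hf]

theorem integrable_comp_sub_left {G : E d → E d → ℝ} {ξ : E d}
    (h : Integrable fun z => G z (ξ - z)) : Integrable fun q => G (ξ - q) q := by
  refine (h.comp_sub_left ξ).congr (Eventually.of_forall fun q => ?_)
  simp

theorem integral_comp_sub_left (G : E d → E d → ℝ) (ξ : E d) :
    ∫ q, G (ξ - q) q = ∫ z, G z (ξ - z) := by
  rw [← integral_sub_left_eq_self (fun z => G z (ξ - z)) volume ξ]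
  simp

theorem isCorrector_comp_proj (ha : IsKernel a) (hper : IsPeriodic mu)
    (hm : IsCoeff (fun t => mu (sec t)) α₁ α₂) {κ : Fin d → Torus d → ℝ}
    (hκ : IsTorusCorrector a (fun t => mu (sec t)) κ) :
    IsCorrector a mu fun i x => κ i (proj d x) where
  periodic i := isPeriodic_comp_proj (κ i)
  memLp i := (hκ.memLp i).comp_measurePreserving measurePreserving_proj
  average_eq_zero i := by rw [integral_unitCell_comp_proj (hκ.memLp i).1, hκ.mean i]
  integrable i := by
    have := ha.finite
    have h := (genFun_aux (ρ := kernelMeasure a) measurable_proj hm.meas hm.abs_le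
      (hκ.memLp i)).1
    filter_upwards [quasiMeasurePreserving_proj.ae h] with ξ hξ
    rw [integrable_kernelMeasure_iff ha.int ha.nonneg] at hξ
    refine integrable_comp_sub_left
      (G := fun z q => a z * mu q * (κ i (proj d q) - κ i (proj d ξ))) ?_
    refine hξ.congr (Eventually.of_forall fun z => ?_)
    simp only [hper.comp_sec_sub, map_sub]
    ring
  cell_eq i := by
    filter_upwards [quasiMeasurePreserving_proj.ae (hκ.eq i)] with ξ hξ
    rw [genFun, corrRhs, integral_kernelMeasure ha.int ha.nonneg,
      integral_kernelMeasure ha.int ha.nonneg] at hξ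
    rw [integral_comp_sub_left (fun z q => a z * mu q * (κ i (proj d q) - κ i (proj d ξ))) ξ,
      integral_comp_sub_left (fun z q => a z * z i * mu q) ξ]
    simp only [hper.comp_sec_sub] at hξ
    simp only [map_sub, mul_assoc]
    exact hξ

theorem isTorusCorrector_comp_sec (ha : IsKernel a) (hper : IsPeriodic mu) {κ : Fin d → E d → ℝ}
    (hκ : IsCorrector a mu κ) :
    IsTorusCorrector a (fun t => mu (sec t)) fun i t => κ i (sec t) where
  memLp i := (hκ.memLp i).comp_measurePreserving measurePreserving_sec
  mean i := by
    have hm := (hκ.memLp i).1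
    rw [← hκ.average_eq_zero i]
    rw [← measurePreserving_sec.map_eq] at hm ⊢
    rw [integral_map measurable_sec.aemeasurable hm]
  eq i := by
    have h1 : ∀ᵐ ξ ∂(volume.restrict (unitCell d)), ∫ q, a (ξ - q) * mu q * (κ i q - κ i ξ) =
      ∫ q, a (ξ - q) * (ξ - q) i * mu q := ae_restrict_of_ae (hκ.cell_eq i)
    filter_upwards [measurePreserving_sec.quasiMeasurePreserving.ae h1] with t ht
    rw [integral_comp_sub_left (fun z q => a z * mu q * (κ i q - κ i (sec t))) (sec t),
      integral_comp_sub_left (fun z q => a z * z i * mu q) (sec t)] at ht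
    rw [genFun, corrRhs, integral_kernelMeasure ha.int ha.nonneg,
      integral_kernelMeasure ha.int ha.nonneg]
    have h2 : ∀ z, proj d (sec t - z) = t - proj d z := fun z => by rw [map_sub, proj_sec]
    have h3 : ∀ z, mu (sec (t - proj d z)) = mu (sec t - z) := fun z => by
      rw [← h2, hper.comp_sec_proj]
    have h4 : ∀ z, κ i (sec (t - proj d z)) = κ i (sec t - z) := fun z => by
      rw [← h2, (hκ.periodic i).comp_sec_proj]
    simp only [h3, h4]
    simp only [mul_assoc] at ht
    exact ht

/-- A corrector on ℝ^d descends to the torus, where uniqueness is known, and the null set is pulled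
back by the projection. -/
theorem isCorrector_unique (ha : IsKernel a) (hper : IsPeriodic mu)
    (hm : IsCoeff (fun t => mu (sec t)) α₁ α₂) {κ : Fin d → Torus d → ℝ}
    (hκ : IsTorusCorrector a (fun t => mu (sec t)) κ) {κ' : Fin d → E d → ℝ}
    (hκ' : IsCorrector a mu κ') (i : Fin d) :
    κ' i =ᵐ[volume] fun x => κ i (proj d x) := by
  have h := hκ.unique ha hm (isTorusCorrector_comp_sec ha hper hκ') i
  filter_upwards [quasiMeasurePreserving_proj.ae h] with x hx
  rw [← hx, (hκ'.periodic i).comp_sec_proj]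

theorem integrable_prod_kernelMeasure_iff (ha : IsKernel a) {f : Torus d × E d → ℝ} :
    Integrable f ((volume : Measure (Torus d)).prod (kernelMeasure a)) ↔
      Integrable (fun y => a y.2 * f y) ((volume : Measure (Torus d)).prod volume) := by
  have hA : AEMeasurable (fun z => ENNReal.ofReal (a z)) := ha.int.1.aemeasurable.ennreal_ofReal
  rw [kernelMeasure, prod_withDensity_right₀ hA, integrable_withDensity_iff_integrable_smul₀'
    hA.comp_snd (Eventually.of_forall fun z => ENNReal.ofReal_lt_top)]
  simp only [ENNReal.toReal_ofReal (ha.nonneg _), smul_eq_mul]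

theorem measurePreserving_proj_sub :
    MeasurePreserving (fun y : E d × E d => (proj d y.1, y.1 - y.2))
      ((volume.restrict (unitCell d)).prod volume)
      ((volume : Measure (Torus d)).prod volume) :=
  measurePreserving_proj.skew_product (g := fun ξ q => ξ - q)
    (measurable_fst.sub measurable_snd) (Eventually.of_forall fun ξ =>
      (Measure.measurePreserving_sub_left volume ξ).map_eq)

theorem integrable_cellIntegrand (ha : IsKernel a) {F : Torus d × E d → ℝ}
    (hF : Integrable F ((volume : Measure (Torus d)).prod (kernelMeasure a))) {G : E d → E d → ℝ}
    (hG : ∀ ξ q, G ξ q = a (ξ - q) * F (proj d ξ, ξ - q)) :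
    Integrable (Function.uncurry G) ((volume.restrict (unitCell d)).prod volume) := by
  rw [integrable_prod_kernelMeasure_iff ha] at hF
  refine (measurePreserving_proj_sub.integrable_comp_of_integrable hF).congr
    (Eventually.of_forall fun y => ?_)
  simp [Function.uncurry, hG]

theorem integral_cellIntegrand (ha : IsKernel a) {F : Torus d × E d → ℝ}
    (hF : Integrable F ((volume : Measure (Torus d)).prod (kernelMeasure a))) {G : E d → E d → ℝ}
    (hG : ∀ ξ q, G ξ q = a (ξ - q) * F (proj d ξ, ξ - q)) :
    ∫ ξ in unitCell d, ∫ q, G ξ q =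
      ∫ y, F y ∂((volume : Measure (Torus d)).prod (kernelMeasure a)) := by
  have := ha.finite
  rw [integral_prod _ hF, ← integral_unitCell_comp_proj hF.1.integral_prod_right']
  refine integral_congr_ae (Eventually.of_forall fun ξ => ?_)
  simp only [hG]
  rw [integral_kernelMeasure ha.int ha.nonneg,
    integral_sub_left_eq_self (fun z => a z * F (proj d ξ, z)) volume ξ]

theorem cellIntegrand₁_eq (hper : IsPeriodic mu) (i j : Fin d) (ξ q : E d) :
    cellIntegrand₁ a mu i j ξ q = a (ξ - q) * (fun y : Torus d × E d => 1 / 2 *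
      (mu (sec y.1) * mu (sec (y.1 - proj d y.2)) * (y.2 i * y.2 j))) (proj d ξ, ξ - q) := by
  simp only [cellIntegrand₁, hper.comp_sec_sub, hper.comp_sec_proj, sub_sub_cancel]
  ring

theorem cellIntegrand₂_eq (hper : IsPeriodic mu) (κ : Fin d → Torus d → ℝ) (i j : Fin d)
    (ξ q : E d) : cellIntegrand₂ a mu (fun i x => κ i (proj d x)) i j ξ q =
      a (ξ - q) * (fun y : Torus d × E d =>
      mu (sec y.1) * mu (sec (y.1 - proj d y.2)) * (y.2 i * κ j (y.1 - proj d y.2)))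
      (proj d ξ, ξ - q) := by
  simp only [cellIntegrand₂, hper.comp_sec_sub, hper.comp_sec_proj, sub_sub_cancel]
  rw [← map_sub, sub_sub_cancel]
  ring

theorem integrable_cellIntegrands (ha : IsKernel a) (hper : IsPeriodic mu)
    (hm : IsCoeff (fun t => mu (sec t)) α₁ α₂) {κ : Fin d → Torus d → ℝ}
    (hκ : IsTorusCorrector a (fun t => mu (sec t)) κ) (i j : Fin d) :
    Integrable (Function.uncurry (cellIntegrand₁ a mu i j))
          ((volume.restrict (unitCell d)).prod volume) ∧
      Integrable (Function.uncurry (cellIntegrand₂ a mu (fun i x => κ i (proj d x)) i j))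
          ((volume.restrict (unitCell d)).prod volume) :=
  ⟨integrable_cellIntegrand ha ((integrable_coord_mul ha hm i j).const_mul (1 / 2))
      (cellIntegrand₁_eq hper i j),
    integrable_cellIntegrand ha (integrable_coord_sub ha hm i (hκ.memLp j))
      (cellIntegrand₂_eq hper κ i j)⟩

theorem effectiveMatrix_eq (ha : IsKernel a) (hper : IsPeriodic mu) (hperl : IsPeriodic lam)
    (hm : IsCoeff (fun t => mu (sec t)) α₁ α₂) (hl : IsCoeff (fun t => lam (sec t)) α₁ α₂)
    {κ : Fin d → Torus d → ℝ} (hκ : IsTorusCorrector a (fun t => mu (sec t)) κ) :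
    effectiveMatrix a lam mu (fun i x => κ i (proj d x)) =
      torusMatrix a (fun t => lam (sec t)) (fun t => mu (sec t)) κ := by
  have h0 : ∫ ξ in unitCell d, mu ξ / lam ξ = ∫ t : Torus d, mu (sec t) / lam (sec t) := by
    rw [← integral_unitCell_comp_proj (hm.memLp_div hl).1]
    simp only [hper.comp_sec_proj, hperl.comp_sec_proj]
  ext i j
  rw [effectiveMatrix, torusMatrix, Matrix.of_apply, Matrix.of_apply, h0,
    integral_cellIntegrand ha ((integrable_coord_mul ha hm i j).const_mul (1 / 2))
      (cellIntegrand₁_eq hper i j),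
    integral_cellIntegrand ha (integrable_coord_sub ha hm i (hκ.memLp j))
      (cellIntegrand₂_eq hper κ i j), integral_const_mul]

end

/-! ### The rescaled operators and their resolvents -/

section

variable {d : ℕ} {a mu lam : E d → ℝ} {α₁ α₂ : ℝ} {ε : ℝ}

/-- The dilation `z ↦ εz`. -/
def dil (d : ℕ) (ε : ℝ) : E d →+ E d := DistribSMul.toAddMonoidHom (E d) ε

theorem dil_apply (z : E d) : dil d ε z = ε • z := rfl

theorem measurable_dil : Measurable (dil d ε) := measurable_const_smul ε

/-- The substitution y = x − εz has Jacobian ε^d, which leaves ε⁻² of the normalisation. -/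
theorem rescaledFun_eq (ha : IsKernel a) (hε : 0 < ε) (u : E d → ℝ) (x : E d) :
    rescaledFun a lam mu ε u x = (ε ^ 2)⁻¹ * (lam (ε⁻¹ • x) *
      genFun (kernelMeasure a) (dil d ε) (fun x => mu (ε⁻¹ • x)) u x) := by
  rw [rescaledFun, genFun, integral_kernelMeasure ha.int ha.nonneg]
  have h1 : ∫ y, rescaledIntegrand a lam mu ε u x y =
      ∫ y, rescaledIntegrand a lam mu ε u x (x - y) :=
    (integral_sub_left_eq_self (fun y => rescaledIntegrand a lam mu ε u x y) volume x).symm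
  have h2 := Measure.integral_comp_smul (volume : Measure (E d))
    (fun y => rescaledIntegrand a lam mu ε u x (x - y)) ε
  rw [finrank_euclideanSpace_fin, abs_of_pos (by positivity), smul_eq_mul] at h2
  have h3 : ∀ z, rescaledIntegrand a lam mu ε u x (x - ε • z) = lam (ε⁻¹ • x) * (a z *
      (mu (ε⁻¹ • (x - dil d ε z)) * (u (x - dil d ε z) - u x))) := by
    intro z
    rw [rescaledIntegrand, sub_sub_cancel, smul_smul, inv_mul_cancel₀ hε.ne', one_smul, dil_apply]
    ring
  simp only [h3] at h2
  rw [integral_const_mul] at h2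
  rw [h1, h2, pow_add, mul_inv]
  ring

theorem integrable_rescaledIntegrand (ha : IsKernel a) (hε : 0 < ε) {u : E d → ℝ} {x : E d}
    (h : Integrable (fun z => mu (ε⁻¹ • (x - dil d ε z)) * (u (x - dil d ε z) - u x))
      (kernelMeasure a)) : Integrable (rescaledIntegrand a lam mu ε u x) := by
  rw [integrable_kernelMeasure_iff ha.int ha.nonneg] at h
  refine (((h.comp_smul (R := ε⁻¹) (inv_ne_zero hε.ne')).comp_sub_left x).const_mul
    (lam (ε⁻¹ • x))).congr (Eventually.of_forall fun y => ?_)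
  simp only [rescaledIntegrand, dil_apply, smul_smul, mul_inv_cancel₀ hε.ne', one_smul,
    sub_sub_cancel]
  ring

theorem aesm_rescaled (hper : IsPeriodic mu) (hm : IsCoeff (fun t => mu (sec t)) α₁ α₂)
    (hε : ε ≠ 0) : AEStronglyMeasurable fun x : E d => mu (ε⁻¹ • x) := by
  have := hm.meas.comp_quasiMeasurePreserving (quasiMeasurePreserving_proj_smul (d := d) hε)
  refine this.congr (Eventually.of_forall fun x => ?_)
  exact hper.comp_sec_proj _

theorem inRescaledDomain (ha : IsKernel a) (hper : IsPeriodic mu)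
    (hm : IsCoeff (fun t => mu (sec t)) α₁ α₂) (hperl : IsPeriodic lam)
    (hl : IsCoeff (fun t => lam (sec t)) α₁ α₂) (hε : 0 < ε) (u : L2 d) :
    InRescaledDomain a lam mu ε u := by
  have := ha.finite
  have hb : ∀ x : E d, |mu (ε⁻¹ • x)| ≤ α₂ := fun x => by
    rw [← hper.comp_sec_proj]; exact hm.abs_le _
  have hbl : ∀ x : E d, |lam (ε⁻¹ • x)| ≤ α₂ := fun x => by
    rw [← hperl.comp_sec_proj]; exact hl.abs_le _
  obtain ⟨h1, h2⟩ := genFun_aux (ρ := kernelMeasure a) (measurable_dil (d := d) (ε := ε))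
    (aesm_rescaled hper hm hε.ne') hb (Lp.memLp u)
  refine ⟨?_, ?_⟩
  · filter_upwards [h1] with x hx using integrable_rescaledIntegrand ha hε hx
  · have h3 := (memLp_mul_of_bound (aesm_rescaled hperl hl hε.ne') hbl h2).const_mul (ε ^ 2)⁻¹
    exact h3.ae_eq (Eventually.of_forall fun x => (rescaledFun_eq ha hε u x).symm)

theorem coeFn_rescaledOp (ha : IsKernel a) (hε : 0 < ε) (u : (rescaledOp a lam mu ε).domain) :
    (rescaledOp a lam mu ε u : E d → ℝ) =ᵐ[volume] fun x => (ε ^ 2)⁻¹ * (lam (ε⁻¹ • x) *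
      genFun (kernelMeasure a) (dil d ε) (fun x => mu (ε⁻¹ • x)) (u : L2 d) x) := by
  have h : InRescaledDomain a lam mu ε u.1 := u.2
  have h1 : rescaledOp a lam mu ε u = h.2.toLp _ := rfl
  rw [h1]
  filter_upwards [h.2.coeFn_toLp] with x hx
  rw [hx, rescaledFun_eq ha hε]

/-- The order of quantifiers is the point: C is chosen before ε, as ε enters only through the scale
s = ε⁻², absent from the bound. -/
theorem exists_rescaled_resolvent (ha : IsKernel a) (hper : IsPeriodic mu)
    (hm : IsCoeff (fun t => mu (sec t)) α₁ α₂) (hperl : IsPeriodic lam)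
    (hl : IsCoeff (fun t => lam (sec t)) α₁ α₂) {k : ℝ} (hk : 0 < k) :
    ∃ C : ℝ, ∀ ε : ℝ, 0 < ε → (rescaledOp a lam mu ε).domain = ⊤ ∧
      Continuous (rescaledOp a lam mu ε) ∧
      ∃ R : L2 d →L[ℝ] L2 d, IsResolvent (rescaledOp a lam mu ε) k R ∧ ‖R‖ ≤ C := by
  have := ha.finite
  have := ha.negInvariant
  refine ⟨(k * (α₁ / α₂))⁻¹ * (α₂ / α₁), fun ε hε => ?_⟩
  obtain ⟨L, R, hL, hR1, hR2, hR3⟩ := exists_resolvent (ν := (volume : Measure (E d)))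
    (ρ := kernelMeasure a) (measurable_dil (d := d) (ε := ε)) (aesm_rescaled hper hm hε.ne')
    (aesm_rescaled hperl hl hε.ne') hm.pos
    (fun x => by rw [← hper.comp_sec_proj]; exact hm.bound _)
    (fun x => by rw [← hperl.comp_sec_proj]; exact hl.bound _)
    (s := (ε ^ 2)⁻¹) (by positivity) hk
  have hop : ∀ u : (rescaledOp a lam mu ε).domain, rescaledOp a lam mu ε u = L u := by
    intro u
    refine Lp.ext ?_
    filter_upwards [coeFn_rescaledOp ha hε u, hL u] with x h1 h2
    rw [h1, h2]
  have hdom : ∀ u : L2 d, u ∈ (rescaledOp a lam mu ε).domain := fun u =>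
    inRescaledDomain ha hper hm hperl hl hε u
  refine ⟨Submodule.eq_top_iff'.2 hdom, ?_, R, ⟨fun f => ⟨hdom _, ?_⟩, fun u => ?_⟩, hR3⟩
  · have : (rescaledOp a lam mu ε : (rescaledOp a lam mu ε).domain → L2 d) =
        fun u : (rescaledOp a lam mu ε).domain => L u := funext hop
    rw [this]
    exact L.continuous.comp continuous_subtype_val
  · rw [hop, hR1]
  · rw [hop, hR2]

end

/-! ### Test functions and Taylor expansions -/

section

variable {d : ℕ}

/-- Smooth functions with compact support. -/
structure IsTest (φ : E d → ℝ) : Prop where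
  smooth : ContDiff ℝ ∞ φ
  supp : HasCompactSupport φ

/-- The `i`-th partial derivative. -/
def pd (i : Fin d) (φ : E d → ℝ) (x : E d) : ℝ := fderiv ℝ φ x (e i)

theorem contDiff_pd {φ : E d → ℝ} (h : ContDiff ℝ ∞ φ) (i : Fin d) : ContDiff ℝ ∞ (pd i φ) :=
  (h.fderiv_right (m := ∞) (by simp)).clm_apply contDiff_const

theorem IsTest.pderiv {φ : E d → ℝ} (h : IsTest φ) (i : Fin d) : IsTest (pd i φ) :=
  ⟨contDiff_pd h.smooth i, hasCompactSupport_partial h.supp i⟩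

theorem fderiv_apply_eq_sum (φ : E d → ℝ) (x v : E d) :
    fderiv ℝ φ x v = ∑ i, v i * pd i φ x := by
  have h : v = ∑ i, v i • e i := by
    ext j
    simp [Finset.sum_apply, Pi.single_apply]
  conv_lhs => rw [h]
  simp [pd]

theorem hasDerivAt_line {φ : E d → ℝ} (h : ContDiff ℝ ∞ φ) (x v : E d) (t : ℝ) :
    HasDerivAt (fun t : ℝ => φ (x - t • v)) (-∑ i, v i * pd i φ (x - t • v)) t := by
  have h1 : HasFDerivAt φ (fderiv ℝ φ (x - t • v)) (x - t • v) :=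
    (h.differentiable (by simp)).differentiableAt.hasFDerivAt
  have h2 : HasDerivAt (fun t : ℝ => x - t • v) (-v) t := by
    simpa using ((hasDerivAt_id t).smul_const v).const_sub x
  have h3 := h1.comp_hasDerivAt t h2
  rw [map_neg, fderiv_apply_eq_sum] at h3
  exact h3

theorem abs_sub_le_of_deriv_bound {f f' : ℝ → ℝ} (hf : ∀ t, HasDerivAt f (f' t) t) {B : ℝ}
    (hB : ∀ t ∈ Set.Ico (0 : ℝ) 1, |f' t| ≤ B) : |f 1 - f 0| ≤ B :=
  norm_image_sub_le_of_norm_deriv_le_segment_01' (fun t _ => (hf t).hasDerivWithinAt) hB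

theorem IsTest.exists_bound {φ : E d → ℝ} (h : IsTest φ) : ∃ C, 0 ≤ C ∧ ∀ x, |φ x| ≤ C := by
  obtain ⟨C, hC⟩ := h.supp.exists_bound_of_continuous h.smooth.continuous
  exact ⟨C, (norm_nonneg _).trans (hC 0), hC⟩

theorem abs_sum_coord_mul_le (v : E d) {f C : Fin d → ℝ} {B : ℝ}
    (hf : ∀ i, |f i| ≤ C i * B) : |∑ i, v i * f i| ≤ (∑ i, C i) * (‖v‖ * B) := by
  refine (Finset.abs_sum_le_sum_abs _ _).trans ?_
  rw [Finset.sum_mul]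
  refine Finset.sum_le_sum fun i _ => ?_
  rw [abs_mul]
  calc |v i| * |f i| ≤ ‖v‖ * (C i * B) :=
        mul_le_mul (abs_coord_le_norm v i) (hf i) (abs_nonneg _) (norm_nonneg _)
    _ = _ := by ring

/-- Boundedness handles large v, the Lipschitz bound small v. The factor min 1 ‖v‖ is kept in all
orders because only second moments of a are available: the final remainder must be O(‖v‖²) with a
bounded factor tending to 0. -/
theorem IsTest.taylor_zero {φ : E d → ℝ} (h : IsTest φ) :
    ∃ C, 0 ≤ C ∧ ∀ x v, |φ (x - v) - φ x| ≤ C * min 1 ‖v‖ := by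
  obtain ⟨C₀, h0, hC₀⟩ := h.exists_bound
  choose C h1 hC using fun i => (h.pderiv i).exists_bound
  have hs : 0 ≤ ∑ i, C i := Finset.sum_nonneg fun i _ => h1 i
  refine ⟨2 * C₀ + ∑ i, C i, by positivity, fun x v => ?_⟩
  rcases le_total 1 ‖v‖ with hv | hv
  · rw [min_eq_left hv, mul_one]
    calc _ ≤ |φ (x - v)| + |φ x| := abs_sub _ _
      _ ≤ _ := by linarith [hC₀ (x - v), hC₀ x]
  · rw [min_eq_right hv]
    have h2 := abs_sub_le_of_deriv_bound (hasDerivAt_line h.smooth x v)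
      (B := (∑ i, C i) * (‖v‖ * 1)) (fun t _ => by
        rw [abs_neg]
        exact abs_sum_coord_mul_le v fun i => by rw [mul_one]; exact hC i _)
    simp only [one_smul, zero_smul, sub_zero, mul_one] at h2
    exact h2.trans (mul_le_mul_of_nonneg_right (by linarith) (norm_nonneg _))

theorem min_one_smul_le {t : ℝ} (ht : t ∈ Set.Ico (0 : ℝ) 1) (v : E d) :
    min 1 ‖t • v‖ ≤ min 1 ‖v‖ := by
  refine min_le_min le_rfl ?_
  rw [norm_smul, Real.norm_of_nonneg ht.1]
  exact mul_le_of_le_one_left (norm_nonneg _) ht.2.le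

theorem IsTest.taylor_one {φ : E d → ℝ} (h : IsTest φ) :
    ∃ C, 0 ≤ C ∧ ∀ x v, |φ (x - v) - φ x + ∑ i, v i * pd i φ x| ≤ C * (‖v‖ * min 1 ‖v‖) := by
  choose C h1 hC using fun i => (h.pderiv i).taylor_zero
  refine ⟨∑ i, C i, Finset.sum_nonneg fun i _ => h1 i, fun x v => ?_⟩
  have hm : 0 ≤ min 1 ‖v‖ := le_min zero_le_one (norm_nonneg _)
  have h2 := abs_sub_le_of_deriv_bound
    (fun t => (hasDerivAt_line h.smooth x v t).add
      ((hasDerivAt_id t).mul_const (∑ i, v i * pd i φ x)))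
    (B := (∑ i, C i) * (‖v‖ * min 1 ‖v‖)) (fun t ht => by
      have : -∑ i, v i * pd i φ (x - t • v) +
          1 * ∑ i, v i * pd i φ x =
          -∑ i, v i * (pd i φ (x - t • v) - pd i φ x) := by
        simp only [mul_sub, Finset.sum_sub_distrib]; ring
      rw [this, abs_neg]
      exact abs_sum_coord_mul_le v fun i => (hC i x (t • v)).trans
        (mul_le_mul_of_nonneg_left (min_one_smul_le ht v) (h1 i)))
  convert! h2 using 2
  simp
  ring

/-- Obtained from the first-order expansion of each ∂_jφ by the mean value inequality along the
segment from x to x − v. -/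
theorem IsTest.taylor_two {φ : E d → ℝ} (h : IsTest φ) :
    ∃ C, 0 ≤ C ∧ ∀ x v, |φ (x - v) - φ x + ∑ j, v j * pd j φ x -
      1 / 2 * ∑ j, v j * ∑ i, v i * pd i (pd j φ) x| ≤ C * (‖v‖ * (‖v‖ * min 1 ‖v‖)) := by
  choose C h1 hC using fun i => (h.pderiv i).taylor_one
  refine ⟨∑ i, C i, Finset.sum_nonneg fun i _ => h1 i, fun x v => ?_⟩
  have hm : 0 ≤ min 1 ‖v‖ := le_min zero_le_one (norm_nonneg _)
  set S := ∑ j, v j * pd j φ x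
  set Q := ∑ j, v j * ∑ i, v i * pd i (pd j φ) x
  have h2 := abs_sub_le_of_deriv_bound
    (fun t => ((hasDerivAt_line h.smooth x v t).add ((hasDerivAt_id t).mul_const S)).sub
      (((hasDerivAt_id t).pow 2).mul_const (1 / 2 * Q)))
    (B := (∑ i, C i) * (‖v‖ * (‖v‖ * min 1 ‖v‖))) (fun t ht => by
      -- The derivative of the remainder along the segment is minus the sum of v_j times the
      -- first-order remainder of ∂_jφ for the increment tv.
      have : -∑ j, v j * pd j φ (x - t • v) + 1 * S -
          ↑2 * id t ^ (2 - 1) * 1 * (1 / 2 * Q) =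
          -∑ j, v j * (pd j φ (x - t • v) - pd j φ x +
            ∑ i, (t • v) i * pd i (pd j φ) x) := by
        simp only [mul_sub, mul_add, Finset.sum_sub_distrib, Finset.sum_add_distrib, S, Q,
          PiLp.smul_apply, smul_eq_mul, mul_assoc t, ← Finset.mul_sum, mul_left_comm _ t]
        simp
        ring
      simp only [Nat.cast_ofNat] at this ⊢
      rw [this, abs_neg]
      refine abs_sum_coord_mul_le v fun i => (hC i x (t • v)).trans
        (mul_le_mul_of_nonneg_left ?_ (h1 i))
      refine mul_le_mul ?_ (min_one_smul_le ht v) (le_min zero_le_one (norm_nonneg _))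
        (norm_nonneg _)
      rw [norm_smul, Real.norm_of_nonneg ht.1]
      exact mul_le_of_le_one_left (norm_nonneg _) ht.2.le)
  convert! h2 using 2
  simp
  ring

theorem IsTest.exists_radius {φ : E d → ℝ} (h : IsTest φ) :
    ∃ R : ℝ, tsupport φ ⊆ Metric.closedBall 0 R :=
  h.supp.isBounded.subset_closedBall 0

theorem tsupport_pd_subset (φ : E d → ℝ) (i : Fin d) : tsupport (pd i φ) ⊆ tsupport φ :=
  tsupport_fderiv_apply_subset ℝ (e i)

theorem IsTest.memLp {φ : E d → ℝ} (h : IsTest φ) : MemLp φ 2 :=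
  h.smooth.continuous.memLp_of_hasCompactSupport h.supp

end

/-! ### Vanishing of the remainder -/

section

variable {d : ℕ} {a : E d → ℝ}

/-- The indicator function of a closed ball centred at the origin. -/
def ballInd (R : ℝ) (x : E d) : ℝ≥0∞ := (Metric.closedBall (0 : E d) R).indicator 1 x

theorem measurable_ballInd (R : ℝ) : Measurable (ballInd (d := d) R) :=
  measurable_one.indicator Metric.isClosed_closedBall.measurableSet

theorem ballInd_sq (R : ℝ) (x : E d) : ballInd R x ^ 2 = ballInd R x := by
  by_cases h : x ∈ Metric.closedBall (0 : E d) R <;> simp [ballInd, h]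

theorem ballInd_eq_one {R : ℝ} {x : E d} (h : x ∈ Metric.closedBall (0 : E d) R) :
    ballInd R x = 1 := by simp [ballInd, h]

theorem lintegral_proj_mul_ballInd_le {p : Torus d → ℝ≥0∞} (hp : Measurable p) (R : ℝ) {ε : ℝ}
    (hε : 0 < ε) (hε1 : ε ≤ 1) (t : Torus d) :
    ∫⁻ x, p (proj d (ε⁻¹ • x) - t) * ballInd R x ≤
      (∫⁻ τ, p τ) * volume (Metric.closedBall (0 : E d) (R + d)) := by
  -- For ε ≤ 1 the shifts εs, with s in the cell, have norm at most d, so enlarging the radius by d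
  -- absorbs them.
  have h := lintegral_proj_mul_le hp (h := ballInd R) (measurable_ballInd (R + d)) hε.ne' t
    (fun x s hs => by
      by_cases hx : x ∈ Metric.closedBall (0 : E d) R
      · rw [ballInd_eq_one (R := R + d)]
        · exact (ballInd_eq_one hx).le
        · rw [mem_closedBall_zero_iff] at hx ⊢
          refine (norm_add_le _ _).trans (add_le_add hx ?_)
          rw [norm_smul, Real.norm_of_nonneg hε.le]
          exact (mul_le_of_le_one_left (norm_nonneg _) hε1).trans (norm_le_of_mem_unitCell hs)
      · simp [ballInd, hx])
  refine h.trans_eq ?_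
  congr 1
  exact lintegral_indicator_one Metric.isClosed_closedBall.measurableSet

/-- The integrand of the remainder bound. -/
def remBound (p : Torus d → ℝ≥0∞) (R ε : ℝ) (x z : E d) : ℝ≥0∞ :=
  p (proj d (ε⁻¹ • x) - proj d z) * (ENNReal.ofReal (min 1 (ε * ‖z‖)) *
    (ballInd R x + ballInd R (x - ε • z)))

theorem measurable_remBound {p : Torus d → ℝ≥0∞} (hp : Measurable p) (R ε : ℝ) :
    Measurable (Function.uncurry (remBound p R ε)) := by
  refine (hp.comp ?_).mul (Measurable.mul ?_ (((measurable_ballInd R).comp measurable_fst).add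
    ((measurable_ballInd R).comp ?_)))
  · exact (measurable_proj.comp ((measurable_const_smul ε⁻¹).comp measurable_fst)).sub
      (measurable_proj.comp measurable_snd)
  · fun_prop
  · exact measurable_fst.sub ((measurable_const_smul ε).comp measurable_snd)

/-- For the ball around x the averaging bound is uniform in the shift z; for the ball around x − εz,
translating by εz removes the shift. Only the small factor still depends on ε and z. The 4 is a 2
from squaring a sum of two indicators, times two terms. -/
theorem lintegral_remBound_sq_le {p : Torus d → ℝ≥0∞} (hp : Measurable p) (R : ℝ) {ε : ℝ}
    (hε : 0 < ε) (hε1 : ε ≤ 1) (z : E d) :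
    ∫⁻ x, remBound p R ε x z ^ 2 ≤ ENNReal.ofReal (min 1 (ε * ‖z‖)) ^ 2 *
      (4 * ((∫⁻ τ, p τ ^ 2) * volume (Metric.closedBall (0 : E d) (R + d)))) := by
  set K := (∫⁻ τ, p τ ^ 2) * volume (Metric.closedBall (0 : E d) (R + d))
  have hp2 : Measurable fun τ => p τ ^ 2 := hp.pow_const 2
  have h1 : ∫⁻ x, p (proj d (ε⁻¹ • x) - proj d z) ^ 2 * ballInd R x ≤ K :=
    lintegral_proj_mul_ballInd_le hp2 R hε hε1 _
  have h2 : ∫⁻ x, p (proj d (ε⁻¹ • x) - proj d z) ^ 2 * ballInd R (x - ε • z) ≤ K := by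
    have h3 := lintegral_proj_mul_ballInd_le hp2 R hε hε1 0
    rw [← lintegral_sub_right_eq_self _ (ε • z)] at h3
    refine (le_of_eq ?_).trans h3
    refine lintegral_congr fun x => ?_
    rw [smul_sub, smul_smul, inv_mul_cancel₀ hε.ne', one_smul, map_sub, sub_zero]
  have hpt : ∀ x, remBound p R ε x z ^ 2 ≤ ENNReal.ofReal (min 1 (ε * ‖z‖)) ^ 2 *
      (2 * (p (proj d (ε⁻¹ • x) - proj d z) ^ 2 * ballInd R x +
        p (proj d (ε⁻¹ • x) - proj d z) ^ 2 * ballInd R (x - ε • z))) := by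
    intro x
    have hs : (ballInd R x + ballInd R (x - ε • z)) ^ 2 ≤
        2 * (ballInd R x + ballInd R (x - ε • z)) := by
      have h3 : ∀ y : E d, ballInd R y = 0 ∨ ballInd R y = 1 := fun y => by
        by_cases h : y ∈ Metric.closedBall (0 : E d) R <;>
          simp [ballInd, h]
      rcases h3 x with h | h <;> rcases h3 (x - ε • z) with h' | h' <;> rw [h, h'] <;> norm_num
    calc _ = ENNReal.ofReal (min 1 (ε * ‖z‖)) ^ 2 * (p (proj d (ε⁻¹ • x) - proj d z) ^ 2 *
          (ballInd R x + ballInd R (x - ε • z)) ^ 2) := by rw [remBound]; ring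
      _ ≤ ENNReal.ofReal (min 1 (ε * ‖z‖)) ^ 2 * (p (proj d (ε⁻¹ • x) - proj d z) ^ 2 *
          (2 * (ballInd R x + ballInd R (x - ε • z)))) := by gcongr
      _ = _ := by ring
  have hm1 : Measurable fun x => p (proj d (ε⁻¹ • x) - proj d z) ^ 2 * ballInd R x :=
    (hp2.comp ((measurable_proj.comp (measurable_const_smul ε⁻¹)).sub_const _)).mul
      (measurable_ballInd R)
  refine (lintegral_mono hpt).trans ?_
  rw [lintegral_const_mul' _ _ (by simp), lintegral_const_mul' _ _ (by simp),
    lintegral_add_left hm1]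
  exact mul_le_mul' le_rfl ((mul_le_mul' le_rfl (add_le_add h1 h2)).trans_eq (by ring))

/-- Cauchy–Schwarz with weight 1 + |z|² and Tonelli reduce to the weighted a-integral of min(1,
ε|z|)², which tends to 0 by dominated convergence. No rate results, since no moment beyond the
second is assumed. -/
theorem tendsto_remainder (ha : IsKernel a) {p : Torus d → ℝ≥0∞} (hp : Measurable p)
    (hp2 : ∫⁻ τ, p τ ^ 2 ≠ ⊤) (R : ℝ) :
    Tendsto (fun ε => ∫⁻ x, (∫⁻ z, ENNReal.ofReal (weight z) * remBound p R ε x z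
      ∂(kernelMeasure a)) ^ 2) (𝓝[>] 0) (𝓝 0) := by
  have := ha.finite
  have hW : Measurable fun z : E d => ENNReal.ofReal (weight z) :=
    continuous_weight.measurable.ennreal_ofReal
  have hW0 : ∫⁻ z, ENNReal.ofReal (weight z) ∂(kernelMeasure a) ≠ ⊤ :=
    ha.integrable_weight.lintegral_lt_top.ne
  set W0 := ∫⁻ z, ENNReal.ofReal (weight z) ∂(kernelMeasure a)
  set K := 4 * ((∫⁻ τ, p τ ^ 2) * volume (Metric.closedBall (0 : E d) (R + d)))
  have hK : K ≠ ⊤ := ENNReal.mul_ne_top (by simp)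
    (ENNReal.mul_ne_top hp2 measure_closedBall_lt_top.ne)
  set g : ℝ → ℝ≥0∞ := fun ε => ∫⁻ z, ENNReal.ofReal (weight z) *
    ENNReal.ofReal (min 1 (ε * ‖z‖)) ^ 2 ∂(kernelMeasure a)
  have hg : Tendsto g (𝓝[>] 0) (𝓝 0) := by
    have : Tendsto g (𝓝[>] 0) (𝓝 (∫⁻ z : E d, 0 ∂(kernelMeasure a))) := by
      refine tendsto_lintegral_filter_of_dominated_convergence
        (fun z => ENNReal.ofReal (weight z)) (Eventually.of_forall fun ε => ?_)
        (Eventually.of_forall fun ε => Eventually.of_forall fun z => ?_) hW0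
        (Eventually.of_forall fun z => ?_)
      · exact hW.mul (by fun_prop)
      · refine mul_le_of_le_one_right' (pow_le_one₀ zero_le ?_)
        exact ENNReal.ofReal_le_one.2 (min_le_left _ _)
      · have h1 : Tendsto (fun ε : ℝ => ENNReal.ofReal (min 1 (ε * ‖z‖)) ^ 2) (𝓝[>] 0)
            (𝓝 (ENNReal.ofReal (min 1 (0 * ‖z‖)) ^ 2)) := by
          refine Tendsto.mono_left (Continuous.tendsto ?_ 0) nhdsWithin_le_nhds
          exact (ENNReal.continuous_pow 2).comp (ENNReal.continuous_ofReal.comp (by fun_prop))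
        have h2 := ENNReal.Tendsto.const_mul (a := ENNReal.ofReal (weight z)) h1
          (Or.inr ENNReal.ofReal_ne_top)
        simpa using h2
    simpa using this
  have hbound : ∀ᶠ ε in 𝓝[>] (0 : ℝ), ∫⁻ x, (∫⁻ z, ENNReal.ofReal (weight z) * remBound p R ε x z
      ∂(kernelMeasure a)) ^ 2 ≤ W0 * (g ε * K) := by
    have h1 : ∀ᶠ ε in 𝓝[>] (0 : ℝ), ε ≤ 1 :=
      nhdsWithin_le_nhds (Iic_mem_nhds (by norm_num))
    filter_upwards [self_mem_nhdsWithin, h1] with ε hε hε1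
    have hr := measurable_remBound hp R ε
    calc _ ≤ ∫⁻ x, W0 * ∫⁻ z, ENNReal.ofReal (weight z) * remBound p R ε x z ^ 2
          ∂(kernelMeasure a) := lintegral_mono fun x => sq_lintegral_mul_le hW.aemeasurable
            (hr.comp measurable_prodMk_left).aemeasurable
      _ = W0 * ∫⁻ x, ∫⁻ z, ENNReal.ofReal (weight z) * remBound p R ε x z ^ 2
          ∂(kernelMeasure a) := lintegral_const_mul' _ _ hW0
      _ = W0 * ∫⁻ z, ∫⁻ x, ENNReal.ofReal (weight z) * remBound p R ε x z ^ 2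
          ∂volume ∂(kernelMeasure a) := by
          rw [lintegral_lintegral_swap]
          exact ((hW.comp measurable_snd).mul (hr.pow_const 2)).aemeasurable
      _ ≤ W0 * ∫⁻ z, ENNReal.ofReal (weight z) * ENNReal.ofReal (min 1 (ε * ‖z‖)) ^ 2 * K
          ∂(kernelMeasure a) := by
          gcongr with z
          rw [lintegral_const_mul' _ _ ENNReal.ofReal_ne_top, mul_assoc]
          gcongr
          exact lintegral_remBound_sq_le hp R hε hε1 z
      _ = _ := by rw [lintegral_mul_const' _ _ hK]
  refine tendsto_of_tendsto_of_tendsto_of_le_of_le' tendsto_const_nhds ?_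
    (Eventually.of_forall fun ε => zero_le) hbound
  have h2 := ENNReal.Tendsto.const_mul (a := W0)
    (ENNReal.Tendsto.mul_const hg (Or.inr hK)) (Or.inr hW0)
  simpa using h2

end

/-! ### The two-scale expansion -/

section

variable {d : ℕ} {a : E d → ℝ} {l m : Torus d → ℝ} {α₁ α₂ : ℝ}

theorem exists_uniform_const {ι : Type*} [Fintype ι] {X : Type*} {f g : ι → X → ℝ}
    (hg : ∀ i x, 0 ≤ g i x) (h : ∀ i, ∃ C, 0 ≤ C ∧ ∀ x, f i x ≤ C * g i x) :
    ∃ C, 0 ≤ C ∧ ∀ i x, f i x ≤ C * g i x := by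
  choose C h0 hC using h
  refine ⟨∑ i, C i, Finset.sum_nonneg fun i _ => h0 i, fun i x => (hC i x).trans ?_⟩
  exact mul_le_mul_of_nonneg_right
    (Finset.single_le_sum (fun i _ => h0 i) (Finset.mem_univ i)) (hg i x)

theorem abs_sum_mul_le {ι : Type*} [Fintype ι] {κ f : ι → ℝ} {B : ℝ} (hf : ∀ i, |f i| ≤ B) :
    |∑ i, κ i * f i| ≤ (∑ i, |κ i|) * B := by
  refine (Finset.abs_sum_le_sum_abs _ _).trans ?_
  rw [Finset.sum_mul]
  refine Finset.sum_le_sum fun i _ => ?_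
  rw [abs_mul]
  exact mul_le_mul_of_nonneg_left (hf i) (abs_nonneg _)

/-- The two-scale ansatz `φ + ε κ(x/ε)·∇φ + ε² χ(x/ε):∇²φ`. -/
def ansatz (κ : Fin d → Torus d → ℝ) (χ : Fin d → Fin d → Torus d → ℝ) (φ : E d → ℝ) (ε : ℝ)
    (x : E d) : ℝ :=
  φ x + ε * (∑ j, κ j (proj d (ε⁻¹ • x)) * pd j φ x) +
    ε ^ 2 * ∑ i, ∑ j, χ i j (proj d (ε⁻¹ • x)) * pd i (pd j φ) x

/-- The remainder in the two-scale expansion. -/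
def expRem (κ : Fin d → Torus d → ℝ) (χ : Fin d → Fin d → Torus d → ℝ) (φ : E d → ℝ) (ε : ℝ)
    (x z : E d) : ℝ :=
  (ε ^ 2)⁻¹ * (φ (x - ε • z) - φ x + ∑ j, (ε • z) j * pd j φ x -
      1 / 2 * ∑ j, (ε • z) j * ∑ i, (ε • z) i * pd i (pd j φ) x) +
    ε⁻¹ * (∑ j, κ j (proj d (ε⁻¹ • x) - proj d z) * (pd j φ (x - ε • z) - pd j φ x +
      ∑ i, (ε • z) i * pd i (pd j φ) x)) +
    ∑ i, ∑ j, χ i j (proj d (ε⁻¹ • x) - proj d z) * (pd i (pd j φ) (x - ε • z) -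
      pd i (pd j φ) x)

/-- The size `1 + Σ |κ| + Σ |χ|` of the correctors. -/
def corrSize (κ : Fin d → Torus d → ℝ) (χ : Fin d → Fin d → Torus d → ℝ) (t : Torus d) : ℝ :=
  1 + ∑ j, |κ j t| + ∑ i, ∑ j, |χ i j t|

variable {κ : Fin d → Torus d → ℝ} {χ : Fin d → Fin d → Torus d → ℝ}

theorem corrSize_pos (t : Torus d) : 0 < corrSize κ χ t := by unfold corrSize; positivity

theorem measurable_corrSize (hκ : ∀ j, Measurable (κ j)) (hχ : ∀ i j, Measurable (χ i j)) :
    Measurable (corrSize κ χ) :=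
  (measurable_const.add (Finset.measurable_fun_sum _ fun j _ => (hκ j).abs)).add
    (Finset.measurable_fun_sum _ fun i _ => Finset.measurable_fun_sum _ fun j _ => (hχ i j).abs)

theorem memLp_corrSize (hκ : ∀ j, MemLp (κ j) 2) (hχ : ∀ i j, MemLp (χ i j) 2) :
    MemLp (corrSize κ χ) 2 :=
  ((memLp_const (1 : ℝ)).add (memLp_finsetSum _ fun j _ => (hκ j).abs)).add
    (memLp_finsetSum _ fun i _ => memLp_finsetSum _ fun j _ => (hχ i j).abs)

theorem proj_smul_sub {ε : ℝ} (hε : ε ≠ 0) (x z : E d) :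
    proj d (ε⁻¹ • (x - ε • z)) = proj d (ε⁻¹ • x) - proj d z := by
  rw [smul_sub, smul_smul, inv_mul_cancel₀ hε, one_smul, map_sub]

/-- Pure algebra, sorted by powers of ε before integration: the ε bracket is the first cell
equation, the ε² bracket the second, and the rest consists of differences with their Taylor
polynomials subtracted. -/
theorem ansatz_sub (φ : E d → ℝ) {ε : ℝ} (hε : ε ≠ 0) (x z : E d) :
    ansatz κ χ φ ε (x - ε • z) - ansatz κ χ φ ε x = ε ^ 2 * expRem κ χ φ ε x z +
      ∑ j, ε * pd j φ x *
        (κ j (proj d (ε⁻¹ • x) - proj d z) - κ j (proj d (ε⁻¹ • x)) - z j) +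
      ∑ i, ∑ j, ε ^ 2 * pd i (pd j φ) x *
        ((1 / 2 * (z i * z j) - z i * κ j (proj d (ε⁻¹ • x) - proj d z)) +
        (χ i j (proj d (ε⁻¹ • x) - proj d z) - χ i j (proj d (ε⁻¹ • x)))) := by
  simp only [ansatz, expRem, proj_smul_sub hε, PiLp.smul_apply, smul_eq_mul]
  generalize proj d (ε⁻¹ • x) = τ
  generalize τ - proj d z = σ
  have h1 : ∑ j, ε * z j * pd j φ x = ε * ∑ j, z j * pd j φ x := by
    rw [Finset.mul_sum]; exact Finset.sum_congr rfl fun j _ => by ring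
  have h2 : ∑ j, ε * z j * ∑ i, ε * z i * pd i (pd j φ) x =
      ε ^ 2 * ∑ i, ∑ j, pd i (pd j φ) x * (z i * z j) := by
    rw [Finset.sum_comm, Finset.mul_sum]
    refine Finset.sum_congr rfl fun j _ => ?_
    rw [Finset.mul_sum, Finset.mul_sum]
    exact Finset.sum_congr rfl fun i _ => by ring
  have h3 : ∑ j, κ j σ * (pd j φ (x - ε • z) - pd j φ x + ∑ i, ε * z i * pd i (pd j φ) x) =
      ∑ j, κ j σ * pd j φ (x - ε • z) - ∑ j, κ j σ * pd j φ x +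
      ε * ∑ i, ∑ j, pd i (pd j φ) x * (z i * κ j σ) := by
    rw [Finset.sum_comm (f := fun i j => pd i (pd j φ) x * (z i * κ j σ)), Finset.mul_sum,
      ← Finset.sum_sub_distrib, ← Finset.sum_add_distrib]
    refine Finset.sum_congr rfl fun j _ => ?_
    rw [mul_add, mul_sub, Finset.mul_sum, Finset.mul_sum]
    congr 1
    exact Finset.sum_congr rfl fun i _ => by ring
  have h4 : ∑ i, ∑ j, χ i j σ * (pd i (pd j φ) (x - ε • z) - pd i (pd j φ) x) =
      ∑ i, ∑ j, χ i j σ * pd i (pd j φ) (x - ε • z) - ∑ i, ∑ j, χ i j σ * pd i (pd j φ) x := by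
    simp only [mul_sub, Finset.sum_sub_distrib]
  have h5 : ∑ j, ε * pd j φ x * (κ j σ - κ j τ - z j) = ε * (∑ j, κ j σ * pd j φ x -
      ∑ j, κ j τ * pd j φ x - ∑ j, z j * pd j φ x) := by
    rw [← Finset.sum_sub_distrib, ← Finset.sum_sub_distrib, Finset.mul_sum]
    exact Finset.sum_congr rfl fun j _ => by ring
  have h6 : ∑ i, ∑ j, ε ^ 2 * pd i (pd j φ) x * ((1 / 2 * (z i * z j) - z i * κ j σ) +
      (χ i j σ - χ i j τ)) = ε ^ 2 * (1 / 2 * (∑ i, ∑ j, pd i (pd j φ) x * (z i * z j)) -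
      (∑ i, ∑ j, pd i (pd j φ) x * (z i * κ j σ)) + (∑ i, ∑ j, χ i j σ * pd i (pd j φ) x -
      ∑ i, ∑ j, χ i j τ * pd i (pd j φ) x)) := by
    simp only [Finset.mul_sum, ← Finset.sum_sub_distrib, ← Finset.sum_add_distrib]
    exact Finset.sum_congr rfl fun i _ => Finset.sum_congr rfl fun j _ => by ring
  rw [h1, h2, h3, h4, h5, h6]
  field_simp
  ring

/-- The three lines of the remainder are Taylor errors of order two, one and zero, divided by ε², ε
and 1, so each is bounded by (1 + |z|²) min(1, ε|z|) times the size of its corrector. -/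
theorem exists_expRem_le {φ : E d → ℝ} (hφ : IsTest φ) :
    ∃ C R : ℝ, 0 ≤ C ∧ ∀ (κ : Fin d → Torus d → ℝ) (χ : Fin d → Fin d → Torus d → ℝ) (ε : ℝ),
      0 < ε → ∀ x z, ‖expRem κ χ φ ε x z‖ₑ ≤ ENNReal.ofReal C * (ENNReal.ofReal (weight z) *
        remBound (fun t => ENNReal.ofReal (corrSize κ χ t)) R ε x z) := by
  obtain ⟨R, hR⟩ := hφ.exists_radius
  obtain ⟨C₂, h2, hC₂⟩ := hφ.taylor_two
  obtain ⟨C₁, h1, hC₁⟩ := exists_uniform_const (ι := Fin d) (X := E d × E d)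
    (f := fun j y => |pd j φ (y.1 - y.2) - pd j φ y.1 + ∑ i, y.2 i * pd i (pd j φ) y.1|)
    (g := fun _ y => ‖y.2‖ * min 1 ‖y.2‖) (fun _ y => by positivity) fun j => by
      obtain ⟨C, h, hC⟩ := (hφ.pderiv j).taylor_one
      exact ⟨C, h, fun y => hC _ _⟩
  obtain ⟨C₀, h0, hC₀⟩ := exists_uniform_const (ι := Fin d × Fin d) (X := E d × E d)
    (f := fun i y => |pd i.1 (pd i.2 φ) (y.1 - y.2) - pd i.1 (pd i.2 φ) y.1|)
    (g := fun _ y => min 1 ‖y.2‖) (fun _ y => by positivity) fun i => by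
      obtain ⟨C, h, hC⟩ := ((hφ.pderiv i.2).pderiv i.1).taylor_zero
      exact ⟨C, h, fun y => hC _ _⟩
  refine ⟨C₂ + C₁ + C₀, R, by positivity, fun κ χ ε hε x z => ?_⟩
  -- If both endpoints lie outside the support ball, every term vanishes; otherwise the sum of the
  -- two indicators is at least 1.
  by_cases hsupp : x ∉ Metric.closedBall (0 : E d) R ∧ x - ε • z ∉ Metric.closedBall (0 : E d) R
  · have hv : ∀ ψ : E d → ℝ, tsupport ψ ⊆ tsupport φ → ψ x = 0 ∧ ψ (x - ε • z) = 0 := fun ψ hψ =>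
      ⟨image_eq_zero_of_notMem_tsupport fun h => hsupp.1 (hR (hψ h)),
        image_eq_zero_of_notMem_tsupport fun h => hsupp.2 (hR (hψ h))⟩
    have e0 := hv φ subset_rfl
    have e1 := fun j => hv (pd j φ) (tsupport_pd_subset φ j)
    have e2 := fun i j => hv (pd i (pd j φ))
      ((tsupport_pd_subset _ i).trans (tsupport_pd_subset φ j))
    have : expRem κ χ φ ε x z = 0 := by
      simp [expRem, e0, e1, e2]
    simp [this]
  set σ := proj d (ε⁻¹ • x) - proj d z with hσ
  have hnorm : ‖ε • z‖ = ε * ‖z‖ := by rw [norm_smul, Real.norm_of_nonneg hε.le]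
  set μ := min 1 (ε * ‖z‖) with hμ
  have hμ0 : 0 ≤ μ := le_min zero_le_one (by positivity)
  have hz := norm_nonneg z
  have hW := weight_pos z
  have hreal : |expRem κ χ φ ε x z| ≤ (C₂ + C₁ + C₀) * (weight z * (corrSize κ χ σ * μ)) := by
    have b2 := hC₂ x (ε • z)
    rw [hnorm, ← hμ] at b2
    have t2 : |(ε ^ 2)⁻¹ * (φ (x - ε • z) - φ x + ∑ j, (ε • z) j * pd j φ x -
        1 / 2 * ∑ j, (ε • z) j * ∑ i, (ε • z) i * pd i (pd j φ) x)| ≤ C₂ * (weight z * μ) := by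
      rw [abs_mul, abs_of_pos (by positivity), inv_mul_le_iff₀ (by positivity)]
      refine b2.trans ?_
      have : ‖z‖ * ‖z‖ ≤ weight z := by unfold weight; nlinarith
      calc _ = ε ^ 2 * (C₂ * (‖z‖ * ‖z‖ * μ)) := by ring
        _ ≤ _ := by gcongr
    have t1 : |ε⁻¹ * (∑ j, κ j σ * (pd j φ (x - ε • z) - pd j φ x +
        ∑ i, (ε • z) i * pd i (pd j φ) x))| ≤ (∑ j, |κ j σ|) * (C₁ * (weight z * μ)) := by
      rw [abs_mul, abs_of_pos (by positivity), inv_mul_le_iff₀ hε]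
      refine (abs_sum_mul_le (B := C₁ * (ε * ‖z‖ * μ)) fun j => ?_).trans ?_
      · have := hC₁ j (x, ε • z)
        simp only [hnorm] at this
        exact this
      · have := norm_le_weight z
        calc _ ≤ (∑ j, |κ j σ|) * (C₁ * (ε * weight z * μ)) := by gcongr
          _ = _ := by ring
    have t0 : |∑ i, ∑ j, χ i j σ * (pd i (pd j φ) (x - ε • z) - pd i (pd j φ) x)| ≤
        (∑ i, ∑ j, |χ i j σ|) * (C₀ * (weight z * μ)) := by
      refine (Finset.abs_sum_le_sum_abs _ _).trans ?_
      rw [Finset.sum_mul]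
      refine Finset.sum_le_sum fun i _ => abs_sum_mul_le fun j => ?_
      have := hC₀ (i, j) (x, ε • z)
      simp only [hnorm] at this
      refine this.trans (mul_le_mul_of_nonneg_left ?_ h0)
      exact le_mul_of_one_le_left hμ0 (one_le_weight z)
    have hk : 0 ≤ ∑ j, |κ j σ| := by positivity
    have hx : 0 ≤ ∑ i, ∑ j, |χ i j σ| := by positivity
    have hY : 0 ≤ weight z * μ := by positivity
    calc |expRem κ χ φ ε x z| ≤ _ :=
          (abs_add_le _ _).trans (add_le_add ((abs_add_le _ _).trans (add_le_add t2 t1)) t0)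
      _ ≤ (C₂ + C₁ + C₀) * ((1 + ∑ j, |κ j σ| + ∑ i, ∑ j, |χ i j σ|) * (weight z * μ)) := by
          generalize (∑ j, |κ j σ|) = A at *
          generalize (∑ i, ∑ j, |χ i j σ|) = B at *
          generalize weight z * μ = Y at *
          have : 0 ≤ (C₁ + C₀) * Y + A * ((C₂ + C₀) * Y) + B * ((C₂ + C₁) * Y) := by positivity
          linarith
      _ = _ := by unfold corrSize; ring
  have hind : 1 ≤ ballInd R x + ballInd R (x - ε • z) := by
    rw [not_and_or, not_not, not_not] at hsupp
    rcases hsupp with h | h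
    · rw [ballInd_eq_one h]; exact le_self_add
    · rw [ballInd_eq_one h]; exact le_add_self
  calc ‖expRem κ χ φ ε x z‖ₑ ≤
      ENNReal.ofReal ((C₂ + C₁ + C₀) * (weight z * (corrSize κ χ σ * μ))) := by
        rw [Real.enorm_eq_ofReal_abs]; exact ENNReal.ofReal_le_ofReal hreal
    _ = ENNReal.ofReal (C₂ + C₁ + C₀) * (ENNReal.ofReal (weight z) *
        (ENNReal.ofReal (corrSize κ χ σ) * (ENNReal.ofReal μ * 1))) := by
        rw [ENNReal.ofReal_mul (by positivity), ENNReal.ofReal_mul hW.le,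
          ENNReal.ofReal_mul (corrSize_pos _).le, mul_one]
    _ ≤ _ := by
        rw [remBound]
        gcongr

theorem aesm_ansatz (hκ : ∀ j, Measurable (κ j)) (hχ : ∀ i j, Measurable (χ i j)) {φ : E d → ℝ}
    (hφ : IsTest φ) (ε : ℝ) : Measurable (ansatz κ χ φ ε) := by
  have hp : Measurable fun x : E d => proj d (ε⁻¹ • x) :=
    measurable_proj.comp (measurable_const_smul ε⁻¹)
  refine (hφ.smooth.continuous.measurable.add (Measurable.const_mul
    (Finset.measurable_fun_sum _ fun j _ => ((hκ j).comp hp).mul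
      (hφ.pderiv j).smooth.continuous.measurable) _)).add (Measurable.const_mul
    (Finset.measurable_fun_sum _ fun i _ => Finset.measurable_fun_sum _ fun j _ =>
      ((hχ i j).comp hp).mul ((hφ.pderiv j).pderiv i).smooth.continuous.measurable) _)

theorem exists_ansatz_sub_le {φ : E d → ℝ} (hφ : IsTest φ) :
    ∃ C R : ℝ, ∀ (κ : Fin d → Torus d → ℝ) (χ : Fin d → Fin d → Torus d → ℝ) (ε : ℝ),
      0 < ε → ε ≤ 1 → ∀ x, ‖ansatz κ χ φ ε x - φ x‖ₑ ≤ ENNReal.ofReal ε * (ENNReal.ofReal C *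
        (ENNReal.ofReal (corrSize κ χ (proj d (ε⁻¹ • x))) * ballInd R x)) := by
  obtain ⟨R, hR⟩ := hφ.exists_radius
  obtain ⟨C₁, h1, hC₁⟩ := exists_uniform_const (ι := Fin d) (X := E d)
    (f := fun j x => |pd j φ x|) (g := fun _ _ => 1) (fun _ _ => zero_le_one) fun j => by
      obtain ⟨C, h, hC⟩ := (hφ.pderiv j).exists_bound
      exact ⟨C, h, fun y => by rw [mul_one]; exact hC _⟩
  obtain ⟨C₀, h0, hC₀⟩ := exists_uniform_const (ι := Fin d × Fin d) (X := E d)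
    (f := fun i x => |pd i.1 (pd i.2 φ) x|) (g := fun _ _ => 1) (fun _ _ => zero_le_one)
    fun i => by
      obtain ⟨C, h, hC⟩ := ((hφ.pderiv i.2).pderiv i.1).exists_bound
      exact ⟨C, h, fun y => by rw [mul_one]; exact hC _⟩
  simp only [mul_one] at hC₁ hC₀
  refine ⟨C₁ + C₀, R, fun κ χ ε hε hε1 x => ?_⟩
  have heq : ansatz κ χ φ ε x - φ x = ε * ((∑ j, κ j (proj d (ε⁻¹ • x)) * pd j φ x) +
      ε * ∑ i, ∑ j, χ i j (proj d (ε⁻¹ • x)) * pd i (pd j φ) x) := by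
    rw [ansatz]; ring
  by_cases hx : x ∈ Metric.closedBall (0 : E d) R
  · rw [ballInd_eq_one hx, mul_one, heq]
    set τ := proj d (ε⁻¹ • x)
    rw [← ENNReal.ofReal_mul (by positivity), ← ENNReal.ofReal_mul hε.le,
      Real.enorm_eq_ofReal_abs]
    refine ENNReal.ofReal_le_ofReal ?_
    rw [abs_mul, abs_of_pos hε]
    refine mul_le_mul_of_nonneg_left ?_ hε.le
    have t1 : |∑ j, κ j τ * pd j φ x| ≤ (∑ j, |κ j τ|) * C₁ := abs_sum_mul_le fun j => hC₁ j x
    have t0 : |∑ i, ∑ j, χ i j τ * pd i (pd j φ) x| ≤ (∑ i, ∑ j, |χ i j τ|) * C₀ := by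
      refine (Finset.abs_sum_le_sum_abs _ _).trans ?_
      rw [Finset.sum_mul]
      exact Finset.sum_le_sum fun i _ => abs_sum_mul_le fun j => hC₀ (i, j) x
    have t0' : |ε * ∑ i, ∑ j, χ i j τ * pd i (pd j φ) x| ≤ (∑ i, ∑ j, |χ i j τ|) * C₀ := by
      rw [abs_mul, abs_of_pos hε]
      exact (mul_le_of_le_one_left (abs_nonneg _) hε1).trans t0
    refine (abs_add_le _ _).trans ((add_le_add t1 t0').trans ?_)
    have hk : 0 ≤ ∑ j, |κ j τ| := by positivity
    have hx : 0 ≤ ∑ i, ∑ j, |χ i j τ| := by positivity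
    unfold corrSize
    generalize (∑ j, |κ j τ|) = A at *
    generalize (∑ i, ∑ j, |χ i j τ|) = B at *
    have : 0 ≤ C₁ + C₀ + A * C₀ + B * C₁ := by positivity
    linarith
  · have hv : ∀ ψ : E d → ℝ, tsupport ψ ⊆ tsupport φ → ψ x = 0 := fun ψ hψ =>
      image_eq_zero_of_notMem_tsupport fun h => hx (hR (hψ h))
    have e1 := fun j => hv (pd j φ) (tsupport_pd_subset φ j)
    have e2 := fun i j => hv (pd i (pd j φ))
      ((tsupport_pd_subset _ i).trans (tsupport_pd_subset φ j))
    simp [heq, e1, e2]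

theorem lintegral_corrSize_sq_ne_top (hκ : ∀ j, MemLp (κ j) 2) (hχ : ∀ i j, MemLp (χ i j) 2) :
    ∫⁻ t, ENNReal.ofReal (corrSize κ χ t) ^ 2 ≠ ⊤ := by
  have h := lintegral_sq_lt_top (memLp_corrSize hκ hχ)
  refine (lt_of_le_of_lt (lintegral_mono fun t => ?_) h).ne
  rw [Real.enorm_of_nonneg (corrSize_pos t).le]

/-- The correction is ε times L² correctors oscillating at scale ε on a fixed ball, and their L²
norms there are bounded uniformly in ε by averaging. -/
theorem tendsto_ansatz_sub (hκm : ∀ j, Measurable (κ j)) (hχm : ∀ i j, Measurable (χ i j))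
    (hκ : ∀ j, MemLp (κ j) 2) (hχ : ∀ i j, MemLp (χ i j) 2) {φ : E d → ℝ} (hφ : IsTest φ) :
    (∀ ε, 0 < ε → ε ≤ 1 → MemLp (fun x => ansatz κ χ φ ε x - φ x) 2) ∧
    Tendsto (fun ε => ∫⁻ x, ‖ansatz κ χ φ ε x - φ x‖ₑ ^ 2) (𝓝[>] 0) (𝓝 0) := by
  obtain ⟨C, R, h⟩ := exists_ansatz_sub_le hφ
  set p : Torus d → ℝ≥0∞ := fun t => ENNReal.ofReal (corrSize κ χ t) ^ 2 with hp
  have hpm : Measurable p := (measurable_corrSize hκm hχm).ennreal_ofReal.pow_const 2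
  have hpi : ∫⁻ t, p t ≠ ⊤ := lintegral_corrSize_sq_ne_top hκ hχ
  set K := ENNReal.ofReal C ^ 2 * ((∫⁻ t, p t) * volume (Metric.closedBall (0 : E d) (R + d)))
  have hK : K ≠ ⊤ := ENNReal.mul_ne_top (by simp)
    (ENNReal.mul_ne_top hpi measure_closedBall_lt_top.ne)
  have hle : ∀ ε, 0 < ε → ε ≤ 1 → ∫⁻ x, ‖ansatz κ χ φ ε x - φ x‖ₑ ^ 2 ≤
      ENNReal.ofReal ε ^ 2 * K := by
    intro ε hε hε1
    calc _ ≤ ∫⁻ x, ENNReal.ofReal ε ^ 2 * (ENNReal.ofReal C ^ 2 *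
          (p (proj d (ε⁻¹ • x) - 0) * ballInd R x)) := by
          refine lintegral_mono fun x => (pow_le_pow_left' (h κ χ ε hε hε1 x) 2).trans_eq ?_
          rw [mul_pow, mul_pow, mul_pow, ballInd_sq, sub_zero]
      _ ≤ _ := by
          rw [lintegral_const_mul' _ _ (by simp), lintegral_const_mul' _ _ (by simp)]
          exact mul_le_mul' le_rfl (mul_le_mul' le_rfl
            (lintegral_proj_mul_ballInd_le hpm R hε hε1 0))
  refine ⟨fun ε hε hε1 => ⟨((aesm_ansatz hκm hχm hφ ε).sub
    hφ.smooth.continuous.measurable).aestronglyMeasurable, ?_⟩, ?_⟩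
  · rw [eLpNorm_lt_top_iff_lintegral_rpow_enorm_lt_top (by norm_num) (by norm_num)]
    simpa using (hle ε hε hε1).trans_lt (ENNReal.mul_lt_top (by simp) hK.lt_top)
  · have h1 : ∀ᶠ ε in 𝓝[>] (0 : ℝ), ε ≤ 1 := nhdsWithin_le_nhds (Iic_mem_nhds (by norm_num))
    refine tendsto_of_tendsto_of_tendsto_of_le_of_le' tendsto_const_nhds ?_
      (Eventually.of_forall fun ε => zero_le)
      (by filter_upwards [self_mem_nhdsWithin, h1] with ε hε hε1 using hle ε hε hε1)
    have h2 : Tendsto (fun ε : ℝ => ENNReal.ofReal ε ^ 2) (𝓝[>] 0)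
        (𝓝 (ENNReal.ofReal 0 ^ 2)) := by
      refine Tendsto.mono_left (Continuous.tendsto ?_ 0) nhdsWithin_le_nhds
      exact (ENNReal.continuous_pow 2).comp ENNReal.continuous_ofReal
    simpa using ENNReal.Tendsto.mul_const h2 (Or.inr hK)

/-- The integrated remainder. -/
def intRem (a : E d → ℝ) (m : Torus d → ℝ) (κ : Fin d → Torus d → ℝ)
    (χ : Fin d → Fin d → Torus d → ℝ) (φ : E d → ℝ) (ε : ℝ) (x : E d) : ℝ :=
  ∫ z, m (proj d (ε⁻¹ • x) - proj d z) * expRem κ χ φ ε x z ∂(kernelMeasure a)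

theorem tendsto_intRem (ha : IsKernel a) (hm : IsCoeff m α₁ α₂) (hκm : ∀ j, Measurable (κ j))
    (hχm : ∀ i j, Measurable (χ i j)) (hκ : ∀ j, MemLp (κ j) 2) (hχ : ∀ i j, MemLp (χ i j) 2)
    {φ : E d → ℝ} (hφ : IsTest φ) :
    Tendsto (fun ε => ∫⁻ x, ‖intRem a m κ χ φ ε x‖ₑ ^ 2) (𝓝[>] 0) (𝓝 0) := by
  obtain ⟨C, R, hC, h⟩ := exists_expRem_le hφ
  set p : Torus d → ℝ≥0∞ := fun t => ENNReal.ofReal (corrSize κ χ t) with hp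
  have hpm : Measurable p := (measurable_corrSize hκm hχm).ennreal_ofReal
  have hT := tendsto_remainder ha hpm (lintegral_corrSize_sq_ne_top hκ hχ) R
  set K := ENNReal.ofReal α₂ * ENNReal.ofReal C with hKdef
  have hK : K ≠ ⊤ := ENNReal.mul_ne_top (by simp) (by simp)
  have hle : ∀ ε, 0 < ε → ∫⁻ x, ‖intRem a m κ χ φ ε x‖ₑ ^ 2 ≤ K ^ 2 *
      ∫⁻ x, (∫⁻ z, ENNReal.ofReal (weight z) * remBound p R ε x z ∂(kernelMeasure a)) ^ 2 := by
    intro ε hε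
    rw [← lintegral_const_mul' _ _ (ENNReal.pow_ne_top hK)]
    refine lintegral_mono fun x => ?_
    rw [← mul_pow, ← lintegral_const_mul' _ _ hK]
    refine pow_le_pow_left' ((enorm_integral_le_lintegral_enorm _).trans
      (lintegral_mono fun z => ?_)) 2
    rw [enorm_mul, hKdef, mul_assoc]
    refine mul_le_mul' ?_ (h κ χ ε hε x z)
    rw [Real.enorm_eq_ofReal_abs]
    exact ENNReal.ofReal_le_ofReal (hm.abs_le _)
  refine tendsto_of_tendsto_of_tendsto_of_le_of_le' tendsto_const_nhds ?_
    (Eventually.of_forall fun ε => zero_le)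
    (by filter_upwards [self_mem_nhdsWithin] with ε hε using hle ε hε)
  simpa using ENNReal.Tendsto.const_mul (a := K ^ 2) hT (Or.inr (ENNReal.pow_ne_top hK))

/-- Integrating `ansatz_sub` against m(τ − z) a(z) dz: the order ε term vanishes by the equation for
κ, and the order ε² term becomes ΘD²φ / l by the equation for χ. -/
theorem genFun_ansatz (ha : IsKernel a) (hm : IsCoeff m α₁ α₂)
    (hκ : IsTorusCorrector a m κ) (hχ : ∀ i j, MemLp (χ i j) 2)
    (hχe : ∀ i j, genFun (kernelMeasure a) (proj d) m (χ i j) =ᵐ[volume] corrRhs₂ a l m κ i j)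
    {φ : E d → ℝ} {ε : ℝ} (hε : 0 < ε)
    (hw : MemLp (ansatz κ χ φ ε) 2) :
    ∀ᵐ x : E d, genFun (kernelMeasure a) (dil d ε) (fun x => m (proj d (ε⁻¹ • x)))
      (ansatz κ χ φ ε) x = ε ^ 2 * (∑ i, ∑ j, torusMatrix a l m κ i j *
        (pd i (pd j φ) x / l (proj d (ε⁻¹ • x))) + intRem a m κ χ φ ε x) := by
  have := ha.finite
  have hq := quasiMeasurePreserving_proj_smul (d := d) hε.ne'
  have hmE : AEStronglyMeasurable fun x : E d => m (proj d (ε⁻¹ • x)) :=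
    hm.meas.comp_quasiMeasurePreserving hq
  have G0 := (genFun_aux (ρ := kernelMeasure a) (measurable_dil (d := d) (ε := ε)) hmE
    (fun x => hm.abs_le _) hw).1
  have G1 := hq.ae ((ae_all_iff (ι := Fin d)).2 fun j =>
    (genFun_aux (ρ := kernelMeasure a) measurable_proj hm.meas hm.abs_le (hκ.memLp j)).1)
  have G1' := hq.ae ((ae_all_iff (ι := Fin d)).2 fun j => hκ.eq j)
  have G2 := hq.ae ((ae_all_iff (ι := Fin d)).2 fun i =>
    (ae_all_iff (ι := Fin d)).2 fun j =>
    (genFun_aux (ρ := kernelMeasure a) measurable_proj hm.meas hm.abs_le (hχ i j)).1)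
  have G2' := hq.ae ((ae_all_iff (ι := Fin d)).2 fun i =>
    (ae_all_iff (ι := Fin d)).2 fun j => hχe i j)
  have G3 := hq.ae ((ae_all_iff (ι := Fin d)).2 fun i =>
    (ae_all_iff (ι := Fin d)).2 fun j => (hκ.corrRhs₂_aux ha hm i j).1)
  have G4 : ∀ᵐ x : E d, ∀ j, Integrable
      (fun z => z j * m (proj d (ε⁻¹ • x) - proj d z)) (kernelMeasure a) := by
    refine hq.ae (p := fun t => ∀ j : Fin d, Integrable (fun z => z j * m (t - proj d z))
      (kernelMeasure a)) (ae_all_iff.2 fun j => ?_)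
    exact (memLp_weighted (ρ := kernelMeasure a) measurable_proj
      (F := fun y => y.2 j * m (y.1 - proj d y.2)) ((aesm_coord j).mul
      (aesm_sub measurable_proj hm.meas)) ha.integrable_weight hm.memLp fun y => by
        rw [abs_mul]
        exact mul_le_mul_of_nonneg_right (abs_coord_le_weight _ _) (abs_nonneg _)).1
  filter_upwards [G0, G1, G1', G2, G2', G3, G4] with x g0 g1 g1' g2 g2' g3 g4
  simp only [dil_apply, proj_smul_sub hε.ne'] at g0
  rw [genFun, intRem]
  simp only [dil_apply, proj_smul_sub hε.ne']
  set τ := proj d (ε⁻¹ • x) with hτ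
  have hexp : ∀ z, m (τ - proj d z) * (ansatz κ χ φ ε (x - ε • z) - ansatz κ χ φ ε x) =
      ε ^ 2 * (m (τ - proj d z) * expRem κ χ φ ε x z) +
      (∑ j, ε * pd j φ x * (m (τ - proj d z) * (κ j (τ - proj d z) - κ j τ) -
        z j * m (τ - proj d z)) +
      ∑ i, ∑ j, ε ^ 2 * pd i (pd j φ) x *
        (m (τ - proj d z) * (1 / 2 * (z i * z j) - z i * κ j (τ - proj d z)) +
        m (τ - proj d z) * (χ i j (τ - proj d z) - χ i j τ))) := by
    intro z
    rw [ansatz_sub φ hε.ne', ← hτ, mul_add, mul_add, Finset.mul_sum, Finset.mul_sum, add_assoc]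
    congr 1
    · ring
    · congr 1
      · exact Finset.sum_congr rfl fun j _ => by ring
      · refine Finset.sum_congr rfl fun i _ => ?_
        rw [Finset.mul_sum]
        exact Finset.sum_congr rfl fun j _ => by ring
  have i1 : ∀ j, Integrable (fun z => ε * pd j φ x * (m (τ - proj d z) *
      (κ j (τ - proj d z) - κ j τ) - z j * m (τ - proj d z))) (kernelMeasure a) :=
    fun j => ((g1 j).sub (g4 j)).const_mul _
  have i2 : ∀ i j, Integrable (fun z => ε ^ 2 * pd i (pd j φ) x *
      (m (τ - proj d z) * (1 / 2 * (z i * z j) - z i * κ j (τ - proj d z)) +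
        m (τ - proj d z) * (χ i j (τ - proj d z) - χ i j τ))) (kernelMeasure a) :=
    fun i j => ((g3 i j).add (g2 i j)).const_mul _
  have i1s : Integrable (fun z => ∑ j, ε * pd j φ x * (m (τ - proj d z) *
      (κ j (τ - proj d z) - κ j τ) - z j * m (τ - proj d z))) (kernelMeasure a) :=
    integrable_finsetSum _ fun j _ => i1 j
  have i2s : Integrable (fun z => ∑ i, ∑ j, ε ^ 2 * pd i (pd j φ) x *
      (m (τ - proj d z) * (1 / 2 * (z i * z j) - z i * κ j (τ - proj d z)) +
        m (τ - proj d z) * (χ i j (τ - proj d z) - χ i j τ))) (kernelMeasure a) :=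
    integrable_finsetSum _ fun i _ => integrable_finsetSum _ fun j _ => i2 i j
  -- Integrability of the remainder is read off from the expansion, all other terms of which are
  -- integrable.
  have ir : Integrable (fun z => ε ^ 2 * (m (τ - proj d z) * expRem κ χ φ ε x z))
      (kernelMeasure a) := by
    refine (g0.sub (i1s.add i2s)).congr (Eventually.of_forall fun z => ?_)
    simp only [Pi.sub_apply, Pi.add_apply, hexp]
    ring
  have v1 : ∀ j, ∫ z, ε * pd j φ x * (m (τ - proj d z) *
      (κ j (τ - proj d z) - κ j τ) - z j * m (τ - proj d z)) ∂(kernelMeasure a) = 0 := by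
    intro j
    rw [integral_const_mul, integral_sub (g1 j) (g4 j)]
    have h1 : ∫ z, m (τ - proj d z) * (κ j (τ - proj d z) - κ j τ) ∂(kernelMeasure a) =
      ∫ z, z j * m (τ - proj d z) ∂(kernelMeasure a) := g1' j
    rw [h1, sub_self, mul_zero]
  have v2 : ∀ i j, ∫ z, ε ^ 2 * pd i (pd j φ) x *
      (m (τ - proj d z) * (1 / 2 * (z i * z j) - z i * κ j (τ - proj d z)) +
        m (τ - proj d z) * (χ i j (τ - proj d z) - χ i j τ)) ∂(kernelMeasure a) =
      ε ^ 2 * (torusMatrix a l m κ i j * (pd i (pd j φ) x / l τ)) := by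
    intro i j
    rw [integral_const_mul, integral_add (g3 i j) (g2 i j)]
    have h1 : ∫ z, m (τ - proj d z) * (χ i j (τ - proj d z) - χ i j τ) ∂(kernelMeasure a) =
      torusMatrix a l m κ i j / l τ - ∫ z, m (τ - proj d z) *
      (1 / 2 * (z i * z j) - z i * κ j (τ - proj d z)) ∂(kernelMeasure a) := g2' i j
    rw [h1]; ring
  simp only [hexp]
  have i12 : Integrable (fun z => (∑ j, ε * pd j φ x * (m (τ - proj d z) *
      (κ j (τ - proj d z) - κ j τ) - z j * m (τ - proj d z))) +
      ∑ i, ∑ j, ε ^ 2 * pd i (pd j φ) x *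
      (m (τ - proj d z) * (1 / 2 * (z i * z j) - z i * κ j (τ - proj d z)) +
        m (τ - proj d z) * (χ i j (τ - proj d z) - χ i j τ))) (kernelMeasure a) := i1s.add i2s
  rw [integral_add ir i12, integral_add i1s i2s,
    integral_finsetSum _ fun j _ => i1 j,
    integral_finsetSum _ fun i _ => integrable_finsetSum _ fun j _ => i2 i j]
  simp only [v1, integral_finsetSum _ fun j _ => i2 _ j, v2, integral_const_mul]
  simp only [← Finset.mul_sum, Finset.sum_const_zero]
  ring

end

/-! ### Directional derivatives of test functions -/

section

variable {d : ℕ}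

theorem IsTest.add {φ ψ : E d → ℝ} (hφ : IsTest φ) (hψ : IsTest ψ) : IsTest (φ + ψ) :=
  ⟨hφ.smooth.add hψ.smooth, hφ.supp.add hψ.supp⟩

theorem IsTest.const_smul {φ : E d → ℝ} (c : ℝ) (hφ : IsTest φ) : IsTest (c • φ) :=
  ⟨hφ.smooth.const_smul c, hφ.supp.smul_left (f := fun _ => c)⟩

theorem IsTest.dir {φ : E d → ℝ} (hφ : IsTest φ) (v : E d) : IsTest fun x => fderiv ℝ φ x v :=
  ⟨(hφ.smooth.fderiv_right (m := ∞) (by simp)).clm_apply contDiff_const,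
    hφ.supp.fderiv_apply (𝕜 := ℝ) v⟩

theorem IsTest.differentiable {φ : E d → ℝ} (hφ : IsTest φ) : Differentiable ℝ φ :=
  hφ.smooth.differentiable (by simp)

theorem IsTest.integral_mul_dir {φ ψ : E d → ℝ} (hφ : IsTest φ) (hψ : IsTest ψ) (v : E d) :
    ∫ x, φ x * fderiv ℝ ψ x v = -∫ x, fderiv ℝ φ x v * ψ x :=
  integral_mul_fderiv_eq_neg_fderiv_mul_of_integrable
    ((hφ.dir v).memLp.integrable_mul hψ.memLp) (hφ.memLp.integrable_mul (hψ.dir v).memLp)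
    (hφ.memLp.integrable_mul hψ.memLp) (fun x _ => hφ.differentiable x)
    (fun x _ => hψ.differentiable x)

theorem dir_comm {φ : E d → ℝ} (hφ : ContDiff ℝ ∞ φ) (v w x : E d) :
    fderiv ℝ (fun y => fderiv ℝ φ y v) x w = fderiv ℝ (fun y => fderiv ℝ φ y w) x v := by
  have hd : DifferentiableAt ℝ (fderiv ℝ φ) x :=
    ((hφ.fderiv_right (m := ∞) (by simp)).differentiable (by simp)) x
  have h := (hφ.contDiffAt (x := x)).isSymmSndFDerivAt 
    (by rw [minSmoothness_of_isRCLikeNormedField]; exact WithTop.coe_le_coe.2 le_top)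
  rw [fderiv_clm_apply hd (differentiableAt_const v), fderiv_clm_apply hd (differentiableAt_const w)]
  simpa using h w v

variable (d) in
/-- The space of test functions. -/
def testSpace : Submodule ℝ (E d → ℝ) where
  carrier := {φ | IsTest φ}
  add_mem' := fun h h' => IsTest.add h h'
  zero_mem' := ⟨contDiff_const, HasCompactSupport.zero⟩
  smul_mem' := fun c _ h => IsTest.const_smul c h

theorem isTest_coe (φ : testSpace d) : IsTest φ.1 := φ.2

variable (d) in
/-- Test functions as elements of `L²`. -/
def testToL2 : testSpace d →ₗ[ℝ] L2 d where
  toFun φ := (isTest_coe φ).memLp.toLp φ.1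
  map_add' _ _ := rfl
  map_smul' _ _ := rfl

theorem coeFn_testToL2 (φ : testSpace d) : testToL2 d φ =ᵐ[volume] φ.1 :=
  MemLp.coeFn_toLp (isTest_coe φ).memLp

theorem inner_testToL2_right (u : L2 d) (φ : testSpace d) :
    inner ℝ u (testToL2 d φ) = ∫ x, u x * φ.1 x := by
  rw [inner_eq_integral_mul]
  refine integral_congr_ae ?_
  filter_upwards [coeFn_testToL2 φ] with x hx
  rw [hx]

theorem inner_testToL2 (φ ψ : testSpace d) :
    inner ℝ (testToL2 d φ) (testToL2 d ψ) = ∫ x, φ.1 x * ψ.1 x := by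
  rw [inner_testToL2_right]
  refine integral_congr_ae ?_
  filter_upwards [coeFn_testToL2 φ] with x hx
  rw [hx]

variable (d) in
/-- The directional derivative as an endomorphism of the space of test functions. -/
def dirDeriv : E d →ₗ[ℝ] Module.End ℝ (testSpace d) where
  toFun v :=
    { toFun := fun φ => ⟨fun x => fderiv ℝ φ.1 x v, (isTest_coe φ).dir v⟩
      map_add' := fun φ ψ => by
        ext x
        change fderiv ℝ (φ.1 + ψ.1) x v = fderiv ℝ φ.1 x v + fderiv ℝ ψ.1 x v
        rw [fderiv_add ((isTest_coe φ).differentiable x) ((isTest_coe ψ).differentiable x)]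
        rfl
      map_smul' := fun c φ => by
        ext x
        change fderiv ℝ (c • φ.1) x v = c * fderiv ℝ φ.1 x v
        rw [fderiv_const_smul ((isTest_coe φ).differentiable x)]
        rfl }
  map_add' v w := by
    ext φ x
    exact map_add _ _ _
  map_smul' c v := by
    ext φ x
    exact map_smul _ _ _

theorem dirDeriv_comm (v w : E d) (φ : testSpace d) :
    dirDeriv d v (dirDeriv d w φ) = dirDeriv d w (dirDeriv d v φ) := by
  ext x
  exact dir_comm (isTest_coe φ).smooth w v x

theorem inner_dirDeriv (v : E d) (φ ψ : testSpace d) :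
    inner ℝ (testToL2 d φ) (testToL2 d (dirDeriv d v ψ)) =
      -inner ℝ (testToL2 d (dirDeriv d v φ)) (testToL2 d ψ) := by
  rw [inner_testToL2, inner_testToL2]
  exact (isTest_coe φ).integral_mul_dir (isTest_coe ψ) v

/-! ### Elliptic estimates for test functions -/

/-- The constant coefficient operator `Θ^{ij} ∂_i ∂_j` on test functions. -/
def testOp (Θ : Matrix (Fin d) (Fin d) ℝ) : Module.End ℝ (testSpace d) :=
  ∑ i, ∑ j, Θ i j • (dirDeriv d (e i) * dirDeriv d (e j))

theorem testOp_apply (Θ : Matrix (Fin d) (Fin d) ℝ) (φ : testSpace d) :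
    testOp Θ φ = ∑ i, ∑ j, Θ i j • dirDeriv d (e i) (dirDeriv d (e j) φ) := by
  simp [testOp, LinearMap.sum_apply]

theorem testOp_apply_apply (Θ : Matrix (Fin d) (Fin d) ℝ) (φ : testSpace d) (x : E d) :
    (testOp Θ φ).1 x = ∑ i, ∑ j, Θ i j * pd i (pd j φ.1) x := by
  rw [testOp_apply]
  simp [Finset.sum_apply]
  rfl

/-- Θ is a sum of squares because it is positive, and the b_k span because it is invertible: Θ⁻¹Θ =
1 gives e_i = Σ_k (Θ⁻¹b_k)_i b_k. The operator thus becomes Σ_k ∂_{b_k}², to which integration by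
parts applies directly. -/
theorem exists_sum_vecMulVec {Θ : Matrix (Fin d) (Fin d) ℝ} (h : Θ.PosDef) :
    ∃ (n : ℕ) (b : Fin n → E d) (C : Fin d → Fin n → ℝ),
      (∀ i j, Θ i j = ∑ k, b k i * b k j) ∧ ∀ i, (e i : E d) = ∑ k, C i k • b k := by
  obtain ⟨n, v, hv⟩ := Matrix.posSemidef_iff_eq_sum_vecMulVec.1 h.posSemidef
  have h1 : ∀ i j, Θ i j = ∑ k, v k i * v k j := fun i j => by
    rw [hv, Matrix.sum_apply]
    simp [Matrix.vecMulVec_apply]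
  refine ⟨n, fun k => WithLp.toLp 2 (v k), fun i k => ∑ j, Θ⁻¹ i j * v k j, h1, fun i => ?_⟩
  ext l
  have h2 : Θ⁻¹ * Θ = 1 := Matrix.nonsing_inv_mul _ ((Matrix.isUnit_iff_isUnit_det _).1 h.isUnit)
  have h3 := congrFun (congrFun h2 i) l
  rw [Matrix.mul_apply, Matrix.one_apply] at h3
  simp only [h1, Finset.mul_sum] at h3
  rw [Finset.sum_comm] at h3
  simp only [PiLp.single_apply, WithLp.ofLp_sum, Finset.sum_apply, PiLp.smul_apply,
    smul_eq_mul, Finset.sum_mul, mul_assoc, eq_comm (a := l)]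
  exact h3.symm

theorem testOp_eq {Θ : Matrix (Fin d) (Fin d) ℝ} {n : ℕ} {b : Fin n → E d}
    (hb : ∀ i j, Θ i j = ∑ k, b k i * b k j) (φ : testSpace d) :
    testOp Θ φ = ∑ k, dirDeriv d (b k) (dirDeriv d (b k) φ) := by
  have h : ∀ k, b k = ∑ i, b k i • (e i : E d) := fun k => by
    ext j
    simp [Finset.sum_apply, Pi.single_apply]
  have h' : ∀ k, dirDeriv d (b k) (dirDeriv d (b k) φ) =
      ∑ i, ∑ j, (b k i * b k j) • dirDeriv d (e i) (dirDeriv d (e j) φ) := fun k => by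
    conv_lhs => rw [h k]
    simp only [map_sum, map_smul, LinearMap.sum_apply, LinearMap.smul_apply, Finset.smul_sum,
      smul_smul]
    exact Finset.sum_congr rfl fun i _ => Finset.sum_congr rfl fun j _ => by
      rw [dirDeriv_comm]
  simp only [h', testOp_apply, hb, Finset.sum_smul]
  exact (Finset.sum_comm.trans (Finset.sum_congr rfl fun i _ => Finset.sum_comm)).symm

theorem inner_testOp {Θ : Matrix (Fin d) (Fin d) ℝ} {n : ℕ} {b : Fin n → E d}
    (hb : ∀ i j, Θ i j = ∑ k, b k i * b k j) (φ : testSpace d) :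
    inner ℝ (testToL2 d φ) (testToL2 d (testOp Θ φ)) =
      -∑ k, ‖testToL2 d (dirDeriv d (b k) φ)‖ ^ 2 := by
  simp only [testOp_eq hb, map_sum, inner_sum, inner_dirDeriv, real_inner_self_eq_norm_sq,
    Finset.sum_neg_distrib]

/-- Two integrations by parts and commuting derivatives give ⟨D_k²φ, D_l²φ⟩ = ‖D_k D_l φ‖², so
second derivatives are controlled without a Fourier transform. -/
theorem norm_testOp_sq {Θ : Matrix (Fin d) (Fin d) ℝ} {n : ℕ} {b : Fin n → E d}
    (hb : ∀ i j, Θ i j = ∑ k, b k i * b k j) (φ : testSpace d) :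
    ‖testToL2 d (testOp Θ φ)‖ ^ 2 =
      ∑ k, ∑ l, ‖testToL2 d (dirDeriv d (b k) (dirDeriv d (b l) φ))‖ ^ 2 := by
  rw [← real_inner_self_eq_norm_sq]
  simp only [testOp_eq hb, map_sum, inner_sum, sum_inner]
  refine Finset.sum_congr rfl fun k _ => Finset.sum_congr rfl fun l _ => ?_
  have h : ∀ k l, inner ℝ (testToL2 d (dirDeriv d (b k) (dirDeriv d (b k) φ)))
      (testToL2 d (dirDeriv d (b l) (dirDeriv d (b l) φ))) =
      ‖testToL2 d (dirDeriv d (b k) (dirDeriv d (b l) φ))‖ ^ 2 := fun k l => by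
    rw [inner_dirDeriv, dirDeriv_comm (b l), ← inner_dirDeriv, dirDeriv_comm (b l),
      real_inner_self_eq_norm_sq]
  rw [h, dirDeriv_comm]

variable {Θ : Matrix (Fin d) (Fin d) ℝ} {m : ℝ}

/-- `Θ^{ij} ∂_i ∂_j - m` on test functions, with values in `L²`. -/
def shiftedOp (Θ : Matrix (Fin d) (Fin d) ℝ) (m : ℝ) : testSpace d →ₗ[ℝ] L2 d :=
  testToL2 d ∘ₗ testOp Θ - m • testToL2 d

/-- Dissipativity: the operator is nonpositive on test functions, so pairing with φ leaves at least
m‖φ‖². -/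
theorem norm_le_shiftedOp (hΘ : Θ.PosDef) (hm : 0 < m) (φ : testSpace d) :
    ‖testToL2 d φ‖ ≤ m⁻¹ * ‖shiftedOp Θ m φ‖ := by
  obtain ⟨n, b, -, hb, -⟩ := exists_sum_vecMulVec hΘ
  have h1 := inner_testOp hb φ
  have h2 : inner ℝ (testToL2 d φ) (shiftedOp Θ m φ) =
      inner ℝ (testToL2 d φ) (testToL2 d (testOp Θ φ)) - m * ‖testToL2 d φ‖ ^ 2 := by
    simp [shiftedOp, inner_sub_right, real_inner_smul_right]
  have h3 : 0 ≤ ∑ k, ‖testToL2 d (dirDeriv d (b k) φ)‖ ^ 2 :=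
    Finset.sum_nonneg fun k _ => by positivity
  have h4 := neg_le_of_abs_le (abs_real_inner_le_norm (testToL2 d φ) (shiftedOp Θ m φ))
  rw [← div_eq_inv_mul, le_div_iff₀ hm]
  rcases (norm_nonneg (testToL2 d φ)).eq_or_lt with h0 | h0
  · rw [← h0]; simp
  · refine le_of_mul_le_mul_left ?_ h0
    nlinarith

theorem norm_testOp_le (hΘ : Θ.PosDef) (hm : 0 < m) (φ : testSpace d) :
    ‖testToL2 d (testOp Θ φ)‖ ≤ 2 * ‖shiftedOp Θ m φ‖ := by
  have h1 : testToL2 d (testOp Θ φ) = shiftedOp Θ m φ + m • testToL2 d φ := by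
    simp [shiftedOp]
  have h2 := norm_le_shiftedOp hΘ hm φ
  rw [← div_eq_inv_mul, le_div_iff₀ hm] at h2
  rw [h1]
  refine (norm_add_le _ _).trans ?_
  rw [norm_smul, Real.norm_of_nonneg hm.le]
  linarith

/-- Each D_k D_l φ is one summand of the identity for ‖ΘD²φ‖², and coordinate derivatives are fixed
combinations of the D_k. -/
theorem exists_second_bound (hΘ : Θ.PosDef) (hm : 0 < m) : ∃ K, 0 ≤ K ∧ ∀ i j (φ : testSpace d),
    ‖testToL2 d (dirDeriv d (e i) (dirDeriv d (e j) φ))‖ ≤ K * ‖shiftedOp Θ m φ‖ := by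
  obtain ⟨n, b, C, hb, hC⟩ := exists_sum_vecMulVec hΘ
  have key : ∀ k l (φ : testSpace d), ‖testToL2 d (dirDeriv d (b k) (dirDeriv d (b l) φ))‖ ≤
      2 * ‖shiftedOp Θ m φ‖ := fun k l φ => by
    refine le_trans ?_ (norm_testOp_le hΘ hm φ)
    refine le_of_sq_le_sq ?_ (norm_nonneg _)
    rw [norm_testOp_sq hb]
    refine le_trans ?_ (Finset.single_le_sum (f := fun k => ∑ l, ‖testToL2 d (dirDeriv d (b k)
      (dirDeriv d (b l) φ))‖ ^ 2) (fun _ _ => by positivity) (Finset.mem_univ k))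
    exact Finset.single_le_sum (f := fun l => ‖testToL2 d (dirDeriv d (b k)
      (dirDeriv d (b l) φ))‖ ^ 2) (fun _ _ => by positivity) (Finset.mem_univ l)
  have h1 : ∀ i j (φ : testSpace d),
      ‖testToL2 d (dirDeriv d (e i) (dirDeriv d (e j) φ))‖ ≤
      (∑ k, ∑ l, |C j k| * |C i l| * 2) * ‖shiftedOp Θ m φ‖ := fun i j φ => by
    rw [hC i, hC j]
    simp only [map_sum, map_smul, LinearMap.sum_apply, LinearMap.smul_apply, Finset.smul_sum,
      smul_smul, Finset.sum_mul]
    refine (norm_sum_le _ _).trans (Finset.sum_le_sum fun k _ => (norm_sum_le _ _).trans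
      (Finset.sum_le_sum fun l _ => ?_))
    rw [norm_smul, norm_mul, mul_assoc _ (2 : ℝ)]
    exact mul_le_mul_of_nonneg_left (key l k φ) (by positivity)
  refine ⟨∑ i, ∑ j, ∑ k, ∑ l, |C j k| * |C i l| * 2, by positivity, fun i j φ =>
    (h1 i j φ).trans (mul_le_mul_of_nonneg_right ?_ (norm_nonneg _))⟩
  refine le_trans ?_ (Finset.single_le_sum (f := fun i => ∑ j, ∑ k, ∑ l, |C j k| * |C i l| * 2)
    (fun _ _ => by positivity) (Finset.mem_univ i))
  exact Finset.single_le_sum (f := fun j => ∑ k, ∑ l, |C j k| * |C i l| * 2)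
    (fun _ _ => by positivity) (Finset.mem_univ j)

/-- Interpolation: ‖∂_iφ‖² = −⟨φ, ∂_i²φ⟩. -/
theorem exists_first_bound (hΘ : Θ.PosDef) (hm : 0 < m) : ∃ K, ∀ i (φ : testSpace d),
    ‖testToL2 d (dirDeriv d (e i) φ)‖ ≤ K * ‖shiftedOp Θ m φ‖ := by
  obtain ⟨K, hK, h⟩ := exists_second_bound hΘ hm
  refine ⟨m⁻¹ + K, fun i φ => ?_⟩
  have hm' : 0 ≤ m⁻¹ := by positivity
  refine le_of_sq_le_sq ?_ (by positivity)
  have h1 : ‖testToL2 d (dirDeriv d (e i) φ)‖ ^ 2 =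
      -inner ℝ (testToL2 d φ) (testToL2 d (dirDeriv d (e i) (dirDeriv d (e i) φ))) := by
    rw [inner_dirDeriv, neg_neg, real_inner_self_eq_norm_sq]
  have h2 := neg_le_of_abs_le (abs_real_inner_le_norm (testToL2 d φ)
    (testToL2 d (dirDeriv d (e i) (dirDeriv d (e i) φ))))
  have h3 := mul_le_mul (norm_le_shiftedOp hΘ hm φ) (h i i φ) (norm_nonneg _) (by positivity)
  have h4 : 0 ≤ (m⁻¹ * ‖shiftedOp Θ m φ‖) * (K * ‖shiftedOp Θ m φ‖) := by positivity
  nlinarith [sq_nonneg (m⁻¹ * ‖shiftedOp Θ m φ‖), sq_nonneg (K * ‖shiftedOp Θ m φ‖)]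

end

/-! ### A maximum principle -/

section

/-- If c were positive, the second derivative test would make 0 a local minimum as well, so g would
be constant near 0 and c = 0. -/
theorem second_deriv_nonpos_of_isMax {g g' : ℝ → ℝ} {c : ℝ} (hg : ∀ t, HasDerivAt g (g' t) t)
    (hg' : HasDerivAt g' c 0) (hmax : ∀ t, g t ≤ g 0) : c ≤ 0 := by
  by_contra! hc
  have h1 : deriv g = g' := funext fun t => (hg t).deriv
  have h2 : IsLocalMax g 0 := Eventually.of_forall hmax
  have h3 : IsLocalMin g 0 := isLocalMin_of_deriv_deriv_pos (by rwa [h1, hg'.deriv])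
    h2.deriv_eq_zero (hg 0).continuousAt
  have h4 : g =ᶠ[𝓝 0] fun _ => g 0 := h3.mono fun t ht => le_antisymm (hmax t) ht
  have h5 : g' =ᶠ[𝓝 0] fun _ => 0 := by
    have := h4.deriv
    simpa [h1] using this
  have h6 := h5.deriv_eq
  rw [hg'.deriv] at h6
  simp at h6
  linarith

variable {d : ℕ}

/-- Subtracting δ‖x‖² makes the function, bounded above, attain its maximum at some y. There Σ H_k ≤
2δ Σ‖b_k‖², so mF(y) = O(δ); comparison with any x and δ → 0 conclude. Only derivatives along the
b_k are used. -/
theorem nonpos_of_sum_second_deriv_eq {n : ℕ} {b : Fin n → E d} {m M : ℝ} (hm : 0 < m)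
    {F : E d → ℝ} {G H : Fin n → E d → ℝ} (hF : Continuous F) (hM : ∀ x, F x ≤ M)
    (hG : ∀ k x (t : ℝ), HasDerivAt (fun t : ℝ => F (x + t • b k)) (G k (x + t • b k)) t)
    (hH : ∀ k x (t : ℝ), HasDerivAt (fun t : ℝ => G k (x + t • b k)) (H k (x + t • b k)) t)
    (heq : ∀ x, ∑ k, H k x = m * F x) (x : E d) : F x ≤ 0 := by
  set B := ∑ k, ‖b k‖ ^ 2 with hB
  have hB0 : 0 ≤ B := Finset.sum_nonneg fun k _ => by positivity
  have key : ∀ δ : ℝ, 0 < δ → F x ≤ δ * (2 * B / m + ‖x‖ ^ 2) := by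
    intro δ hδ
    have hV : Continuous fun y => F y - δ * ‖y‖ ^ 2 := by fun_prop
    have hlim : Tendsto (fun y : E d => F y - δ * ‖y‖ ^ 2) (cocompact _) atBot := by
      refine tendsto_atBot_mono (fun y => sub_le_sub_right (hM y) _) ?_
      have h1 : Tendsto (fun y : E d => δ * ‖y‖ ^ 2) (cocompact _) atTop :=
        ((tendsto_pow_atTop two_ne_zero).comp tendsto_norm_cocompact_atTop).const_mul_atTop hδ
      exact tendsto_atBot_add_const_left _ M (tendsto_neg_atTop_atBot.comp h1)
    obtain ⟨y, hy⟩ := hV.exists_forall_ge hlim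
    have h2 : ∀ k, H k y - δ * (2 * ‖b k‖ ^ 2) ≤ 0 := by
      intro k
      have e1 : ∀ t : ℝ, ‖y + t • b k‖ ^ 2 =
          ‖y‖ ^ 2 + t * (2 * inner ℝ y (b k)) + t ^ 2 * ‖b k‖ ^ 2 := fun t => by
        rw [norm_add_sq_real, real_inner_smul_right, norm_smul, mul_pow, Real.norm_eq_abs, sq_abs]
        ring
      refine second_deriv_nonpos_of_isMax
        (g := fun t => F (y + t • b k) - δ * ‖y + t • b k‖ ^ 2)
        (g' := fun t => G k (y + t • b k) - δ * (2 * inner ℝ y (b k) + 2 * t * ‖b k‖ ^ 2))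
        (fun t => ?_) ?_ (fun t => ?_)
      · simp only [e1]
        refine (hG k y t).sub (HasDerivAt.const_mul δ ?_)
        convert! (((hasDerivAt_id t).mul_const (2 * inner ℝ y (b k))).const_add (‖y‖ ^ 2)).add
          (((hasDerivAt_id t).pow 2).mul_const (‖b k‖ ^ 2)) using 1
        simp
      · have h3 := hH k y 0
        rw [zero_smul, add_zero] at h3
        refine h3.sub (HasDerivAt.const_mul δ ?_)
        convert! (((hasDerivAt_id (0 : ℝ)).const_mul 2).mul_const (‖b k‖ ^ 2)).const_add
          (2 * inner ℝ y (b k)) using 1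
        simp
      · simpa using hy (y + t • b k)
    have h3 : m * F y ≤ δ * (2 * B) := by
      rw [← heq, hB, Finset.mul_sum, Finset.mul_sum]
      exact Finset.sum_le_sum fun k _ => by linarith [h2 k]
    have h4 := hy x
    have h5 : F y ≤ δ * (2 * B / m) := by
      rw [← mul_div_assoc, le_div_iff₀ hm, mul_comm]; exact h3
    have h6 : 0 ≤ δ * ‖y‖ ^ 2 := by positivity
    rw [mul_add]
    linarith
  by_contra! hx
  set K := 2 * B / m + ‖x‖ ^ 2 with hK
  have hK0 : 0 ≤ K := by positivity
  -- This δ would give F(x) ≤ F(x) K/(K + 1), impossible for F(x) > 0.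
  have h := key (F x / (K + 1)) (by positivity)
  rw [div_mul_eq_mul_div, le_div_iff₀ (by positivity)] at h
  nlinarith

end

/-! ### Density of the range of the limit operator on test functions -/

section

variable {d : ℕ}

/-- Reflection of a test function at `x / 2`. -/
def reflect (x : E d) (ψ : testSpace d) : testSpace d :=
  ⟨fun t => ψ.1 (x - t), (isTest_coe ψ).smooth.comp (contDiff_const.sub contDiff_id),
    (isTest_coe ψ).supp.comp_homeomorph (Homeomorph.subLeft x)⟩

theorem dirDeriv_reflect (x v : E d) (ψ : testSpace d) :
    dirDeriv d v (reflect x ψ) = -reflect x (dirDeriv d v ψ) := by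
  ext t
  have h : HasFDerivAt (fun t => ψ.1 (x - t)) _ t :=
    ((isTest_coe ψ).differentiable (x - t)).hasFDerivAt.comp t ((hasFDerivAt_id t).const_sub x)
  change fderiv ℝ (fun t => ψ.1 (x - t)) t v = -(fderiv ℝ ψ.1 (x - t) v)
  rw [h.fderiv]
  simp

theorem reflect_neg (x : E d) (ψ : testSpace d) : reflect x (-ψ) = -reflect x ψ := rfl

theorem norm_testToL2_reflect (x : E d) (ψ : testSpace d) :
    ‖testToL2 d (reflect x ψ)‖ = ‖testToL2 d ψ‖ := by
  rw [← sq_eq_sq₀ (norm_nonneg _) (norm_nonneg _), ← real_inner_self_eq_norm_sq,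
    ← real_inner_self_eq_norm_sq, inner_testToL2, inner_testToL2]
  exact integral_sub_left_eq_self (fun t => ψ.1 t * ψ.1 t) volume x

/-- The convolution of an `L²` function with a test function. -/
def conv (w : L2 d) (ψ : testSpace d) (x : E d) : ℝ := inner ℝ w (testToL2 d (reflect x ψ))

theorem conv_eq (w : L2 d) (ψ : testSpace d) :
    conv w ψ = convolution (w : E d → ℝ) ψ.1 (ContinuousLinearMap.mul ℝ ℝ) volume :=
  funext fun _ => inner_testToL2_right _ _

theorem hasFDerivAt_conv (w : L2 d) (ψ : testSpace d) (x : E d) :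
    ∃ A : E d →L[ℝ] ℝ, HasFDerivAt (conv w ψ) A x ∧ ∀ v, A v = conv w (dirDeriv d v ψ) x := by
  have hw : LocallyIntegrable (w : E d → ℝ) volume := (Lp.memLp w).locallyIntegrable (by norm_num)
  have h := (isTest_coe ψ).supp.hasFDerivAt_convolution_right (ContinuousLinearMap.mul ℝ ℝ) hw
    ((isTest_coe ψ).smooth.of_le (by simp)) x
  rw [← conv_eq] at h
  refine ⟨_, h, fun v => ?_⟩
  rw [convolution_precompR_apply _ hw ((isTest_coe ψ).supp.fderiv ℝ)
    ((isTest_coe ψ).smooth.continuous_fderiv (by simp)), conv_eq]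
  rfl

theorem hasDerivAt_conv (w : L2 d) (ψ : testSpace d) (x b : E d) (t : ℝ) :
    HasDerivAt (fun t : ℝ => conv w ψ (x + t • b)) (conv w (dirDeriv d b ψ) (x + t • b)) t := by
  obtain ⟨A, hA, hAv⟩ := hasFDerivAt_conv w ψ (x + t • b)
  have h2 : HasDerivAt (fun t : ℝ => x + t • b) b t := by
    simpa using ((hasDerivAt_id t).smul_const b).const_add x
  rw [← hAv]
  exact hA.comp_hasDerivAt t h2

variable {Θ : Matrix (Fin d) (Fin d) ℝ} {m : ℝ}

/-- Orthogonality of w to the operator applied to reflected test functions says that w ∗ ψ solves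
ΘD²F = mF; the reflection sign cancels in second derivatives. Cauchy–Schwarz bounds F, so the
maximum principle applies. -/
theorem conv_nonpos (hΘ : Θ.PosDef) (hm : 0 < m) {w : L2 d}
    (hw : ∀ φ, inner ℝ w (shiftedOp Θ m φ) = 0) (ψ : testSpace d) (x : E d) : conv w ψ x ≤ 0 := by
  obtain ⟨n, b, -, hb, -⟩ := exists_sum_vecMulVec hΘ
  refine nonpos_of_sum_second_deriv_eq (b := b) (M := ‖w‖ * ‖testToL2 d ψ‖) hm
    (F := conv w ψ) (G := fun k => conv w (dirDeriv d (b k) ψ))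
    (H := fun k => conv w (dirDeriv d (b k) (dirDeriv d (b k) ψ))) ?_ ?_
    (fun k x t => hasDerivAt_conv w ψ x (b k) t) (fun k x t => hasDerivAt_conv w _ x (b k) t) ?_ x
  · refine continuous_iff_continuousAt.2 fun x => ?_
    obtain ⟨A, hA, -⟩ := hasFDerivAt_conv w ψ x
    exact hA.continuousAt
  · intro x
    rw [← norm_testToL2_reflect x]
    exact real_inner_le_norm _ _
  · intro x
    have h1 := hw (reflect x ψ)
    have h2 : ∑ k, conv w (dirDeriv d (b k) (dirDeriv d (b k) ψ)) x =
        inner ℝ w (testToL2 d (testOp Θ (reflect x ψ))) := by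
      simp only [testOp_eq hb, dirDeriv_reflect, map_neg, neg_neg, map_sum, inner_sum, conv]
    rw [h2]
    simp only [shiftedOp, LinearMap.sub_apply, LinearMap.comp_apply, LinearMap.smul_apply,
      inner_sub_right, real_inner_smul_right] at h1
    rw [conv]
    linarith

/-- For w orthogonal to the range, the sign result for ψ and −ψ makes all convolutions vanish; their
values at 0 are the pairings of w with all test functions. -/
theorem denseRange_shiftedOp (hΘ : Θ.PosDef) (hm : 0 < m) : DenseRange (shiftedOp Θ m) := by
  have h : (LinearMap.range (shiftedOp Θ m))ᗮ = ⊥ := by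
    rw [eq_bot_iff]
    intro w hw
    have hw' : ∀ φ, inner ℝ w (shiftedOp Θ m φ) = 0 := fun φ => by
      rw [real_inner_comm]; exact hw _ ⟨φ, rfl⟩
    have h0 : ∀ φ, inner ℝ w (testToL2 d φ) = 0 := by
      intro φ
      have h1 : φ = reflect 0 (reflect 0 φ) := by
        ext t
        simp [reflect]
      have h2 := conv_nonpos hΘ hm hw' (reflect 0 φ) 0
      have h3 := conv_nonpos hΘ hm hw' (-reflect 0 φ) 0
      rw [conv, ← h1] at h2
      rw [conv, reflect_neg, ← h1, map_neg, inner_neg_right] at h3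
      linarith
    rw [Submodule.mem_bot]
    refine Lp.ext ?_
    refine ae_eq_of_integral_contDiff_smul_eq ((Lp.memLp w).locallyIntegrable (by norm_num))
      ((Lp.memLp (0 : L2 d)).locallyIntegrable (by norm_num)) fun φ hφ hs => ?_
    have h1 := h0 ⟨φ, hφ, hs⟩
    have h2 : inner ℝ (0 : L2 d) (testToL2 d ⟨φ, hφ, hs⟩) = 0 := inner_zero_left _
    rw [inner_testToL2_right] at h1 h2
    simp only [smul_eq_mul, mul_comm (φ _)]
    exact h1.trans h2.symm
  have h1 := Submodule.topologicalClosure_eq_top_iff.2 h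
  have h2 := Submodule.dense_iff_topologicalClosure_eq_top.2 h1
  rwa [DenseRange, ← LinearMap.coe_range]

/-! ### The resolvent of the limit operator -/

theorem hasWeakPartial_iff {i : Fin d} {u g : L2 d} : HasWeakPartial i u g ↔
    ∀ φ, inner ℝ u (testToL2 d (dirDeriv d (e i) φ)) = -inner ℝ g (testToL2 d φ) := by
  constructor
  · intro h φ
    rw [inner_testToL2_right, inner_testToL2_right]
    exact h φ.1 (isTest_coe φ).smooth (isTest_coe φ).supp
  · intro h φ hφ hs
    have := h ⟨φ, hφ, hs⟩
    rwa [inner_testToL2_right, inner_testToL2_right] at this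

/-- Weak differentiation is a closed condition, so it passes from a dense set to all f by continuity
of U and G. -/
theorem hasWeakPartial_of_dense {F : testSpace d →ₗ[ℝ] L2 d} (hF : DenseRange F) {i : Fin d}
    {U G : L2 d →L[ℝ] L2 d} (h : ∀ φ, HasWeakPartial i (U (F φ)) (G (F φ))) (f : L2 d) :
    HasWeakPartial i (U f) (G f) := by
  rw [hasWeakPartial_iff]
  intro φ
  refine hF.induction_on (p := fun f => inner ℝ (U f) (testToL2 d (dirDeriv d (e i) φ)) =
    -inner ℝ (G f) (testToL2 d φ)) f (isClosed_eq (by fun_prop) (by fun_prop)) fun ψ => ?_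
  exact hasWeakPartial_iff.1 (h ψ) φ

theorem hasWeakPartial_testToL2 (i : Fin d) (φ : testSpace d) :
    HasWeakPartial i (testToL2 d φ) (testToL2 d (dirDeriv d (e i) φ)) :=
  hasWeakPartial_iff.2 fun ψ => inner_dirDeriv _ φ ψ

theorem limitOp_apply {u : L2 d} {H : Fin d → Fin d → L2 d} (h : HasWeakHessian u H)
    (hu : u ∈ (limitOp Θ).domain) : limitOp Θ ⟨u, hu⟩ = ∑ i, ∑ j, Θ i j • H i j := by
  have h1 : weakHessian ⟨u, hu⟩ = H := (weakHessian_spec ⟨u, hu⟩).unique h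
  rw [← h1]
  rfl

theorem HasWeakHessian.mem_domain {u : L2 d} {H : Fin d → Fin d → L2 d}
    (h : HasWeakHessian u H) : u ∈ (limitOp Θ).domain := ⟨H, h⟩

theorem inner_limitOp (hΘ : Θ.PosDef) (u : (limitOp Θ).domain) (φ : testSpace d) :
    inner ℝ (limitOp Θ u) (testToL2 d φ) = inner ℝ (u : L2 d) (testToL2 d (testOp Θ φ)) := by
  obtain ⟨u, hu⟩ := u
  obtain ⟨H, hW⟩ := id hu
  rw [limitOp_apply hW]
  obtain ⟨g, hg, hH⟩ := hW
  have h1 : ∀ i j, inner ℝ (H i j) (testToL2 d φ) =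
      inner ℝ u (testToL2 d (dirDeriv d (e j) (dirDeriv d (e i) φ))) := fun i j => by
    have e1 := hasWeakPartial_iff.1 (hH i j) φ
    have e2 := hasWeakPartial_iff.1 (hg j) (dirDeriv d (e i) φ)
    linarith
  simp only [testOp_apply, sum_inner, real_inner_smul_left, h1, map_sum, map_smul, inner_sum,
    real_inner_smul_right]
  rw [Finset.sum_comm]
  refine Finset.sum_congr rfl fun i _ => Finset.sum_congr rfl fun j _ => ?_
  have : Θ j i = Θ i j := by simpa using hΘ.isHermitian.apply i j
  rw [this]

/-- By the elliptic estimates, φ and its first and second derivatives depend boundedly on (L⁰ − m)φ,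
so all of them extend continuously from the dense range. The extensions stay weak derivatives of R
f, which places R f in H². -/
theorem exists_limit_resolvent (hΘ : Θ.PosDef) (hm : 0 < m) :
    ∃ R : L2 d →L[ℝ] L2 d, IsResolvent (limitOp Θ) m R ∧
      ∀ φ, R (shiftedOp Θ m φ) = testToL2 d φ := by
  have hd := denseRange_shiftedOp hΘ hm
  obtain ⟨K₁, hK₁⟩ := exists_first_bound hΘ hm
  obtain ⟨K₂, -, hK₂⟩ := exists_second_bound hΘ hm
  set F := shiftedOp Θ m with hF
  set R : L2 d →L[ℝ] L2 d := (testToL2 d).extendOfNorm F with hR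
  set G : Fin d → L2 d →L[ℝ] L2 d :=
    fun i => (testToL2 d ∘ₗ dirDeriv d (e i)).extendOfNorm F with hG
  set H : Fin d → Fin d → L2 d →L[ℝ] L2 d := fun i j =>
    (testToL2 d ∘ₗ (dirDeriv d (e i) * dirDeriv d (e j))).extendOfNorm F with hH
  have hRF : ∀ φ, R (F φ) = testToL2 d φ :=
    LinearMap.extendOfNorm_eq hd ⟨_, norm_le_shiftedOp hΘ hm⟩
  have hGF : ∀ i φ, G i (F φ) = testToL2 d (dirDeriv d (e i) φ) := fun i =>
    LinearMap.extendOfNorm_eq hd ⟨_, hK₁ i⟩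
  have hHF : ∀ i j φ, H i j (F φ) = testToL2 d (dirDeriv d (e i) (dirDeriv d (e j) φ)) :=
    fun i j => LinearMap.extendOfNorm_eq hd ⟨_, hK₂ i j⟩
  have hW : ∀ f, HasWeakHessian (R f) fun i j => H i j f := fun f =>
    ⟨fun j => G j f, fun j => hasWeakPartial_of_dense hd (fun φ => by
      rw [hRF, hGF]; exact hasWeakPartial_testToL2 j φ) f,
      fun i j => hasWeakPartial_of_dense hd (fun φ => by
      rw [hGF, hHF]; exact hasWeakPartial_testToL2 i _) f⟩
  have hsolve : ∀ f, ∃ h : R f ∈ (limitOp Θ).domain, limitOp Θ ⟨R f, h⟩ - m • R f = f := by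
    intro f
    refine ⟨(hW f).mem_domain, ?_⟩
    rw [limitOp_apply (hW f)]
    refine hd.induction_on (p := fun f => ∑ i, ∑ j, Θ i j • H i j f - m • R f = f) f
      (isClosed_eq (by fun_prop) (by fun_prop)) fun φ => ?_
    simp only [hRF, hHF]
    simp [hF, shiftedOp, testOp_apply]
  refine ⟨R, ⟨hsolve, fun u => ?_⟩, hRF⟩
  obtain ⟨h, hv⟩ := hsolve (limitOp Θ u - m • (u : L2 d))
  set v := R (limitOp Θ u - m • (u : L2 d)) with hvdef
  -- The left inverse property is uniqueness in H²: v and u have the same image, and moving the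
  -- symmetric operator onto test functions makes v − u orthogonal to a dense set.
  have horth : ∀ f, inner ℝ (v - u) f = 0 := by
    intro f
    refine hd.induction_on (p := fun f => inner ℝ (v - u) f = 0) f
      (isClosed_eq (by fun_prop) (by fun_prop)) fun φ => ?_
    have h1 := inner_limitOp hΘ u φ
    have h2 := inner_limitOp hΘ ⟨v, h⟩ φ
    have h3 := congrArg (fun f => inner ℝ f (testToL2 d φ)) hv
    simp only [inner_sub_left, real_inner_smul_left] at h3
    simp only [hF, shiftedOp, LinearMap.sub_apply, LinearMap.comp_apply, LinearMap.smul_apply,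
      inner_sub_left, inner_sub_right, real_inner_smul_right]
    linarith
  exact sub_eq_zero.1 (inner_self_eq_zero.1 (horth (v - u)))

end

/-! ### Strong resolvent convergence -/

section

variable {d : ℕ} {a mu lam : E d → ℝ} {α₁ α₂ : ℝ}

theorem norm_eq_sqrt_lintegral {u : L2 d} {f : E d → ℝ} (h : u =ᵐ[volume] f) :
    ‖u‖ = √(∫⁻ x, ‖f x‖ₑ ^ 2).toReal := by
  rw [Lp.norm_def, eLpNorm_congr_ae h, eLpNorm_eq_lintegral_rpow_enorm_toReal (by norm_num)
    (by norm_num), ENNReal.toReal_ofNat, ← ENNReal.toReal_rpow, ← Real.sqrt_eq_rpow]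
  simp

theorem tendsto_sqrt_toReal {A : ℝ → ℝ≥0∞} {l : Filter ℝ} (h : Tendsto A l (𝓝 0)) :
    Tendsto (fun ε => √(A ε).toReal) l (𝓝 0) := by
  have h1 := ((ENNReal.tendsto_toReal ENNReal.zero_ne_top).comp h).sqrt
  simpa using h1

/-- The consistency error of the two-scale ansatz. -/
def consistencyError (a lam mu : E d → ℝ) (κ : Fin d → Torus d → ℝ)
    (χ : Fin d → Fin d → Torus d → ℝ) (φ : E d → ℝ) (ε : ℝ) (x : E d) : ℝ :=
  lam (ε⁻¹ • x) * intRem a (fun t => mu (sec t)) κ χ φ ε x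

theorem exists_approx (ha : IsKernel a) (hper : IsPeriodic mu)
    (hm : IsCoeff (fun t => mu (sec t)) α₁ α₂) (hperl : IsPeriodic lam)
    (hl : IsCoeff (fun t => lam (sec t)) α₁ α₂) {κ : Fin d → Torus d → ℝ}
    (hκ : IsTorusCorrector a (fun t => mu (sec t)) κ) {χ : Fin d → Fin d → Torus d → ℝ}
    (hχ : ∀ i j, MemLp (χ i j) 2)
    (hχe : ∀ i j, genFun (kernelMeasure a) (proj d) (fun t => mu (sec t)) (χ i j) =ᵐ[volume]
      corrRhs₂ a (fun t => lam (sec t)) (fun t => mu (sec t)) κ i j)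
    (φ : testSpace d) {ε : ℝ} (hε : 0 < ε)
    (hw : MemLp (fun x => ansatz κ χ φ.1 ε x - φ.1 x) 2) :
    ∃ w : (rescaledOp a lam mu ε).domain,
      ‖(w : L2 d) - testToL2 d φ‖ = √(∫⁻ x, ‖ansatz κ χ φ.1 ε x - φ.1 x‖ₑ ^ 2).toReal ∧
      ‖rescaledOp a lam mu ε w - testToL2 d (testOp (torusMatrix a (fun t => lam (sec t))
        (fun t => mu (sec t)) κ) φ)‖ =
        √(∫⁻ x, ‖consistencyError a lam mu κ χ φ.1 ε x‖ₑ ^ 2).toReal := by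
  have := ha.finite
  have hw' : MemLp (ansatz κ χ φ.1 ε) 2 := by
    refine (hw.add (isTest_coe φ).memLp).ae_eq (Eventually.of_forall fun x => ?_)
    exact sub_add_cancel _ _
  refine ⟨⟨hw'.toLp _, inRescaledDomain ha hper hm hperl hl hε _⟩,
    norm_eq_sqrt_lintegral ?_, norm_eq_sqrt_lintegral ?_⟩
  · filter_upwards [Lp.coeFn_sub (hw'.toLp _) (testToL2 d φ), hw'.coeFn_toLp,
      coeFn_testToL2 φ] with x h1 h2 h3
    rw [h1, Pi.sub_apply, h2, h3]
  · refine (Lp.coeFn_sub _ _).trans ?_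
    have hg := genFun_congr (ρ := kernelMeasure a) (measurable_dil (d := d) (ε := ε))
      (m := fun x => mu (ε⁻¹ • x)) hw'.coeFn_toLp
    have hA := genFun_ansatz ha hm hκ hχ hχe hε hw'
    simp only [hper.comp_sec_proj, hperl.comp_sec_proj] at hA
    filter_upwards [coeFn_rescaledOp ha hε ⟨hw'.toLp _, inRescaledDomain ha hper hm hperl hl hε _⟩,
      coeFn_testToL2 (testOp (torusMatrix a (fun t => lam (sec t)) (fun t => mu (sec t)) κ) φ),
      hg, hA] with x h1 h2 h3 h4
    have hlx : lam (ε⁻¹ • x) ≠ 0 := by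
      rw [← hperl.comp_sec_proj]; exact (hl.pos' _).ne'
    rw [Pi.sub_apply, h1, h2, h3, h4, testOp_apply_apply, consistencyError]
    simp only [← mul_div_assoc, ← Finset.sum_div]
    rw [mul_left_comm, inv_mul_cancel_left₀ (by positivity), mul_add, mul_div_cancel₀ _ hlx]
    ring

/-- Consistency plus stability: the ansatz is L²-close to φ, its image under L^ε is close to ΘD²φ,
and the uniform resolvent bound turns these two facts into convergence. -/
theorem tendsto_resolvent_test (ha : IsKernel a) (hper : IsPeriodic mu)
    (hm : IsCoeff (fun t => mu (sec t)) α₁ α₂) (hperl : IsPeriodic lam)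
    (hl : IsCoeff (fun t => lam (sec t)) α₁ α₂) {κ : Fin d → Torus d → ℝ}
    (hκm : ∀ i, Measurable (κ i)) (hκ : IsTorusCorrector a (fun t => mu (sec t)) κ)
    {k C : ℝ} (hk : 0 < k) {R : ℝ → L2 d →L[ℝ] L2 d}
    (hR : ∀ ε, 0 < ε → IsResolvent (rescaledOp a lam mu ε) k (R ε) ∧ ‖R ε‖ ≤ C)
    (φ : testSpace d) :
    Tendsto (fun ε => ‖R ε (shiftedOp (torusMatrix a (fun t => lam (sec t))
      (fun t => mu (sec t)) κ) k φ) - testToL2 d φ‖) (𝓝[>] 0) (𝓝 0) := by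
  choose χ hχm hχ hχe using fun i j => hκ.exists_second ha hm hl i j
  obtain ⟨hw, hA⟩ := tendsto_ansatz_sub hκm hχm hκ.memLp hχ (isTest_coe φ)
  have hI := tendsto_intRem ha hm hκm hχm hκ.memLp hχ (isTest_coe φ)
  have hB : Tendsto (fun ε => ∫⁻ x, ‖consistencyError a lam mu κ χ φ.1 ε x‖ₑ ^ 2)
      (𝓝[>] 0) (𝓝 0) := by
    have h1 := ENNReal.Tendsto.const_mul (a := ENNReal.ofReal α₂ ^ 2) hI (Or.inr (by simp))
    rw [mul_zero] at h1
    refine tendsto_of_tendsto_of_tendsto_of_le_of_le tendsto_const_nhds h1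
      (fun ε => zero_le) fun ε => ?_
    simp only
    rw [← lintegral_const_mul' _ _ (by simp)]
    refine lintegral_mono fun x => ?_
    rw [← mul_pow, consistencyError, enorm_mul]
    refine pow_le_pow_left' (mul_le_mul' ?_ le_rfl) 2
    rw [Real.enorm_eq_ofReal_abs, ← hperl.comp_sec_proj]
    exact ENNReal.ofReal_le_ofReal (hl.abs_le _)
  have hA' := tendsto_sqrt_toReal hA
  have hlim := hA'.add (((tendsto_sqrt_toReal hB).add (hA'.const_mul k)).const_mul C)
  simp only [mul_zero, add_zero] at hlim
  have hev : ∀ᶠ ε in 𝓝[>] (0 : ℝ), ε ≤ 1 := nhdsWithin_le_nhds (Iic_mem_nhds (by norm_num))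
  refine tendsto_of_tendsto_of_tendsto_of_le_of_le' tendsto_const_nhds hlim
    (Eventually.of_forall fun ε => norm_nonneg _) ?_
  filter_upwards [self_mem_nhdsWithin, hev] with ε hε hε1
  obtain ⟨w, h1, h2⟩ := exists_approx ha hper hm hperl hl hκ hχ hχe φ hε (hw ε hε hε1)
  obtain ⟨⟨-, hR2⟩, hRC⟩ := hR ε hε
  set Θ := torusMatrix a (fun t => lam (sec t)) (fun t => mu (sec t)) κ
  set r := rescaledOp a lam mu ε w - testToL2 d (testOp Θ φ) with hr
  -- The data (L⁰ − k)φ differ from (L^ε − k)w by a small error, and R^ε inverts the latter exactly.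
  have h3 : R ε (shiftedOp Θ k φ) - testToL2 d φ = ((w : L2 d) - testToL2 d φ) -
      R ε (r - k • ((w : L2 d) - testToL2 d φ)) := by
    have h4 : shiftedOp Θ k φ = (rescaledOp a lam mu ε w - k • (w : L2 d)) -
        (r - k • ((w : L2 d) - testToL2 d φ)) := by
      simp only [shiftedOp, LinearMap.sub_apply, LinearMap.comp_apply, LinearMap.smul_apply, hr,
        smul_sub]
      abel
    rw [h4, map_sub, hR2 w]
    abel
  rw [h3, ← h1, ← h2]
  refine (norm_sub_le _ _).trans (add_le_add le_rfl ?_)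
  refine ((R ε).le_of_opNorm_le hRC _).trans
    (mul_le_mul_of_nonneg_left ?_ ((norm_nonneg _).trans hRC))
  refine (norm_sub_le _ _).trans_eq ?_
  rw [norm_smul, Real.norm_of_nonneg hk.le]

theorem tendsto_norm_sub_of_dense {V T : Type*} [NormedAddCommGroup V] [NormedSpace ℝ V]
    {F : T → V} (hF : DenseRange F) {R : ℝ → V →L[ℝ] V} {R₀ : V →L[ℝ] V} {C : ℝ} {l : Filter ℝ}
    (hR : ∀ᶠ ε in l, ‖R ε‖ ≤ C)
    (h : ∀ φ, Tendsto (fun ε => ‖R ε (F φ) - R₀ (F φ)‖) l (𝓝 0)) (f : V) :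
    Tendsto (fun ε => ‖R ε f - R₀ f‖) l (𝓝 0) := by
  rw [Metric.tendsto_nhds]
  intro δ hδ
  -- The absolute value and the + 1 keep K positive whatever the sign of C.
  set K := |C| + ‖R₀‖ + 1 with hK
  have hK0 : 0 < K := by positivity
  obtain ⟨φ, hφ⟩ := hF.exists_dist_lt f (ε := δ / (2 * K)) (by positivity)
  filter_upwards [hR, (Metric.tendsto_nhds.1 (h φ)) (δ / 2) (by positivity)] with ε h1 h2
  rw [Real.dist_0_eq_abs, abs_norm] at h2 ⊢
  rw [dist_eq_norm] at hφ
  have h3 : R ε f - R₀ f = R ε (f - F φ) - R₀ (f - F φ) + (R ε (F φ) - R₀ (F φ)) := by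
    rw [map_sub, map_sub]; abel
  have h4 : ‖R ε (f - F φ)‖ ≤ |C| * ‖f - F φ‖ :=
    (R ε).le_of_opNorm_le (h1.trans (le_abs_self C)) _
  have h5 : ‖R₀ (f - F φ)‖ ≤ ‖R₀‖ * ‖f - F φ‖ := R₀.le_opNorm _
  have h6 : K * ‖f - F φ‖ < δ / 2 := by
    rw [lt_div_iff₀ (by positivity)] at hφ
    linarith
  have h7 := norm_add_le (R ε (f - F φ) - R₀ (f - F φ)) (R ε (F φ) - R₀ (F φ))
  have h8 := norm_sub_le (R ε (f - F φ)) (R₀ (f - F φ))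
  have h9 := norm_nonneg (f - F φ)
  rw [h3]
  nlinarith

end

end NonlocalHomog

end

/-! ### Assembly of the homogenization theorem -/

theorem theorem1 {d : ℕ} (a lam mu : E d → ℝ)
    (ha_int : Integrable a) (ha_loc : LocallyIntegrable (fun z => a z ^ 2))
    (ha_nonneg : ∀ z, 0 ≤ a z) (ha_even : ∀ z, a (-z) = a z)
    (ha_pos : 0 < ∫ z, a z) (ha_moment : Integrable (fun z => ‖z‖ ^ 2 * a z))
    (hlam_meas : AEMeasurable lam) (hmu_meas : AEMeasurable mu)
    (hlam_per : IsPeriodic lam) (hmu_per : IsPeriodic mu)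
    (α₁ α₂ : ℝ) (hα₁ : 0 < α₁)
    (hlam : ∀ x, α₁ ≤ lam x ∧ lam x ≤ α₂) (hmu : ∀ x, α₁ ≤ mu x ∧ mu x ≤ α₂) :
    -- each `L^ε` is a bounded operator defined on the whole of `L²`
    (∀ ε : ℝ, 0 < ε → (rescaledOp a lam mu ε).domain = ⊤ ∧ Continuous (rescaledOp a lam mu ε)) ∧
    -- the corrector exists and is unique
    ∃ κ : Fin d → E d → ℝ, IsCorrector a mu κ ∧
      (∀ κ' : Fin d → E d → ℝ, IsCorrector a mu κ' → ∀ i, κ' i =ᵐ[volume] κ i) ∧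
      -- the integrals in the cell formula converge absolutely
      (∀ i j, Integrable (Function.uncurry (cellIntegrand₁ a mu i j))
          ((volume.restrict (unitCell d)).prod volume) ∧
        Integrable (Function.uncurry (cellIntegrand₂ a mu κ i j))
          ((volume.restrict (unitCell d)).prod volume)) ∧
      (effectiveMatrix a lam mu κ).PosDef ∧
      -- the resolvents exist and converge strongly
      ∀ m : ℝ, 0 < m → ∃ (R : ℝ → L2 d →L[ℝ] L2 d) (R₀ : L2 d →L[ℝ] L2 d),
        (∀ ε : ℝ, 0 < ε → IsResolvent (rescaledOp a lam mu ε) m (R ε)) ∧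
        IsResolvent (limitOp (effectiveMatrix a lam mu κ)) m R₀ ∧
        ∀ f : L2 d, Tendsto (fun ε => ‖R ε f - R₀ f‖) (𝓝[>] 0) (𝓝 0) := by
  have ha : IsKernel a := ⟨ha_int, ha_nonneg, ha_even, ha_pos, ha_moment⟩
  have hm := isCoeff_comp_sec hmu_meas hα₁ hmu
  have hl := isCoeff_comp_sec hlam_meas hα₁ hlam
  have hres := fun {k : ℝ} (hk : 0 < k) =>
    exists_rescaled_resolvent ha hmu_per hm hlam_per hl hk
  refine ⟨fun ε hε => ?_, ?_⟩
  -- Domain and continuity do not depend on the spectral parameter; 1 is an arbitrary choice.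
  · obtain ⟨C, hC⟩ := hres one_pos
    exact ⟨(hC ε hε).1, (hC ε hε).2.1⟩
  obtain ⟨κ, hκm, hκ⟩ := exists_torusCorrector ha hm
  refine ⟨fun i x => κ i (proj d x), isCorrector_comp_proj ha hmu_per hm hκ,
    fun κ' hκ' i => isCorrector_unique ha hmu_per hm hκ hκ' i,
    fun i j => integrable_cellIntegrands ha hmu_per hm hκ i j, ?_⟩
  rw [effectiveMatrix_eq ha hmu_per hlam_per hm hl hκ]
  have hΘ := hκ.posDef ha hm hl
  refine ⟨hΘ, fun k hk => ?_⟩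
  obtain ⟨C, hC⟩ := hres hk
  choose R hR using fun (ε : ℝ) (hε : 0 < ε) => (hC ε hε).2.2
  obtain ⟨R₀, hR₀, hR₀'⟩ := exists_limit_resolvent hΘ hk
  have hR' : ∀ ε : ℝ, 0 < ε → IsResolvent (rescaledOp a lam mu ε) k
      (if h : 0 < ε then R ε h else 0) ∧ ‖if h : 0 < ε then R ε h else 0‖ ≤ C := fun ε hε => by
    rw [dif_pos hε]
    exact hR ε hε
  refine ⟨fun ε => if h : 0 < ε then R ε h else 0, R₀, fun ε hε => (hR' ε hε).1, hR₀, fun f => ?_⟩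
  refine tendsto_norm_sub_of_dense (denseRange_shiftedOp hΘ hk)
    (R := fun ε => if h : 0 < ε then R ε h else 0) (C := C)
    (by filter_upwards [self_mem_nhdsWithin] with ε hε using (hR' ε hε).2) (fun φ => ?_) f
  rw [hR₀']
  exact tendsto_resolvent_test ha hmu_per hm hlam_per hl hκm hκ hk
    (R := fun ε => if h : 0 < ε then R ε h else 0) hR' φ
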